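/- Let $L\ge 2$, let $\mathbb T_L=\mathbb Z/L\mathbb Z$, and fix $\alpha>3$. Put $a(0)=1$, $a(n)=n^\alpha$ for $n\ge1$, $g(0)=0$ and $g(n)=a(n)/a(n-1)$ for $n\ge 1$. For $N\ge1$ let $E_N=\{\eta\in\mathbb N^{\mathbb T_L}:\sum_z\eta_z=N\}$, and let $\sigma^{z,w}\eta$ be $\eta$ with one particle moved from $z$ to $w$. The totally asymmetric zero range process on $E_N$ is the continuous-time Markov chain with generator $$(\mathcal L F)(\eta)=\sum_{z\in\mathbb T_L}g(\eta_z)\,\{F(\sigma^{z,z+1}\eta)-F(\eta)\}.$$ Its stationary probability measure is $\mu_N(\eta)=\dfrac{N^\alpha}{Z_N}\prod_{z}\dfrac1{a(\eta_z)}$, with $Z_N$ the normalizing constant. Let $\langle\cdot,\cdot\rangle$ be the scalar product of $L^2(\mu_N)$, let $(\mathcal L^* F)(\eta)=\sum_{z}g(\eta_z)\{F(\sigma^{z,z-1}\eta)-F(\eta)\}$ be the adjoint of $\mathcal L$, and let $\mathcal S=\frac12(\mathcal L+\mathcal L^*)$. Let $(\ell_N)_{N\ge1}$ be real numbers with $\ell_N\to\infty$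 and $\ell_N/N\to0$, and let $\mathcal E^z_N=\{\eta\in E_N:\eta_z\ge N-\ell_N\}$ for $z\in\mathbb T_L$. Fix $x\ne y$ in $\mathbb T_L$. For $f:E_N\to\mathbb R$ let $$\mathbb G^{x,y}(f)=\sup_h\big\{2\langle f,\mathcal L h\rangle-\langle h,(-\mathcal S)h\rangle\big\},$$ where the supremum is over all $h:E_N\to\mathbb R$ that are constant on $\mathcal E^x_N$, constant on $\mathcal E^y_N$, and equal to $0$ on $\bigcup_{z\ne x,y}\mathcal E^z_N$. Put $$\Gamma(\alpha)=\sum_{j\ge0}\frac1{a(j)},\qquad I_\alpha=\int_0^1u^\alpha(1-u)^\alpha\,du .$$ Then $$\lim_{N\to\infty}N^{1+\alpha}\inf_f\mathbb G^{x,y}(f)=\frac1{\Gamma(\alpha)\,I_\alpha}\,\frac{L-2}{L-1},$$ where the infimum is over all $f:E_N\to\mathbb R$ that are equal to $1$ on $\mathcal E^x_N$, equal to $0$ on $\bigcup_{z\ne x,y}\mathcal E^z_N$, and constant on $\mathcal E^y_N$. Moreover, let $\mathcal E_N=\bigcup_z\mathcal E^z_N$, and let $R^{\mathcal E}_N(\eta,\xi)=\lambda(\eta)\,\mathbf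 P_\eta[H^+_{\mathcal E_N}=H^+_{\xi}]$, for $\eta\neq\xi$ in $\mathcal E_N$, be the jump rates of the trace of the process on $\mathcal E_N$. Here $\lambda(\eta)=\sum_zg(\eta_z)$ is the total jump rate at $\eta$, $\mathbf P_\eta$ is the law of the process started from $\eta$, and $H^+_{\mathcal A}$ is the first return time to $\mathcal A$ (with $H^+_\xi=H^+_{\{\xi\}}$). With the mean jump rates $$r_N(\mathcal E^y_N,\mathcal E^x_N)=\frac1{\mu_N(\mathcal E^y_N)}\sum_{\eta\in\mathcal E^y_N}\sum_{\xi\in\mathcal E^x_N}\mu_N(\eta)\,R^{\mathcal E}_N(\eta,\xi)$$ one has $$\lim_{N\to\infty}N^{1+\alpha}\,r_N(\mathcal E^y_N,\mathcal E^x_N)=\frac1{\Gamma(\alpha)\,I_\alpha}.$$ -/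

import Mathlib

noncomputable section

namespace ZeroRange

open MeasureTheory ProbabilityTheory

/-- Configurations of particles on the discrete torus with `L` sites. -/
abbrev Config (L : ℕ) : Type := ZMod L → ℕ

/-- `a(n) = n ^ α` for `n ≥ 1`, and `a(0) = 1`. -/
def a (α : ℝ) (n : ℕ) : ℝ := if n = 0 then 1 else (n : ℝ) ^ α

/-- The jump rate: `g(0) = 0` and `g(n) = a(n) / a(n - 1)` for `n ≥ 1`. -/
def g (α : ℝ) (n : ℕ) : ℝ := if n = 0 then 0 else a α n / a α (n - 1)

/-- `σ^{x,y} η`: one particle is moved from `x` to `y`. It is only used with `η x > 0`, or with a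
vanishing factor `g (η x)` in front. -/
def move {L : ℕ} (x y : ZMod L) (η : Config L) : Config L :=
  fun z => if z = x then η x - 1 else if z = y then η y + 1 else η z

section Torus

variable {L : ℕ} [NeZero L]

/-- The generator of the totally asymmetric zero range process. -/
def gen (α : ℝ) (F : Config L → ℝ) (η : Config L) : ℝ :=
  ∑ x : ZMod L, g α (η x) * (F (move x (x + 1) η) - F η)

/-- The generator of the time-reversed process (particles jump to the left). -/
def genAdj (α : ℝ) (F : Config L → ℝ) (η : Config L) : ℝ :=
  ∑ x : ZMod L, g α (η x) * (F (move x (x - 1) η) - F η)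

/-- The symmetric part `S = (1/2) (𝓛 + 𝓛*)` of the generator. -/
def genSym (α : ℝ) (F : Config L → ℝ) (η : Config L) : ℝ :=
  (1 / 2) * (gen α F η + genAdj α F η)

/-- `E_N`: the configurations with `N` particles. -/
def confs (L : ℕ) [NeZero L] (N : ℕ) : Finset (Config L) :=
  Finset.piAntidiag Finset.univ N

/-- `1 / a(η) = ∏_x 1 / a(η_x)`. -/
def weight (α : ℝ) (η : Config L) : ℝ := ∏ x : ZMod L, 1 / a α (η x)

/-- The normalizing constant `Z_N = N ^ α ∑_{ζ ∈ E_N} 1 / a(ζ)`. -/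
def Z (L : ℕ) [NeZero L] (α : ℝ) (N : ℕ) : ℝ := (N : ℝ) ^ α * ∑ ζ ∈ confs L N, weight α ζ

/-- The stationary measure `μ_N` on `E_N`, given by its mass function (`N ≥ 1`). -/
def mu (α : ℝ) (N : ℕ) (η : Config L) : ℝ := (N : ℝ) ^ α / Z L α N * weight α η

/-- The scalar product of `L²(μ_N)`. It only sees the values of `F` and `G` on `E_N`, so that
functions on `E_N` may be represented by functions on all configurations. -/
def inner (α : ℝ) (N : ℕ) (F G : Config L → ℝ) : ℝ :=
  ∑ η ∈ confs L N, mu α N η * (F η * G η)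

/-- The well `𝓔^x_N`: configurations of `E_N` with `η_x ≥ N - ℓ_N` (here `l = ℓ_N`). -/
def well (N : ℕ) (l : ℝ) (x : ZMod L) : Finset (Config L) :=
  (confs L N).filter fun η => (N : ℝ) - l ≤ (η x : ℝ)

/-- `𝓔_N(A) = ⋃_{z ∈ A} 𝓔^z_N`. -/
def wells (N : ℕ) (l : ℝ) (A : Finset (ZMod L)) : Finset (Config L) :=
  A.biUnion (well N l)

/-- `F` is constant on `A`. -/
def ConstOn (A : Finset (Config L)) (F : Config L → ℝ) : Prop := ∃ c : ℝ, ∀ η ∈ A, F η = c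

/-- `sup_h {2 ⟨f, 𝓛 h⟩ - ⟨h, (-S) h⟩}` over the functions `h` which are constant on `A₁`, constant
on `A₂` and equal to `0` on `A₃`, as an extended real number. -/
def supFunctional (α : ℝ) (N : ℕ) (A₁ A₂ A₃ : Finset (Config L)) (f : Config L → ℝ) : EReal :=
  ⨆ h ∈ {h : Config L → ℝ | ConstOn A₁ h ∧ ConstOn A₂ h ∧ ∀ η ∈ A₃, h η = 0},
    ((2 * inner α N f (gen α h) - inner α N h (fun η => - genSym α h η) : ℝ) : EReal)

/-- The functional `𝔾^{x,y}`. -/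
def G (α : ℝ) (N : ℕ) (l : ℝ) (x y : ZMod L) (f : Config L → ℝ) : EReal :=
  supFunctional α N (well N l x) (well N l y)
    (wells N l (Finset.univ.filter fun z => z ≠ x ∧ z ≠ y)) f

/-- The infimum of `𝔾^{x,y}(f)` over the functions `f` which are equal to `1` on `𝓔^x_N`, equal
to `0` on `𝓔^z_N` for `z ≠ x, y`, and constant on `𝓔^y_N`. -/
def infG (α : ℝ) (N : ℕ) (l : ℝ) (x y : ZMod L) : EReal :=
  ⨅ f ∈ {f : Config L → ℝ | (∀ η ∈ well N l x, f η = 1) ∧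
      (∀ η ∈ wells N l (Finset.univ.filter fun z => z ≠ x ∧ z ≠ y), f η = 0) ∧
      ConstOn (well N l y) f},
    G α N l x y f

/-- The total jump rate (inverse mean holding time) of the process at `η`. -/
def totalRate (α : ℝ) (η : Config L) : ℝ := ∑ x : ZMod L, g α (η x)

/-- The law of the configuration after the first jump from `η`; the empty configuration, which
never jumps, stays put. -/
def jumpLaw (α : ℝ) (η : Config L) : Measure (Config L) :=
  if totalRate α η = 0 then Measure.dirac η
  else ∑ x : ZMod L,
    ENNReal.ofReal (g α (η x) / totalRate α η) • Measure.dirac (move x (x + 1) η)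

theorem a_pos (α : ℝ) (n : ℕ) : 0 < a α n := by
  unfold a
  split_ifs with h
  · exact one_pos
  · exact Real.rpow_pos_of_pos (by exact_mod_cast Nat.pos_of_ne_zero h) α

theorem g_nonneg (α : ℝ) (n : ℕ) : 0 ≤ g α n := by
  unfold g
  split_ifs with h
  · exact le_rfl
  · exact (div_pos (a_pos α n) (a_pos α (n - 1))).le

instance jumpLaw_isProbability (α : ℝ) (η : Config L) : IsProbabilityMeasure (jumpLaw α η) := by
  unfold jumpLaw
  split_ifs with h
  · infer_instance
  · have h0 : 0 ≤ totalRate α η := Finset.sum_nonneg fun x _ => g_nonneg α (η x)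
    constructor
    simp only [Measure.coe_finsetSum, Finset.sum_apply, Measure.smul_apply, measure_univ,
      smul_eq_mul, mul_one]
    rw [← ENNReal.ofReal_sum_of_nonneg fun x _ => div_nonneg (g_nonneg α (η x)) h0,
      ← Finset.sum_div]
    change ENNReal.ofReal (totalRate α η / totalRate α η) = 1
    rw [div_self h, ENNReal.ofReal_one]

/-- The transition kernel of the embedded jump chain. -/
def jumpKernel (L : ℕ) [NeZero L] (α : ℝ) : Kernel (Config L) (Config L) :=
  Kernel.ofFunOfCountable (jumpLaw α)

instance jumpKernel_isMarkov (α : ℝ) : IsMarkovKernel (jumpKernel L α) :=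
  ⟨fun η => jumpLaw_isProbability α η⟩

/-- The jump chain as a function of its past: only the present configuration matters. -/
def stepKernel (L : ℕ) [NeZero L] (α : ℝ) (n : ℕ) :
    Kernel ((i : Finset.Iic n) → Config L) (Config L) :=
  (jumpKernel L α).comap (fun p => p ⟨n, Finset.mem_Iic.2 le_rfl⟩) (measurable_pi_apply _)

instance stepKernel_isMarkov (α : ℝ) (n : ℕ) : IsMarkovKernel (stepKernel L α n) := by
  unfold stepKernel
  infer_instance

/-- The law, on the space of sequences of configurations, of the successive configurations visited
by the zero range process started from `η`. -/
def chainLaw (α : ℝ) (η : Config L) : Measure (ℕ → Config L) :=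
  Kernel.traj (X := fun _ => Config L) (stepKernel L α) 0 (fun _ => η)

/-- The event that the first return to `A` takes place at `ξ`, i.e. `H⁺_A = H⁺_ξ < ∞` for
`ξ ∈ A`. -/
def returnAt (A : Finset (Config L)) (ξ : Config L) : Set (ℕ → Config L) :=
  {ω | ∃ n, 1 ≤ n ∧ ω n = ξ ∧ ∀ m, 1 ≤ m → m < n → ω m ∉ A}

/-- The jump rates `R^A(η, ξ) = λ(η) P_η[H⁺_A = H⁺_ξ]`, `η ≠ ξ` in `A`, of the trace on `A` of
the zero range process: in the time spent in `A`, the trace leaves `η` at rate `λ(η)`, and it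
continues from the configuration at which the process first returns to `A`. -/
def traceRate (α : ℝ) (A : Finset (Config L)) (η ξ : Config L) : ℝ :=
  totalRate α η * (chainLaw α η).real (returnAt A ξ)

/-- The mean rate `r_N(𝓔^x_N, 𝓔^y_N)` at which the trace of the process on the union of all the
wells jumps from `𝓔^x_N` to `𝓔^y_N`. -/
def meanRate (α : ℝ) (N : ℕ) (l : ℝ) (x y : ZMod L) : ℝ :=
  1 / (∑ η ∈ well N l x, mu α N η) *
    ∑ η ∈ well N l x, ∑ ξ ∈ well N l y,
      mu α N η * traceRate α (wells N l Finset.univ) η ξ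

end Torus

/-- `Γ(α) = ∑_{j ≥ 0} 1 / a(j)`. -/
def Gam (α : ℝ) : ℝ := ∑' j : ℕ, 1 / a α j

/-- `I_α = ∫₀¹ u ^ α (1 - u) ^ α du`. -/
def I (α : ℝ) : ℝ := ∫ u in (0 : ℝ)..1, u ^ α * (1 - u) ^ α

end ZeroRange

end

noncomputable section

set_option linter.unusedSectionVars false

namespace ZeroRange

open MeasureTheory ProbabilityTheory Filter Topology

variable {L : ℕ} [NeZero L]

/-! ### Removing a particle -/

/-! Let h_w be the equilibrium potential of the well at w: 1 there, 0 on the other wells, harmonic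
elsewhere. Both limits come from the capacity matrix c(z,w) = ⟨1_{𝓔^z}, 𝓛 h_w⟩ (`capEntry`, up to
the factor N^α/Z_N). On 𝓔^y the function 𝓛 h_x is the rate at which the trace jumps to 𝓔^x, so the
mean rate is c(y,x)/μ_N(𝓔^y) (`meanRate_eq_capEntry`). The variational problem has for value the
Schur complement -(c(x,x) - c(y,x) c(x,y)/c(y,y)), the capacity after 𝓔^y is collapsed to a point
(`infG_eq`). The minimizer is the half-sum of the collapsed potentials of the process and of its
time reversal, and the latter is obtained by reflecting the torus (`bform_reflect`).

The entries are computed without knowing h_w in the bulk. Since h_w is harmonic off the wells, ⟨u, 𝓛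
h_w⟩ depends only on the values of u on the wells, so an indicator may be replaced by a test
function. Removing the jumping particle turns the form into a sum over ξ with N - 1 particles of
cycles z ↦ ξ + δ_z, all steps of a cycle having the weight of ξ (`bform`). In the tube between x and
w the test function is the primitive of s^α (1-s)^α at the fraction of particles on x, …, w - 1. On
a cycle it takes two values, differing by about (ξ_x ξ_w)^α / N^(1+2α). This cancels 1/(a(ξ_x)
a(ξ_w)) in the weight. The sum over the arc telescopes to h(ξ + δ_w) - h(ξ + δ_x), with a
coefficient depending only on the other sites, and the sum over ξ telescopes again along the tube,
leaving the values of h on the two wells (`sum_flowCoef`).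

The error is treated by Cauchy–Schwarz: the squared gradient error is negligible
(`tendsto_scaled_err_sum`), and the energy of h_w is controlled by the test function itself
(`IsPotential.energy_le`). Dominated convergence over the remaining sites uses second moments of
1/a, hence α > 3. After scaling by N^(1+α), every off-diagonal entry tends to θ = 1/(L Γ I). Columns
sum to zero, so the diagonal entries tend to -(L-1)θ. The Schur complement is (L-1)θ - θ/(L-1) =
Lθ(L-2)/(L-1), and the mean rate is θ/(1/L). -/

/-- `ξ` with one particle added at `z`. -/
def addAt (ξ : Config L) (z : ZMod L) : Config L := ξ + Pi.single z 1

theorem mem_confs {N : ℕ} {η : Config L} : η ∈ confs L N ↔ ∑ z, η z = N := by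
  simp [confs]

@[simp] theorem addAt_same (ξ : Config L) (z : ZMod L) : addAt ξ z z = ξ z + 1 := by
  simp [addAt]

theorem addAt_of_ne (ξ : Config L) {z v : ZMod L} (h : v ≠ z) : addAt ξ z v = ξ v := by
  simp [addAt, h]

theorem addAt_apply (ξ : Config L) (z v : ZMod L) :
    addAt ξ z v = ξ v + if v = z then 1 else 0 := by
  by_cases h : v = z
  · subst h; simp
  · simp [addAt_of_ne _ h, h]

theorem le_addAt (ξ : Config L) (z v : ZMod L) : ξ v ≤ addAt ξ z v := by
  rw [addAt_apply]; exact Nat.le_add_right _ _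

theorem addAt_le (ξ : Config L) (z v : ZMod L) : addAt ξ z v ≤ ξ v + 1 := by
  rw [addAt_apply]; split_ifs <;> omega

theorem sum_addAt (ξ : Config L) (z : ZMod L) (s : Finset (ZMod L)) :
    ∑ v ∈ s, addAt ξ z v = ∑ v ∈ s, ξ v + if z ∈ s then 1 else 0 := by
  simp only [addAt_apply, Finset.sum_add_distrib, Finset.sum_ite_eq']

theorem addAt_mem_confs {n : ℕ} {ξ : Config L} (h : ξ ∈ confs L n) (z : ZMod L) :
    addAt ξ z ∈ confs L (n + 1) := by
  rw [mem_confs] at h ⊢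
  rw [sum_addAt, h]; simp

theorem move_addAt (ξ : Config L) {z w : ZMod L} (h : z ≠ w) :
    move z w (addAt ξ z) = addAt ξ w := by
  funext v
  unfold move
  by_cases h1 : v = z
  · subst h1; simp [addAt_of_ne _ h]
  · by_cases h2 : v = w
    · subst h2; simp [h1, addAt_of_ne _ h1]
    · simp [h1, h2, addAt_of_ne]

theorem addAt_injective (z : ZMod L) : Function.Injective fun ξ : Config L => addAt ξ z :=
  fun _ _ h => add_right_cancel h

theorem weight_pos (α : ℝ) (η : Config L) : 0 < weight α η :=
  Finset.prod_pos fun x _ => one_div_pos.2 (a_pos α (η x))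

/-- The ratio form of g makes the product measure stationary: the flux out of ξ + δ_z through z does
not depend on z. -/
theorem weight_mul_g_addAt (α : ℝ) (ξ : Config L) (z : ZMod L) :
    weight α (addAt ξ z) * g α (addAt ξ z z) = weight α ξ := by
  unfold weight
  rw [← Finset.mul_prod_erase _ _ (Finset.mem_univ z),
    ← Finset.mul_prod_erase _ (fun x => 1 / a α (ξ x)) (Finset.mem_univ z)]
  have h : ∀ v ∈ Finset.univ.erase z, 1 / a α (addAt ξ z v) = 1 / a α (ξ v) := by
    intro v hv
    rw [addAt_of_ne _ (Finset.ne_of_mem_erase hv)]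
  rw [Finset.prod_congr rfl h, addAt_same]
  have h1 := (a_pos α (ξ z + 1)).ne'
  have h2 := (a_pos α (ξ z)).ne'
  simp only [g, Nat.add_eq_zero_iff, one_ne_zero, and_false, if_false, Nat.add_sub_cancel]
  field_simp

/-- Summation over configurations with a particle at `z`, in terms of the configuration of the
remaining particles. -/
theorem sum_confs_filter_pos (n : ℕ) (z : ZMod L) (Φ : Config L → ℝ) :
    ∑ η ∈ (confs L (n + 1)).filter (fun η => η z ≠ 0), Φ η = ∑ ξ ∈ confs L n, Φ (addAt ξ z) := by
  symm
  refine Finset.sum_bij (fun ξ _ => addAt ξ z) ?_ ?_ ?_ ?_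
  · intro ξ hξ
    simp [addAt_mem_confs hξ z]
  · intro ξ _ ξ' _ h
    exact addAt_injective z h
  · intro η hη
    rw [Finset.mem_filter, mem_confs] at hη
    have hadd : addAt (η - Pi.single z 1) z = η := by
      funext v
      by_cases h : v = z
      · subst h
        simp
        omega
      · rw [addAt_of_ne _ h]; simp [h]
    refine ⟨η - Pi.single z 1, ?_, hadd⟩
    have h1 := sum_addAt (η - Pi.single z 1) z Finset.univ
    rw [hadd, hη.1] at h1
    rw [mem_confs]
    simp only [Finset.mem_univ, if_true] at h1
    omega
  · intros; rfl

theorem sum_confs_weight_g (α : ℝ) (n : ℕ) (z : ZMod L) (Φ : Config L → ℝ) :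
    ∑ η ∈ confs L (n + 1), weight α η * (g α (η z) * Φ η) =
      ∑ ξ ∈ confs L n, weight α ξ * Φ (addAt ξ z) := by
  rw [← Finset.sum_filter_add_sum_filter_not (confs L (n + 1)) (fun η => η z ≠ 0)]
  rw [sum_confs_filter_pos]
  have h0 : ∑ η ∈ (confs L (n + 1)).filter (fun η => ¬ η z ≠ 0),
      weight α η * (g α (η z) * Φ η) = 0 := by
    refine Finset.sum_eq_zero fun η hη => ?_
    have : η z = 0 := by simpa using (Finset.mem_filter.1 hη).2
    simp [this, g]
  rw [h0, add_zero]
  refine Finset.sum_congr rfl fun ξ _ => ?_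
  rw [← mul_assoc, weight_mul_g_addAt]

/-- The non-symmetric Dirichlet form, as a sum over configurations from which a particle has been
removed. -/
def bform (α : ℝ) (n : ℕ) (u h : Config L → ℝ) : ℝ :=
  ∑ ξ ∈ confs L n, weight α ξ *
    ∑ z : ZMod L, u (addAt ξ z) * (h (addAt ξ (z + 1)) - h (addAt ξ z))

/-- Twice the (symmetric) Dirichlet form. -/
def energy (α : ℝ) (n : ℕ) (h : Config L → ℝ) : ℝ :=
  ∑ ξ ∈ confs L n, weight α ξ * ∑ z : ZMod L, (h (addAt ξ (z + 1)) - h (addAt ξ z)) ^ 2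

theorem energy_nonneg (α : ℝ) (n : ℕ) (h : Config L → ℝ) : 0 ≤ energy α n h :=
  Finset.sum_nonneg fun ξ _ => mul_nonneg (weight_pos α ξ).le
    (Finset.sum_nonneg fun _ _ => sq_nonneg _)

theorem sum_shift (F : ZMod L → ℝ) : ∑ z : ZMod L, F (z + 1) = ∑ z : ZMod L, F z :=
  Fintype.sum_equiv (Equiv.addRight 1) _ _ fun _ => rfl

/-- On each cycle the squares of h cancel after a shift, so only the symmetric part of the generator
survives on the diagonal. -/
theorem bform_self (α : ℝ) (n : ℕ) (h : Config L → ℝ) :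
    bform α n h h = -(1 / 2) * energy α n h := by
  unfold bform energy
  rw [Finset.mul_sum]
  refine Finset.sum_congr rfl fun ξ _ => ?_
  have h1 := sum_shift fun z => h (addAt ξ z) ^ 2
  have h2 : ∑ z : ZMod L, (h (addAt ξ (z + 1)) - h (addAt ξ z)) ^ 2 =
      ∑ z : ZMod L, h (addAt ξ (z + 1)) ^ 2 - ∑ z : ZMod L, h (addAt ξ z) ^ 2
        - 2 * ∑ z : ZMod L, h (addAt ξ z) * (h (addAt ξ (z + 1)) - h (addAt ξ z)) := by
    rw [Finset.mul_sum, ← Finset.sum_sub_distrib, ← Finset.sum_sub_distrib]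
    exact Finset.sum_congr rfl fun z _ => by ring
  rw [h2, h1]
  ring

/-- The factor `N ^ α / Z_N`. -/
def coefMu (L : ℕ) [NeZero L] (α : ℝ) (N : ℕ) : ℝ := (N : ℝ) ^ α / Z L α N

theorem inner_eq_coefMu_mul (α : ℝ) (N : ℕ) (F G : Config L → ℝ) :
    inner α N F G = coefMu L α N * ∑ η ∈ confs L N, weight α η * (F η * G η) := by
  unfold inner mu coefMu
  rw [Finset.mul_sum]
  exact Finset.sum_congr rfl fun η _ => by ring

/-- The map τ covers both jump directions. The condition z ≠ τ z is needed because `move z z` would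
lose a particle. -/
theorem sum_confs_weight_jump (α : ℝ) (n : ℕ) (u h : Config L → ℝ) (τ : ZMod L → ZMod L)
    (hτ : ∀ z, z ≠ τ z) :
    ∑ η ∈ confs L (n + 1), weight α η *
        (u η * ∑ z : ZMod L, g α (η z) * (h (move z (τ z) η) - h η)) =
      ∑ ξ ∈ confs L n, weight α ξ *
        ∑ z : ZMod L, u (addAt ξ z) * (h (addAt ξ (τ z)) - h (addAt ξ z)) := by
  simp only [Finset.mul_sum]
  rw [Finset.sum_comm, Finset.sum_comm (s := confs L n)]
  refine Finset.sum_congr rfl fun z _ => ?_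
  have := sum_confs_weight_g α n z fun η => u η * (h (move z (τ z) η) - h η)
  simp only [move_addAt _ (hτ z)] at this
  rw [← this]
  exact Finset.sum_congr rfl fun η _ => by ring

theorem one_ne_zero_of_two_le (hL : 2 ≤ L) : (1 : ZMod L) ≠ 0 := by
  have : Fact (1 < L) := ⟨hL⟩
  exact one_ne_zero

theorem inner_gen (hL : 2 ≤ L) (α : ℝ) (n : ℕ) (u h : Config L → ℝ) :
    inner α (n + 1) u (gen α h) = coefMu L α (n + 1) * bform α n u h := by
  rw [inner_eq_coefMu_mul]
  congr 1
  refine sum_confs_weight_jump α n u h (fun z => z + 1) fun z hz => ?_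
  exact one_ne_zero_of_two_le hL (by simpa using hz)

theorem inner_genAdj (hL : 2 ≤ L) (α : ℝ) (n : ℕ) (u h : Config L → ℝ) :
    inner α (n + 1) u (genAdj α h) = coefMu L α (n + 1) * bform α n h u := by
  rw [inner_eq_coefMu_mul]
  congr 1
  refine (sum_confs_weight_jump α n u h (fun z => z - 1) fun z hz => ?_).trans ?_
  · exact one_ne_zero_of_two_le hL (sub_eq_self.1 hz.symm)
  · refine Finset.sum_congr rfl fun ξ _ => ?_
    congr 1
    have h1 := sum_shift fun z => u (addAt ξ z) * h (addAt ξ (z - 1))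
    simp only [add_sub_cancel_right] at h1
    simp only [mul_sub, Finset.sum_sub_distrib]
    rw [← h1]
    congr 1 <;> exact Finset.sum_congr rfl fun z _ => by ring

theorem inner_genSym (hL : 2 ≤ L) (α : ℝ) (n : ℕ) (u h : Config L → ℝ) :
    inner α (n + 1) u (fun η => -genSym α h η) =
      -(1 / 2) * coefMu L α (n + 1) * (bform α n u h + bform α n h u) := by
  have h1 := inner_gen hL α n u h
  have h2 := inner_genAdj hL α n u h
  rw [mul_add, mul_assoc, mul_assoc, ← h1, ← h2]
  unfold inner genSym
  rw [← mul_add, ← Finset.sum_add_distrib, Finset.mul_sum]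
  exact Finset.sum_congr rfl fun η _ => by ring

/-! ### Bilinearity of the non-symmetric form. -/

theorem bform_add_right (α : ℝ) (n : ℕ) (u h k : Config L → ℝ) :
    bform α n u (fun η => h η + k η) = bform α n u h + bform α n u k := by
  unfold bform
  rw [← Finset.sum_add_distrib]
  refine Finset.sum_congr rfl fun ξ _ => ?_
  rw [← mul_add, ← Finset.sum_add_distrib]
  congr 1
  exact Finset.sum_congr rfl fun z _ => by ring

theorem bform_add_left (α : ℝ) (n : ℕ) (u v h : Config L → ℝ) :
    bform α n (fun η => u η + v η) h = bform α n u h + bform α n v h := by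
  unfold bform
  rw [← Finset.sum_add_distrib]
  refine Finset.sum_congr rfl fun ξ _ => ?_
  rw [← mul_add, ← Finset.sum_add_distrib]
  congr 1
  exact Finset.sum_congr rfl fun z _ => by ring

theorem bform_smul_right (α : ℝ) (n : ℕ) (c : ℝ) (u h : Config L → ℝ) :
    bform α n u (fun η => c * h η) = c * bform α n u h := by
  unfold bform
  rw [Finset.mul_sum]
  refine Finset.sum_congr rfl fun ξ _ => ?_
  rw [mul_left_comm, Finset.mul_sum (a := c)]
  congr 1
  exact Finset.sum_congr rfl fun z _ => by ring

theorem bform_smul_left (α : ℝ) (n : ℕ) (c : ℝ) (u h : Config L → ℝ) :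
    bform α n (fun η => c * u η) h = c * bform α n u h := by
  unfold bform
  rw [Finset.mul_sum]
  refine Finset.sum_congr rfl fun ξ _ => ?_
  rw [mul_left_comm, Finset.mul_sum (a := c)]
  congr 1
  exact Finset.sum_congr rfl fun z _ => by ring

/-- Constants do not contribute to the form. -/
theorem bform_const_left (α : ℝ) (n : ℕ) (c : ℝ) (h : Config L → ℝ) :
    bform α n (fun _ => c) h = 0 := by
  unfold bform
  refine Finset.sum_eq_zero fun ξ _ => ?_
  have h1 := sum_shift fun z => h (addAt ξ z)
  rw [← Finset.mul_sum, Finset.sum_sub_distrib, h1, sub_self, mul_zero, mul_zero]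

/-! ### The equilibrium potentials -/

open scoped ENNReal

/-- The transition operator of the jump chain, on non-negative functions. -/
def jumpOp (α : ℝ) (f : Config L → ℝ≥0∞) (η : Config L) : ℝ≥0∞ := ∫⁻ ζ, f ζ ∂jumpLaw α η

/-- The transition operator of the jump chain killed at `A`. -/
def killedOp (α : ℝ) (A : Finset (Config L)) (f : Config L → ℝ≥0∞) (η : Config L) : ℝ≥0∞ :=
  if η ∈ A then 0 else jumpOp α f η

/-! ### The Markov property and first returns of the jump chain. -/

theorem lintegral_traj_succ (α : ℝ) (n : ℕ) (p : (i : Finset.Iic n) → Config L)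
    (f : Config L → ℝ≥0∞) :
    ∫⁻ ω, f (ω (n + 1)) ∂(Kernel.traj (X := fun _ => Config L) (stepKernel L α) n p) =
      jumpOp α f (p ⟨n, Finset.mem_Iic.2 le_rfl⟩) := by
  have hf : Measurable f := measurable_of_countable f
  have h3 := congrArg (fun k => ∫⁻ ζ, f ζ ∂(k p))
    (Kernel.map_traj_succ_self (X := fun _ => Config L) (κ := stepKernel L α) (a := n))
  rw [Kernel.map_apply _ (measurable_pi_apply _)] at h3
  have hev : Measurable fun ω : ℕ → Config L => ω (n + 1) := measurable_pi_apply (n + 1)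
  exact (lintegral_map hf hev).symm.trans h3

/-- The Markov property at time n, read off from the disintegration of the path law into the path up
to time n and the trajectory after it. -/
theorem lintegral_chainLaw_step (α : ℝ) (η : Config L) (n : ℕ)
    (G : ((i : Finset.Iic n) → Config L) → ℝ≥0∞) (f : Config L → ℝ≥0∞) :
    ∫⁻ ω, G (Preorder.frestrictLe n ω) * f (ω (n + 1)) ∂chainLaw α η =
      ∫⁻ ω, G (Preorder.frestrictLe n ω) * jumpOp α f (ω n) ∂chainLaw α η := by
  have hG : Measurable G := measurable_of_countable G
  have hf : Measurable f := measurable_of_countable f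
  unfold chainLaw
  have key := Kernel.partialTraj_compProd_traj (X := fun _ => Config L) (κ := stepKernel L α)
    (a := 0) (b := n) (Nat.zero_le n) (fun _ => η)
  have h1 : ∫⁻ ω, G (Preorder.frestrictLe n ω) * f (ω (n + 1))
      ∂(Kernel.traj (X := fun _ => Config L) (stepKernel L α) 0 (fun _ => η)) =
      ∫⁻ q, G q.1 * f (q.2 (n + 1)) ∂((Kernel.traj (X := fun _ => Config L) (stepKernel L α) 0
        (fun _ => η)).map (fun x => (Preorder.frestrictLe n x, x))) := by
    rw [lintegral_map]
    · exact (hG.comp measurable_fst).mul (hf.comp ((measurable_pi_apply _).comp measurable_snd))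
    · fun_prop
  rw [h1, ← key, Measure.lintegral_compProd]
  · have h2 : ∫⁻ ω, G (Preorder.frestrictLe n ω) * jumpOp α f (ω n)
        ∂(Kernel.traj (X := fun _ => Config L) (stepKernel L α) 0 (fun _ => η)) =
        ∫⁻ p, G p * jumpOp α f (p ⟨n, Finset.mem_Iic.2 le_rfl⟩)
          ∂(Kernel.partialTraj (X := fun _ => Config L) (stepKernel L α) 0 n (fun _ => η)) := by
      rw [← Kernel.traj_map_frestrictLe_apply, lintegral_map]
      · rfl
      · exact measurable_of_countable _
      · fun_prop
    rw [h2]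
    refine lintegral_congr fun p => ?_
    have hm : Measurable fun b : ℕ → Config L => f (b (n + 1)) :=
      hf.comp (measurable_pi_apply (n + 1))
    exact (lintegral_const_mul (G p) hm).trans
      (congrArg (fun t => G p * t) (lintegral_traj_succ α n p f))
  · exact (hG.comp measurable_fst).mul (hf.comp ((measurable_pi_apply _).comp measurable_snd))

/-- The indicator function of the complement of `A`. -/
def offInd (A : Finset (Config L)) (ζ : Config L) : ℝ≥0∞ := if ζ ∈ A then 0 else 1

theorem lintegral_chainLaw_avoid (α : ℝ) (A : Finset (Config L)) (η : Config L) (n : ℕ)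
    (f : Config L → ℝ≥0∞) :
    ∫⁻ ω, (∏ m ∈ Finset.Icc 1 n, offInd A (ω m)) * f (ω (n + 1)) ∂chainLaw α η =
      jumpOp α ((killedOp α A)^[n] f) η := by
  induction n generalizing f with
  | zero =>
    simp only [Finset.Icc_eq_empty_of_lt zero_lt_one, Finset.prod_empty, one_mul,
      Function.iterate_zero, id_eq, zero_add]
    exact lintegral_traj_succ α 0 (fun _ => η) f
  | succ n ih =>
    -- The avoidance indicator has to be a function of the path up to time n + 1, hence the product
    -- over attached indices.
    have h1 := lintegral_chainLaw_step α η (n + 1)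
      (fun p => ∏ m ∈ (Finset.Icc 1 (n + 1)).attach,
        offInd A (p ⟨m.1, Finset.mem_Iic.2 (Finset.mem_Icc.1 m.2).2⟩)) f
    have h2 : ∀ ω : ℕ → Config L, (∏ m ∈ (Finset.Icc 1 (n + 1)).attach,
        offInd A (Preorder.frestrictLe (π := fun _ => Config L) (n + 1) ω
          ⟨m.1, Finset.mem_Iic.2 (Finset.mem_Icc.1 m.2).2⟩)) =
        ∏ m ∈ Finset.Icc 1 (n + 1), offInd A (ω m) := by
      intro ω
      exact Finset.prod_attach (Finset.Icc 1 (n + 1)) fun m => offInd A (ω m)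
    simp only [h2] at h1
    rw [h1, Function.iterate_succ_apply, ← ih (killedOp α A f)]
    refine lintegral_congr fun ω => ?_
    rw [Finset.prod_Icc_succ_top (by omega), mul_assoc]
    congr 1
    unfold killedOp offInd
    split_ifs <;> simp

/-- Decomposition according to the return time, whose value is shifted by one so that the index
starts at 0. -/
theorem chainLaw_returnAt (α : ℝ) (A : Finset (Config L)) {ξ : Config L} (hξ : ξ ∈ A)
    (η : Config L) :
    chainLaw α η (returnAt A ξ) =
      ∑' n, jumpOp α ((killedOp α A)^[n] (Set.indicator {ξ} 1)) η := by
  have hunion : returnAt A ξ =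
      ⋃ n : ℕ, {ω : ℕ → Config L | ω (n + 1) = ξ ∧ ∀ m ∈ Finset.Icc 1 n, ω m ∉ A} := by
    ext ω
    simp only [returnAt, Set.mem_ofPred_eq, Set.mem_iUnion, Finset.mem_Icc]
    constructor
    · rintro ⟨n, h1, h2, h3⟩
      obtain ⟨k, rfl⟩ : ∃ k, n = k + 1 := ⟨n - 1, by omega⟩
      exact ⟨k, h2, fun m hm => h3 m hm.1 (by omega)⟩
    · rintro ⟨n, h1, h2⟩
      exact ⟨n + 1, by omega, h1, fun m hm hm' => h2 m ⟨hm, by omega⟩⟩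
  have hset : ∀ n : ℕ, MeasurableSet
      {ω : ℕ → Config L | ω (n + 1) = ξ ∧ ∀ m ∈ Finset.Icc 1 n, ω m ∉ A} := by
    intro n
    have : {ω : ℕ → Config L | ω (n + 1) = ξ ∧ ∀ m ∈ Finset.Icc 1 n, ω m ∉ A} =
        ((fun ω : ℕ → Config L => ω (n + 1)) ⁻¹' {ξ}) ∩
          ⋂ m ∈ Finset.Icc 1 n, (fun ω : ℕ → Config L => ω m) ⁻¹' ((A : Set (Config L))ᶜ) := by
      ext ω; simp
    rw [this]
    refine (measurable_pi_apply _ (Set.to_countable _).measurableSet).inter ?_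
    exact Finset.measurableSet_biInter _ fun m _ =>
      measurable_pi_apply _ (Set.to_countable _).measurableSet
  rw [hunion, measure_iUnion]
  · refine tsum_congr fun n => ?_
    rw [← lintegral_chainLaw_avoid, ← lintegral_indicator_one (hset n)]
    refine lintegral_congr fun ω => ?_
    by_cases h : ∀ m ∈ Finset.Icc 1 n, ω m ∉ A
    · have h1 : ∏ m ∈ Finset.Icc 1 n, offInd A (ω m) = 1 :=
        Finset.prod_eq_one fun m hm => by simp [offInd, h m hm]
      rw [h1, one_mul]
      by_cases h2 : ω (n + 1) = ξ
      · rw [Set.indicator_of_mem (show ω ∈ {ω : ℕ → Config L | ω (n + 1) = ξ ∧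
          ∀ m ∈ Finset.Icc 1 n, ω m ∉ A} from ⟨h2, h⟩), Set.indicator_of_mem (by simpa using h2)]
        rfl
      · rw [Set.indicator_of_notMem fun h3 => h2 h3.1, Set.indicator_of_notMem (by simpa using h2)]
    · rw [Set.indicator_of_notMem fun h3 => h h3.2]
      push Not at h
      obtain ⟨m, hm, hmA⟩ := h
      rw [Finset.prod_eq_zero hm (by simp [offInd, hmA]), zero_mul]
  · intro i j hij
    wlog hlt : i < j generalizing i j
    · exact (this hij.symm (by omega)).symm
    refine Set.disjoint_left.2 fun ω h1 h2 => ?_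
    -- A return at time i + 1 is a visit to A, as ξ ∈ A, and excludes a later first return.
    exact h2.2 (i + 1) (Finset.mem_Icc.2 ⟨by omega, by omega⟩) (h1.1 ▸ hξ)
  · exact hset

/-- The first step decomposition of the return probabilities. -/
theorem chainLaw_returnAt_eq_jumpOp (α : ℝ) (A : Finset (Config L)) {ξ : Config L} (hξ : ξ ∈ A)
    (η : Config L) :
    chainLaw α η (returnAt A ξ) =
      jumpOp α (fun ζ => Set.indicator {ξ} 1 ζ +
        if ζ ∈ A then 0 else chainLaw α ζ (returnAt A ξ)) η := by
  rw [chainLaw_returnAt α A hξ, tsum_eq_zero_add' ENNReal.summable]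
  unfold jumpOp
  rw [lintegral_add_left (measurable_of_countable _)]
  simp only [Function.iterate_zero, id_eq, Function.iterate_succ_apply']
  congr 1
  rw [← lintegral_tsum fun n => (measurable_of_countable _).aemeasurable]
  refine lintegral_congr fun ζ => ?_
  unfold killedOp
  split_ifs with h
  · simp
  · rw [chainLaw_returnAt α A hξ]
    rfl

theorem jumpOp_toReal (α : ℝ) (f : Config L → ℝ≥0∞) (hf : ∀ ζ, f ζ ≠ ∞) (η : Config L) :
    totalRate α η * (jumpOp α f η).toReal =
      ∑ z : ZMod L, g α (η z) * (f (move z (z + 1) η)).toReal := by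
  by_cases h : totalRate α η = 0
  · have h0 : ∀ z, g α (η z) = 0 := fun z =>
      (Finset.sum_eq_zero_iff_of_nonneg fun x _ => g_nonneg α (η x)).1 h z (Finset.mem_univ z)
    simp [h, h0]
  · unfold jumpOp jumpLaw
    rw [if_neg h, lintegral_finsetSum_measure, ENNReal.toReal_sum]
    · rw [Finset.mul_sum]
      refine Finset.sum_congr rfl fun z _ => ?_
      rw [lintegral_smul_measure, lintegral_dirac, smul_eq_mul, ENNReal.toReal_mul,
        ENNReal.toReal_ofReal]
      · field_simp
      · exact div_nonneg (g_nonneg _ _) (Finset.sum_nonneg fun x _ => g_nonneg α (η x))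
    · intro z _
      rw [lintegral_smul_measure, lintegral_dirac, smul_eq_mul]
      exact ENNReal.mul_ne_top ENNReal.ofReal_ne_top (hf _)

instance chainLaw_isProbability (α : ℝ) (η : Config L) : IsProbabilityMeasure (chainLaw α η) := by
  unfold chainLaw; infer_instance

/-- `h` is `1` on the well at `w`, `0` on the other wells, and harmonic elsewhere. -/
structure IsPotential (α : ℝ) (N : ℕ) (l : ℝ) (w : ZMod L) (h : Config L → ℝ) : Prop where
  one : ∀ η ∈ well N l w, h η = 1
  zero : ∀ z, z ≠ w → ∀ η ∈ well N l z, h η = 0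
  harmonic : ∀ η ∈ confs L N, η ∉ wells N l Finset.univ → gen α h η = 0

/-- The probability that the wells are first visited at the well of `w`. -/
def potential (α : ℝ) (N : ℕ) (l : ℝ) (w : ZMod L) (η : Config L) : ℝ :=
  ∑ ξ ∈ well N l w, ((if η = ξ then 1 else 0) +
    if η ∈ wells N l Finset.univ then 0
    else (chainLaw α η).real (returnAt (wells N l Finset.univ) ξ))

theorem mem_well {N : ℕ} {l : ℝ} {z : ZMod L} {η : Config L} :
    η ∈ well N l z ↔ η ∈ confs L N ∧ (N : ℝ) - l ≤ η z := by
  simp [well]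

theorem mem_wells {N : ℕ} {l : ℝ} {A : Finset (ZMod L)} {η : Config L} :
    η ∈ wells N l A ↔ ∃ z ∈ A, η ∈ well N l z := by
  simp [wells]

theorem well_subset_wells {N : ℕ} {l : ℝ} {z : ZMod L} {η : Config L} (h : η ∈ well N l z) :
    η ∈ wells N l Finset.univ := mem_wells.2 ⟨z, Finset.mem_univ z, h⟩

/-- First-step analysis, valid at every configuration. Off the wells the two terms cancel, which is
harmonicity. On a well other than that of w the potential vanishes and only the trace rates remain.
-/
theorem gen_potential (α : ℝ) (N : ℕ) (l : ℝ) (w : ZMod L) (η : Config L) :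
    gen α (potential α N l w) η =
      ∑ ξ ∈ well N l w, traceRate α (wells N l Finset.univ) η ξ
        - totalRate α η * potential α N l w η := by
  have h1 : gen α (potential α N l w) η =
      ∑ z : ZMod L, g α (η z) * potential α N l w (move z (z + 1) η)
        - totalRate α η * potential α N l w η := by
    unfold gen totalRate
    rw [Finset.sum_mul, ← Finset.sum_sub_distrib]
    exact Finset.sum_congr rfl fun z _ => by ring
  rw [h1]
  congr 1
  conv_lhs => unfold potential
  simp only [Finset.mul_sum]
  rw [Finset.sum_comm]
  refine Finset.sum_congr rfl fun ξ hξ => ?_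
  unfold traceRate Measure.real
  rw [chainLaw_returnAt_eq_jumpOp α _ (well_subset_wells hξ), jumpOp_toReal]
  · refine Finset.sum_congr rfl fun z _ => ?_
    rw [ENNReal.toReal_add]
    · congr 2
      · by_cases h : move z (z + 1) η = ξ
        · simp [h]
        · simp [h]
      · split_ifs <;> simp
    · by_cases h : move z (z + 1) η = ξ <;> simp [h]
    · split_ifs <;> simp
  · intro ζ
    refine ENNReal.add_ne_top.2 ⟨?_, ?_⟩
    · by_cases h : ζ = ξ <;> simp [h]
    · split_ifs <;> simp

theorem disjoint_wells {N : ℕ} {l : ℝ} (hl : 2 * l < N) {z w : ZMod L} (hzw : z ≠ w)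
    {η : Config L} (h1 : η ∈ well N l z) : η ∉ well N l w := by
  intro h2
  rw [mem_well] at h1 h2
  have h3 := mem_confs.1 h1.1
  have h4 : η z + η w ≤ N := by
    rw [← h3, ← Finset.sum_pair hzw]
    exact Finset.sum_le_sum_of_subset (Finset.subset_univ _)
  have h5 : (η z : ℝ) + η w ≤ N := by exact_mod_cast h4
  linarith [h1.2, h2.2]

theorem isPotential_potential (α : ℝ) {N : ℕ} {l : ℝ} (hl : 2 * l < N) (w : ZMod L) :
    IsPotential α N l w (potential α N l w) where
  one η hη := by
    unfold potential
    simp [well_subset_wells hη, hη]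
  zero z hz η hη := by
    unfold potential
    simp [well_subset_wells hη, disjoint_wells hl hz hη]
  harmonic η hη hη' := by
    rw [gen_potential]
    unfold potential traceRate
    have : ∀ ξ ∈ well N l w, (if η = ξ then (1 : ℝ) else 0) = 0 := by
      intro ξ hξ
      rw [if_neg]
      rintro rfl
      exact hη' (well_subset_wells hξ)
    rw [Finset.mul_sum, ← Finset.sum_sub_distrib]
    refine Finset.sum_eq_zero fun ξ hξ => ?_
    rw [this ξ hξ, if_neg hη', zero_add, sub_self]

theorem gen_potential_of_mem_well (α : ℝ) {N : ℕ} {l : ℝ} (hl : 2 * l < N) {z w : ZMod L}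
    (hzw : z ≠ w) {η : Config L} (hη : η ∈ well N l z) :
    gen α (potential α N l w) η =
      ∑ ξ ∈ well N l w, traceRate α (wells N l Finset.univ) η ξ := by
  rw [gen_potential, (isPotential_potential α hl w).zero z hzw η hη, mul_zero, sub_zero]

/-- The mean rates in terms of the equilibrium potentials. -/
theorem meanRate_eq (α : ℝ) {N : ℕ} {l : ℝ} (hl : 2 * l < N) {z w : ZMod L} (hzw : z ≠ w) :
    meanRate α N l z w = 1 / (∑ η ∈ well N l z, mu α N η) *
      ∑ η ∈ well N l z, mu α N η * gen α (potential α N l w) η := by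
  unfold meanRate
  congr 1
  refine Finset.sum_congr rfl fun η hη => ?_
  rw [gen_potential_of_mem_well α hl hzw hη, Finset.mul_sum]

/-! ### Sums over configurations of product weights -/

/-- The boxes {0, …, M-1}^L exhaust the configurations, and on a box the sum of products factorizes.
-/
theorem summable_prod_and_tsum {f : ZMod L → ℕ → ℝ} (h0 : ∀ v n, 0 ≤ f v n)
    (hs : ∀ v, Summable (f v)) :
    Summable (fun ζ : Config L => ∏ v, f v (ζ v)) ∧
      ∑' ζ : Config L, ∏ v, f v (ζ v) = ∏ v, ∑' n, f v n := by
  have hbox : ∀ M : ℕ, ∑ ζ ∈ Fintype.piFinset (fun _ : ZMod L => Finset.range M),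
      ∏ v, f v (ζ v) = ∏ v, ∑ n ∈ Finset.range M, f v n := fun M =>
    (Finset.prod_univ_sum (fun _ : ZMod L => Finset.range M) f).symm
  have hnn : ∀ ζ : Config L, 0 ≤ ∏ v, f v (ζ v) := fun ζ => Finset.prod_nonneg fun v _ => h0 v _
  have hmono : Monotone fun M : ℕ => Fintype.piFinset (fun _ : ZMod L => Finset.range M) := by
    intro M M' h
    exact Fintype.piFinset_subset _ _ fun _ => Finset.range_mono h
  have hatTop : Tendsto (fun M : ℕ => Fintype.piFinset (fun _ : ZMod L => Finset.range M))
      atTop atTop := by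
    refine tendsto_atTop_finset_of_monotone hmono fun ζ => ⟨∑ v, ζ v + 1, ?_⟩
    rw [Fintype.mem_piFinset]
    intro v
    rw [Finset.mem_range, Nat.lt_succ_iff]
    exact Finset.single_le_sum (f := ζ) (fun _ _ => Nat.zero_le _) (Finset.mem_univ v)
  have hsum : Summable (fun ζ : Config L => ∏ v, f v (ζ v)) := by
    refine summable_of_sum_le (c := ∏ v, ∑' n, f v n) hnn fun s => ?_
    obtain ⟨M, hM⟩ := (hatTop.eventually (eventually_ge_atTop s)).exists
    refine (Finset.sum_le_sum_of_subset_of_nonneg hM fun ζ _ _ => hnn ζ).trans ?_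
    rw [hbox]
    exact Finset.prod_le_prod (fun v _ => Finset.sum_nonneg fun n _ => h0 v n)
      fun v _ => (hs v).sum_le_tsum _ fun n _ => h0 v n
  refine ⟨hsum, tendsto_nhds_unique (hsum.hasSum.comp hatTop) ?_⟩
  refine Tendsto.congr (fun M => (hbox M).symm) ?_
  exact tendsto_finsetProd _ fun v _ => (hs v).hasSum.tendsto_sum_nat

/-- The weight of site `v` in a configuration of the sites outside `A`. -/
def siteWeight (α : ℝ) (A : Finset (ZMod L)) (v : ZMod L) (n : ℕ) : ℝ :=
  if v ∈ A then (if n = 0 then 1 else 0) else 1 / a α n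

/-- The weight of a configuration of the sites outside `A`, extended by `0` to `A`. -/
def bgWeight (α : ℝ) (A : Finset (ZMod L)) (ζ : Config L) : ℝ :=
  ∏ v, siteWeight α A v (ζ v)

/-- The configuration outside `A`. -/
def clear (A : Finset (ZMod L)) (ξ : Config L) : Config L := fun v => if v ∈ A then 0 else ξ v

/-- The number of particles. -/
def size (ζ : Config L) : ℕ := ∑ v, ζ v

theorem siteWeight_nonneg (α : ℝ) (A : Finset (ZMod L)) (v : ZMod L) (n : ℕ) :
    0 ≤ siteWeight α A v n := by
  unfold siteWeight
  split_ifs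
  · exact zero_le_one
  · exact le_rfl
  · exact (one_div_pos.2 (a_pos α n)).le

theorem bgWeight_nonneg (α : ℝ) (A : Finset (ZMod L)) (ζ : Config L) : 0 ≤ bgWeight α A ζ :=
  Finset.prod_nonneg fun v _ => siteWeight_nonneg α A v _

theorem bgWeight_eq_zero (α : ℝ) {A : Finset (ZMod L)} {ζ : Config L} {v : ZMod L} (hv : v ∈ A)
    (h : ζ v ≠ 0) : bgWeight α A ζ = 0 :=
  Finset.prod_eq_zero (Finset.mem_univ v) (by simp [siteWeight, hv, h])

theorem weight_eq_mul_bgWeight (α : ℝ) (A : Finset (ZMod L)) (ξ : Config L) :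
    weight α ξ = (∏ v ∈ A, 1 / a α (ξ v)) * bgWeight α A (clear A ξ) := by
  unfold weight bgWeight
  rw [← Finset.prod_mul_prod_compl A]
  congr 1
  rw [← Finset.prod_mul_prod_compl A (fun v => siteWeight α A v (clear A ξ v))]
  rw [Finset.prod_eq_one (s := A), one_mul]
  · refine Finset.prod_congr rfl fun v hv => ?_
    simp [siteWeight, clear, Finset.mem_compl.1 hv]
  · intro v hv
    simp [siteWeight, clear, hv]

/-- This is where α > 3 enters: the terms are of order n^(2-α). -/
theorem summable_site_moment {α : ℝ} (hα : 3 < α) :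
    Summable fun n : ℕ => (1 / a α n) * ((1 : ℝ) + n) ^ 2 := by
  rw [← summable_nat_add_iff 1]
  have h1 : Summable fun n : ℕ => 4 * (1 / ((n + 1 : ℕ) : ℝ) ^ (α - 2)) :=
    ((summable_nat_add_iff (f := fun n : ℕ => 1 / (n : ℝ) ^ (α - 2)) 1).2
      (Real.summable_one_div_nat_rpow.2 (by linarith))).mul_left 4
  refine Summable.of_nonneg_of_le (fun n => ?_) (fun n => ?_) h1
  · exact mul_nonneg (one_div_pos.2 (a_pos α _)).le (sq_nonneg _)
  · have hpos : (0 : ℝ) < ((n + 1 : ℕ) : ℝ) := by positivity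
    have h2 : a α (n + 1) = ((n + 1 : ℕ) : ℝ) ^ α := by simp [a]
    rw [h2, Real.rpow_sub hpos, Real.rpow_two]
    have h3 : (1 + ((n + 1 : ℕ) : ℝ)) ^ 2 ≤ 4 * ((n + 1 : ℕ) : ℝ) ^ 2 := by
      push_cast
      nlinarith [Nat.cast_nonneg (α := ℝ) n]
    have h4 : (0 : ℝ) < ((n + 1 : ℕ) : ℝ) ^ α := Real.rpow_pos_of_pos hpos α
    rw [one_div_div, div_mul_eq_mul_div, one_mul, ← mul_div_assoc]
    gcongr

theorem summable_one_div_a {α : ℝ} (hα : 3 < α) : Summable fun n : ℕ => 1 / a α n := by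
  refine Summable.of_nonneg_of_le (fun n => (one_div_pos.2 (a_pos α _)).le) (fun n => ?_)
    (summable_site_moment hα)
  refine le_mul_of_one_le_right (one_div_pos.2 (a_pos α _)).le ?_
  nlinarith [Nat.cast_nonneg (α := ℝ) n]

theorem Gam_pos {α : ℝ} (hα : 3 < α) : 0 < Gam α := by
  refine (summable_one_div_a hα).tsum_pos (fun n => (one_div_pos.2 (a_pos α _)).le) 0 ?_
  exact one_div_pos.2 (a_pos α _)

theorem summable_siteWeight_moment {α : ℝ} (hα : 3 < α) (A : Finset (ZMod L)) (v : ZMod L) :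
    Summable fun n : ℕ => siteWeight α A v n * ((1 : ℝ) + n) ^ 2 := by
  unfold siteWeight
  split_ifs
  · refine summable_of_ne_finset_zero (s := {0}) fun n hn => ?_
    simp at hn
    simp [hn]
  · exact summable_site_moment hα

/-- The dominating function for all sums over background configurations. -/
def momentBound (ζ : Config L) : ℝ := (∏ v, ((1 : ℝ) + ζ v)) ^ 2

theorem one_le_prod_one_add (ζ : Config L) : (1 : ℝ) ≤ ∏ v, ((1 : ℝ) + ζ v) := by
  rw [← Finset.prod_const_one (s := (Finset.univ : Finset (ZMod L)))]
  exact Finset.prod_le_prod (fun _ _ => zero_le_one) fun v _ => by simp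

theorem one_add_sum_le_prod {ι : Type*} (s : Finset ι) {f : ι → ℝ} (hf : ∀ i, 0 ≤ f i) :
    1 + ∑ i ∈ s, f i ≤ ∏ i ∈ s, (1 + f i) := by
  classical
  induction s using Finset.induction_on with
  | empty => simp
  | insert i s hi ih =>
    rw [Finset.sum_insert hi, Finset.prod_insert hi]
    have h1 := hf i
    have h2 : 0 ≤ ∑ j ∈ s, f j := Finset.sum_nonneg fun j _ => hf j
    nlinarith

theorem one_le_momentBound (ζ : Config L) : 1 ≤ momentBound ζ :=
  one_le_pow₀ (one_le_prod_one_add ζ)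

theorem size_sq_le_momentBound (ζ : Config L) :
    ((size ζ : ℝ) + 3) ^ 2 ≤ 9 * momentBound ζ := by
  have h1 : (1 : ℝ) + size ζ ≤ ∏ v, ((1 : ℝ) + ζ v) := by
    unfold size
    push_cast
    exact one_add_sum_le_prod Finset.univ fun v => Nat.cast_nonneg (ζ v)
  have h2 : (0 : ℝ) ≤ size ζ := Nat.cast_nonneg _
  have h3 := one_le_prod_one_add ζ
  unfold momentBound
  nlinarith

/-- `momentBound` is a product over sites, so the sum factorizes, and yet it dominates the square of
the number of particles. -/
theorem summable_bgWeight_moment {α : ℝ} (hα : 3 < α) (A : Finset (ZMod L)) :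
    Summable fun ζ : Config L => bgWeight α A ζ * momentBound ζ := by
  have := (summable_prod_and_tsum (L := L)
    (f := fun v n => siteWeight α A v n * ((1 : ℝ) + n) ^ 2)
    (fun v n => mul_nonneg (siteWeight_nonneg α A v n) (sq_nonneg _))
    (fun v => summable_siteWeight_moment hα A v)).1
  refine this.congr fun ζ => ?_
  rw [bgWeight, momentBound, Finset.prod_mul_distrib, Finset.prod_pow]

theorem tsum_bgWeight {α : ℝ} (hα : 3 < α) (A : Finset (ZMod L)) :
    ∑' ζ : Config L, bgWeight α A ζ = Gam α ^ (L - A.card) := by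
  have hs : ∀ v : ZMod L, Summable (siteWeight α A v) := fun v => by
    refine Summable.of_nonneg_of_le (fun n => siteWeight_nonneg α A v n) (fun n => ?_)
      (summable_siteWeight_moment hα A v)
    refine le_mul_of_one_le_right (siteWeight_nonneg α A v n) ?_
    nlinarith [Nat.cast_nonneg (α := ℝ) n]
  have h1 := (summable_prod_and_tsum (L := L) (f := siteWeight α A)
    (fun v n => siteWeight_nonneg α A v n) hs).2
  unfold bgWeight
  rw [h1]
  have h2 : ∀ v : ZMod L, ∑' n, siteWeight α A v n = if v ∈ A then 1 else Gam α := by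
    intro v
    unfold siteWeight Gam
    split_ifs with hv
    · exact tsum_ite_eq 0 fun _ => (1 : ℝ)
    · rfl
  simp only [h2]
  rw [Finset.prod_ite, Finset.prod_const_one, one_mul, Finset.prod_const]
  congr 1
  have h3 : (Finset.univ.filter fun v : ZMod L => v ∉ A) = Aᶜ := by ext; simp
  rw [h3, Finset.card_compl, ZMod.card]

/-! ### Dominated convergence over the configurations outside a set of sites. -/

/-- Summation over the fibres of `clear A`. -/
theorem sum_bgWeight_eq_tsum (α : ℝ) (A : Finset (ZMod L)) (S : Finset (Config L))
    (q : Config L → ℝ) :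
    ∑ ξ ∈ S, bgWeight α A (clear A ξ) * q ξ =
      ∑' ζ, bgWeight α A ζ * ∑ ξ ∈ S.filter (fun ξ => clear A ξ = ζ), q ξ := by
  rw [tsum_eq_sum (s := S.image (clear A))]
  · rw [← Finset.sum_fiberwise_of_maps_to (g := clear A) (t := S.image (clear A))
      (fun ξ hξ => Finset.mem_image_of_mem _ hξ)]
    refine Finset.sum_congr rfl fun ζ _ => ?_
    rw [Finset.mul_sum]
    refine Finset.sum_congr rfl fun ξ hξ => ?_
    rw [(Finset.mem_filter.1 hξ).2]
  · intro ζ hζ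
    rw [Finset.filter_eq_empty_iff.2, Finset.sum_empty, mul_zero]
    intro ξ hξ h
    exact hζ (h ▸ Finset.mem_image_of_mem _ hξ)

theorem tendsto_sum_bgWeight {α : ℝ} (hα : 3 < α) (A : Finset (ZMod L))
    (S : ℕ → Finset (Config L)) (q : ℕ → Config L → ℝ) (c : Config L → ℝ) (C : ℝ)
    (hbound : ∀ᶠ N in atTop, ∀ ζ, |∑ ξ ∈ (S N).filter (fun ξ => clear A ξ = ζ), q N ξ| ≤
      C * momentBound ζ)
    (hlim : ∀ ζ : Config L, (∀ v ∈ A, ζ v = 0) →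
      Tendsto (fun N => ∑ ξ ∈ (S N).filter (fun ξ => clear A ξ = ζ), q N ξ) atTop (𝓝 (c ζ))) :
    Tendsto (fun N => ∑ ξ ∈ S N, bgWeight α A (clear A ξ) * q N ξ) atTop
      (𝓝 (∑' ζ, bgWeight α A ζ * c ζ)) := by
  simp only [sum_bgWeight_eq_tsum]
  refine tendsto_tsum_of_dominated_convergence
    (bound := fun ζ => C * (bgWeight α A ζ * momentBound ζ))
    ((summable_bgWeight_moment hα A).mul_left C) (fun ζ => ?_) ?_
  · by_cases h : ∀ v ∈ A, ζ v = 0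
    · exact (hlim ζ h).const_mul _
    · push Not at h
      obtain ⟨v, hv, hne⟩ := h
      simp [bgWeight_eq_zero α hv hne]
  · filter_upwards [hbound] with N hN ζ
    rw [Real.norm_eq_abs, abs_mul, abs_of_nonneg (bgWeight_nonneg α A ζ), mul_left_comm]
    exact mul_le_mul_of_nonneg_left (hN ζ) (bgWeight_nonneg α A ζ)

theorem size_clear_add (A : Finset (ZMod L)) (ξ : Config L) :
    size (clear A ξ) + ∑ v ∈ A, ξ v = ∑ v, ξ v := by
  unfold size
  have h1 : ∑ v ∈ A, clear A ξ v = 0 := Finset.sum_eq_zero fun v hv => by simp [clear, hv]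
  have h2 : ∑ v ∈ Aᶜ, clear A ξ v = ∑ v ∈ Aᶜ, ξ v :=
    Finset.sum_congr rfl fun v hv => by simp [clear, Finset.mem_compl.1 hv]
  rw [← Finset.sum_add_sum_compl A ξ, ← Finset.sum_add_sum_compl A (clear A ξ), h1, h2]
  ring

/-- Configurations of `E_N` with no particle on `A` outside `w`, and at least `N - l` at `w`. -/
def condensed (N : ℕ) (l : ℝ) (A : Finset (ZMod L)) (w : ZMod L) : Finset (Config L) :=
  (well N l w).filter fun η => ∀ v ∈ A, v ≠ w → η v = 0

/-- All particles on A sit at w, so conservation of their total number recovers η from its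
background. -/
theorem condensed_fiber_subsingleton {N : ℕ} {l : ℝ} {A : Finset (ZMod L)} {w : ZMod L}
    (hw : w ∈ A) {ζ η : Config L} (hη : η ∈ condensed N l A w) (hζ : clear A η = ζ) :
    size ζ + η w = N ∧ η = ζ + Pi.single w (N - size ζ) := by
  obtain ⟨h1, h2⟩ := Finset.mem_filter.1 hη
  have h3 := mem_confs.1 (mem_well.1 h1).1
  have h4 := size_clear_add A η
  rw [h3, hζ, Finset.sum_eq_single_of_mem w hw fun v hv hne => h2 v hv hne] at h4
  refine ⟨h4, ?_⟩
  funext v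
  rw [← hζ] at h4 ⊢
  by_cases hv : v = w
  · subst hv
    simp [clear, hw]
    omega
  · by_cases hvA : v ∈ A
    · simp [clear, hv, hvA, h2 v hvA hv]
    · simp [clear, hv, hvA]

/-- Each background ζ carries at most one configuration, and exactly one once ℓ_N exceeds the size
of ζ. The set A = {w} serves for the measure of a well, A = {x, w} for the end of a tube. -/
theorem tendsto_sum_condensed {α : ℝ} (hα : 3 < α) {ℓ : ℕ → ℝ} (hℓ : Tendsto ℓ atTop atTop)
    {A : Finset (ZMod L)} {w : ZMod L} (hw : w ∈ A) (r : ℕ → ℕ → ℝ) (C : ℝ)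
    (hr : ∀ᶠ N : ℕ in atTop, ∀ m : ℕ, (N : ℝ) - ℓ N ≤ m → m ≤ N → |r N m| ≤ C)
    (hlim : ∀ k : ℕ, Tendsto (fun N => r N (N - k)) atTop (𝓝 1)) :
    Tendsto (fun N => ∑ η ∈ condensed N (ℓ N) A w, bgWeight α A (clear A η) * r N (η w)) atTop
      (𝓝 (Gam α ^ (L - A.card))) := by
  rw [← tsum_bgWeight hα A]
  have key := tendsto_sum_bgWeight hα A (fun N => condensed N (ℓ N) A w)
    (fun N η => r N (η w)) (fun _ => 1) (|C|) ?_ ?_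
  · simpa using key
  · filter_upwards [hr] with N hN ζ
    have hcard : ((condensed N (ℓ N) A w).filter (fun ξ => clear A ξ = ζ)).card ≤ 1 := by
      refine Finset.card_le_one.2 fun η hη η' hη' => ?_
      rw [(condensed_fiber_subsingleton hw (Finset.mem_filter.1 hη).1 (Finset.mem_filter.1 hη).2).2,
        (condensed_fiber_subsingleton hw (Finset.mem_filter.1 hη').1
          (Finset.mem_filter.1 hη').2).2]
    have hle : ∀ η ∈ (condensed N (ℓ N) A w).filter (fun ξ => clear A ξ = ζ),
        |r N (η w)| ≤ |C| := by
      intro η hη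
      have h1 := (condensed_fiber_subsingleton hw (Finset.mem_filter.1 hη).1
        (Finset.mem_filter.1 hη).2).1
      have h2 := (mem_well.1 (Finset.mem_filter.1 (Finset.mem_filter.1 hη).1).1).2
      exact (hN _ h2 (by omega)).trans (le_abs_self C)
    calc |∑ ξ ∈ (condensed N (ℓ N) A w).filter (fun ξ => clear A ξ = ζ), r N (ξ w)|
        ≤ ∑ ξ ∈ (condensed N (ℓ N) A w).filter (fun ξ => clear A ξ = ζ), |r N (ξ w)| :=
          Finset.abs_sum_le_sum_abs _ _
      _ ≤ ((condensed N (ℓ N) A w).filter (fun ξ => clear A ξ = ζ)).card • |C| :=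
          Finset.sum_le_card_nsmul _ _ _ hle
      _ ≤ 1 * |C| := by
          rw [nsmul_eq_mul]
          exact mul_le_mul_of_nonneg_right (by exact_mod_cast hcard) (abs_nonneg C)
      _ ≤ |C| * momentBound ζ := by
          rw [mul_comm]
          exact mul_le_mul_of_nonneg_left (one_le_momentBound ζ) (abs_nonneg C)
  · intro ζ hζ
    refine (hlim (size ζ)).congr' ?_
    filter_upwards [hℓ.eventually_ge_atTop (size ζ : ℝ), eventually_ge_atTop (size ζ)]
      with N h1 h2
    have hw0 := hζ w hw
    have hfib : (condensed N (ℓ N) A w).filter (fun ξ => clear A ξ = ζ) =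
        {ζ + Pi.single w (N - size ζ)} := by
      refine Finset.eq_singleton_iff_unique_mem.2 ⟨?_, fun η hη =>
        (condensed_fiber_subsingleton hw (Finset.mem_filter.1 hη).1 (Finset.mem_filter.1 hη).2).2⟩
      rw [Finset.mem_filter, condensed, Finset.mem_filter, mem_well, mem_confs]
      refine ⟨⟨⟨?_, ?_⟩, ?_⟩, ?_⟩
      · simp only [Pi.add_apply, Finset.sum_add_distrib, Finset.sum_pi_single', Finset.mem_univ,
          if_true]
        change size ζ + _ = _
        omega
      · simp only [Pi.add_apply, Pi.single_eq_same, hw0, zero_add]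
        rw [Nat.cast_sub h2]
        linarith
      · intro v hv hne
        simp [hne, hζ v hv]
      · funext v
        by_cases hv : v ∈ A
        · simp [clear, hv, hζ v hv]
        · have : v ≠ w := fun h => hv (h ▸ hw)
          simp [clear, hv, this]
    rw [hfib, Finset.sum_singleton]
    simp [hw0]

/-! ### Sums over tubes: configurations with two distinguished sites. -/

theorem pair_fiber_injective {n : ℕ} {x w : ZMod L} (hxw : x ≠ w) {ξ ξ' : Config L}
    (h : ξ ∈ confs L n) (h' : ξ' ∈ confs L n) (hc : clear {x, w} ξ = clear {x, w} ξ')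
    (hx : ξ x = ξ' x ∨ ξ w = ξ' w) : ξ = ξ' := by
  have h1 := size_clear_add {x, w} ξ
  have h2 := size_clear_add {x, w} ξ'
  rw [mem_confs.1 h, Finset.sum_pair hxw] at h1
  rw [mem_confs.1 h', Finset.sum_pair hxw, ← hc] at h2
  have hx' : ξ x = ξ' x := by omega
  have hw' : ξ w = ξ' w := by omega
  funext v
  by_cases hv : v = x
  · rw [hv, hx']
  · by_cases hv' : v = w
    · rw [hv', hw']
    · have := congrFun hc v
      simpa [clear, hv, hv'] using this

/-- With the background fixed, a fibre is a segment parametrized by the occupation of either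
distinguished site. -/
theorem card_pair_fiber_filter_le {n : ℕ} {x w : ZMod L} (hxw : x ≠ w) (ζ : Config L)
    {y : ZMod L} (hy : y = x ∨ y = w) (P : Config L → Prop) [DecidablePred P] (m : ℕ)
    (hP : ∀ ξ ∈ confs L n, P ξ → ξ y < m) :
    (((confs L n).filter (fun ξ => clear {x, w} ξ = ζ)).filter P).card ≤ m := by
  rw [← Finset.card_range m]
  refine Finset.card_le_card_of_injOn (fun ξ => ξ y) ?_ ?_
  · intro ξ hξ
    simp only [Finset.coe_filter, Set.mem_ofPred_eq, Finset.mem_filter] at hξ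
    exact Finset.mem_coe.2 (Finset.mem_range.2 (hP ξ hξ.1.1 hξ.2))
  · intro ξ hξ ξ' hξ' heq
    simp only [Finset.coe_filter, Set.mem_ofPred_eq, Finset.mem_filter] at hξ hξ'
    refine pair_fiber_injective hxw hξ.1.1 hξ'.1.1 (hξ.1.2.trans hξ'.1.2.symm) ?_
    rcases hy with rfl | rfl
    · exact Or.inl heq
    · exact Or.inr heq

theorem card_pair_fiber_le {N : ℕ} (hN : 1 ≤ N) {x w : ZMod L} (hxw : x ≠ w) (ζ : Config L) :
    ((confs L (N - 1)).filter (fun ξ => clear {x, w} ξ = ζ)).card ≤ N := by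
  have := card_pair_fiber_filter_le (n := N - 1) hxw ζ (Or.inl rfl) (fun _ => True) N
    (fun ξ hξ _ => by
      have h1 := mem_confs.1 hξ
      have h2 := Finset.single_le_sum (f := ξ) (fun _ _ => Nat.zero_le _) (Finset.mem_univ x)
      omega)
  simpa using this

/-- A bound for sums over configurations with two distinguished sites. -/
theorem pair_sum_le {α : ℝ} (hα : 3 < α) {N : ℕ} (hN : 1 ≤ N) {x w : ZMod L} (hxw : x ≠ w)
    (e : Config L → ℝ) {C : ℝ}
    (hC : ∀ ξ ∈ confs L (N - 1), e ξ ≤ C * momentBound (clear {x, w} ξ)) :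
    ∑ ξ ∈ confs L (N - 1), bgWeight α {x, w} (clear {x, w} ξ) * e ξ ≤
      N * (|C| * ∑' ζ : Config L, bgWeight α {x, w} ζ * momentBound ζ) := by
  have hsum := summable_bgWeight_moment (L := L) hα {x, w}
  rw [← tsum_mul_left, ← tsum_mul_left]
  have hle : ∑ ξ ∈ confs L (N - 1), bgWeight α {x, w} (clear {x, w} ξ) * e ξ ≤
      ∑ ξ ∈ confs L (N - 1), bgWeight α {x, w} (clear {x, w} ξ) *
        (|C| * momentBound (clear {x, w} ξ)) := by
    refine Finset.sum_le_sum fun ξ hξ => ?_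
    refine mul_le_mul_of_nonneg_left ((hC ξ hξ).trans ?_) (bgWeight_nonneg _ _ _)
    exact mul_le_mul_of_nonneg_right (le_abs_self C)
      (zero_le_one.trans (one_le_momentBound _))
  refine hle.trans ?_
  rw [sum_bgWeight_eq_tsum]
  have hb : ∀ ζ : Config L, bgWeight α {x, w} ζ *
      ∑ ξ ∈ (confs L (N - 1)).filter (fun ξ => clear {x, w} ξ = ζ),
        |C| * momentBound (clear {x, w} ξ) ≤
      N * (|C| * (bgWeight α {x, w} ζ * momentBound ζ)) := by
    intro ζ
    have h1 : ∑ ξ ∈ (confs L (N - 1)).filter (fun ξ => clear {x, w} ξ = ζ),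
        |C| * momentBound (clear {x, w} ξ) =
        ∑ ξ ∈ (confs L (N - 1)).filter (fun ξ => clear {x, w} ξ = ζ), |C| * momentBound ζ :=
      Finset.sum_congr rfl fun ξ hξ => by rw [(Finset.mem_filter.1 hξ).2]
    rw [h1, Finset.sum_const, nsmul_eq_mul]
    have h2 : (((confs L (N - 1)).filter (fun ξ => clear {x, w} ξ = ζ)).card : ℝ) ≤ N := by
      exact_mod_cast card_pair_fiber_le hN hxw ζ
    have h3 : 0 ≤ bgWeight α {x, w} ζ * (|C| * momentBound ζ) :=
      mul_nonneg (bgWeight_nonneg _ _ _) (mul_nonneg (abs_nonneg C)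
        (zero_le_one.trans (one_le_momentBound _)))
    nlinarith
  refine Summable.tsum_le_tsum hb ?_ ((hsum.mul_left |C|).mul_left (N : ℝ))
  refine Summable.of_nonneg_of_le (fun ζ => ?_) hb ((hsum.mul_left |C|).mul_left (N : ℝ))
  exact mul_nonneg (bgWeight_nonneg _ _ _) (Finset.sum_nonneg fun ξ _ =>
    mul_nonneg (abs_nonneg C) (zero_le_one.trans (one_le_momentBound _)))

/-- Dominated convergence for sums over configurations with two distinguished sites. -/
theorem tendsto_pair_sum_zero {α : ℝ} (hα : 3 < α) {x w : ZMod L} (hxw : x ≠ w)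
    (e : ℕ → Config L → ℝ) {C : ℝ} (h0 : ∀ N ξ, 0 ≤ e N ξ)
    (hC : ∀ᶠ N : ℕ in atTop, ∀ ξ ∈ confs L (N - 1),
      e N ξ ≤ C * momentBound (clear {x, w} ξ))
    (hlim : ∀ (ζ : Config L) (ε : ℝ), 0 < ε → ∀ᶠ N : ℕ in atTop, ∀ ξ ∈ confs L (N - 1),
      clear {x, w} ξ = ζ → ε * N ≤ ξ x → ε * N ≤ ξ w → e N ξ ≤ ε) :
    Tendsto (fun N : ℕ => (1 / (N : ℝ)) *
      ∑ ξ ∈ confs L (N - 1), bgWeight α {x, w} (clear {x, w} ξ) * e N ξ) atTop (𝓝 0) := by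
  have hev : (fun N : ℕ => (1 / (N : ℝ)) *
      ∑ ξ ∈ confs L (N - 1), bgWeight α {x, w} (clear {x, w} ξ) * e N ξ) =
      fun N : ℕ => ∑ ξ ∈ confs L (N - 1), bgWeight α {x, w} (clear {x, w} ξ) *
        (1 / (N : ℝ) * e N ξ) := by
    funext N
    rw [Finset.mul_sum]
    exact Finset.sum_congr rfl fun ξ _ => by ring
  rw [hev]
  have key := tendsto_sum_bgWeight hα {x, w} (fun N => confs L (N - 1))
    (fun N ξ => 1 / (N : ℝ) * e N ξ) (fun _ => 0) C ?_ ?_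
  · simpa using key
  · filter_upwards [hC, eventually_ge_atTop 1] with N hN hN1 ζ
    have hNpos : (0 : ℝ) < N := by exact_mod_cast hN1
    rw [← Finset.mul_sum, abs_of_nonneg (mul_nonneg (by positivity)
      (Finset.sum_nonneg fun ξ _ => h0 N ξ))]
    by_cases hemp : (confs L (N - 1)).filter (fun ξ => clear {x, w} ξ = ζ) = ∅
    · rw [hemp]
      simp only [Finset.sum_empty, mul_zero]
      -- The sign of C cannot be read from an empty fibre; the configuration with all particles at x
      -- provides it.
      have hCnn : 0 ≤ C := by
        have hne : (Pi.single x (N - 1) : Config L) ∈ confs L (N - 1) := by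
          rw [mem_confs]; simp
        have h1 := (h0 N _).trans (hN _ hne)
        have h2 := one_le_momentBound (clear {x, w} (Pi.single x (N - 1) : Config L))
        nlinarith
      exact mul_nonneg hCnn (zero_le_one.trans (one_le_momentBound _))
    · obtain ⟨ξ₀, hξ₀⟩ := Finset.nonempty_iff_ne_empty.2 hemp
      have hB : 0 ≤ C * momentBound ζ := by
        have := hN ξ₀ (Finset.mem_filter.1 hξ₀).1
        rw [(Finset.mem_filter.1 hξ₀).2] at this
        exact (h0 N ξ₀).trans this
      have h1 : ∑ ξ ∈ (confs L (N - 1)).filter (fun ξ => clear {x, w} ξ = ζ), e N ξ ≤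
          ((confs L (N - 1)).filter (fun ξ => clear {x, w} ξ = ζ)).card • (C * momentBound ζ) := by
        refine Finset.sum_le_card_nsmul _ _ _ fun ξ hξ => ?_
        have := hN ξ (Finset.mem_filter.1 hξ).1
        rwa [(Finset.mem_filter.1 hξ).2] at this
      rw [nsmul_eq_mul] at h1
      have h2 : (((confs L (N - 1)).filter (fun ξ => clear {x, w} ξ = ζ)).card : ℝ) ≤ N := by
        exact_mod_cast card_pair_fiber_le hN1 hxw ζ
      rw [one_div, inv_mul_le_iff₀ hNpos]
      exact h1.trans (mul_le_mul_of_nonneg_right h2 hB)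
  · intro ζ _
    rw [Metric.tendsto_atTop']
    intro ε' hε'
    set B := |C| * momentBound ζ with hBdef
    have hB : 0 ≤ B := mul_nonneg (abs_nonneg C) (zero_le_one.trans (one_le_momentBound _))
    -- A fibre has at most N points, about 2εN of them near its ends. There the bound is B,
    -- elsewhere it is ε. The total N ε(1 + 2B) + 2B is below N ε' for this ε and for N > 8B/ε'.
    set ε := ε' / (4 * (B + 1)) with hε
    have hεpos : 0 < ε := by positivity
    obtain ⟨M, hM⟩ := exists_nat_gt (8 * B / ε')
    obtain ⟨K, hK⟩ := eventually_atTop.1 ((hC.and (hlim ζ ε hεpos)).and (eventually_ge_atTop 1))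
    refine ⟨max M K, fun N hN => ?_⟩
    obtain ⟨⟨hN1, hN2⟩, hN3⟩ := hK N ((le_max_right M K).trans hN.le)
    have hNpos : (0 : ℝ) < N := by exact_mod_cast hN3
    have hNM : 8 * B / ε' < N := hM.trans_le (by exact_mod_cast (le_max_left M K).trans hN.le)
    set S := (confs L (N - 1)).filter (fun ξ => clear {x, w} ξ = ζ) with hS
    rw [← Finset.mul_sum, Real.dist_eq, sub_zero, abs_of_nonneg (mul_nonneg (by positivity)
      (Finset.sum_nonneg fun ξ _ => h0 N ξ))]
    have hmem : ∀ ξ ∈ S, ξ ∈ confs L (N - 1) ∧ clear {x, w} ξ = ζ := fun ξ hξ =>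
      Finset.mem_filter.1 hξ
    have hpt : ∀ ξ ∈ S, e N ξ ≤ ε + (if (ξ x : ℝ) < ε * N then B else 0) +
        (if (ξ w : ℝ) < ε * N then B else 0) := by
      intro ξ hξ
      have hle : e N ξ ≤ B := by
        refine (hN1 ξ (hmem ξ hξ).1).trans ?_
        rw [(hmem ξ hξ).2]
        exact mul_le_mul_of_nonneg_right (le_abs_self C) (zero_le_one.trans (one_le_momentBound _))
      by_cases h1 : (ξ x : ℝ) < ε * N
      · rw [if_pos h1]
        split_ifs <;> linarith
      · by_cases h2 : (ξ w : ℝ) < ε * N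
        · rw [if_pos h2, if_neg h1]
          linarith
        · rw [if_neg h1, if_neg h2]
          linarith [hN2 ξ (hmem ξ hξ).1 (hmem ξ hξ).2 (not_lt.1 h1) (not_lt.1 h2)]
    have hcard : ∀ y : ZMod L, y = x ∨ y = w →
        ((S.filter fun ξ => (ξ y : ℝ) < ε * N).card : ℝ) ≤ ε * N + 1 := by
      intro y hy
      have h1 := card_pair_fiber_filter_le (n := N - 1) hxw ζ hy
        (fun ξ => (ξ y : ℝ) < ε * N) ⌈ε * N⌉₊ (fun ξ _ h => Nat.lt_ceil.2 h)
      calc ((S.filter fun ξ => (ξ y : ℝ) < ε * N).card : ℝ) ≤ (⌈ε * N⌉₊ : ℝ) := by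
            exact_mod_cast h1
        _ ≤ ε * N + 1 := (Nat.ceil_lt_add_one (by positivity)).le
    have hsum : ∑ ξ ∈ S, e N ξ ≤ N * ε + (ε * N + 1) * B + (ε * N + 1) * B := by
      refine (Finset.sum_le_sum hpt).trans ?_
      rw [Finset.sum_add_distrib, Finset.sum_add_distrib, Finset.sum_const, nsmul_eq_mul,
        ← Finset.sum_filter, ← Finset.sum_filter, Finset.sum_const, Finset.sum_const,
        nsmul_eq_mul, nsmul_eq_mul]
      have h2 : (S.card : ℝ) ≤ N := by exact_mod_cast card_pair_fiber_le hN3 hxw ζ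
      have h3 := mul_le_mul_of_nonneg_right (hcard x (Or.inl rfl)) hB
      have h4 := mul_le_mul_of_nonneg_right (hcard w (Or.inr rfl)) hB
      have h5 := mul_le_mul_of_nonneg_right h2 hεpos.le
      linarith
    rw [one_div, inv_mul_lt_iff₀ hNpos]
    refine hsum.trans_lt ?_
    have h6 : ε * (4 * (B + 1)) = ε' := by rw [hε]; field_simp
    have h7 : 8 * B < N * ε' := by rwa [div_lt_iff₀ hε'] at hNM
    have h8 : N * ε + (ε * N + 1) * B + (ε * N + 1) * B =
        N * (ε * (1 + 2 * B)) + 2 * B := by ring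
    have h9 : ε * (1 + 2 * B) ≤ ε' / 2 := by nlinarith
    have h10 := mul_le_mul_of_nonneg_left h9 hNpos.le
    have h11 := mul_pos hNpos hε'
    rw [h8]
    nlinarith [h11]

/-! ### The partition function and the measure of the wells -/

theorem a_of_pos (α : ℝ) {n : ℕ} (h : 0 < n) : a α n = (n : ℝ) ^ α := by
  simp [a, h.ne']

theorem tendsto_rpow_div_a (α : ℝ) (k : ℕ) :
    Tendsto (fun N : ℕ => (N : ℝ) ^ α / a α (N - k)) atTop (𝓝 1) := by
  have h1 : Tendsto (fun N : ℕ => ((N : ℝ) / ((N - k : ℕ) : ℝ)) ^ α) atTop (𝓝 1) := by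
    have h2 : Tendsto (fun N : ℕ => (N : ℝ) / ((N - k : ℕ) : ℝ)) atTop (𝓝 1) := by
      rw [← tendsto_add_atTop_iff_nat k]
      simp only [Nat.add_sub_cancel]
      have h3 : Tendsto (fun N : ℕ => 1 + (k : ℝ) / (N : ℝ)) atTop (𝓝 (1 + 0)) :=
        tendsto_const_nhds.add (tendsto_const_div_atTop_nhds_zero_nat (k : ℝ))
      rw [add_zero] at h3
      refine h3.congr' ?_
      filter_upwards [eventually_gt_atTop 0] with N hN
      have : (N : ℝ) ≠ 0 := by exact_mod_cast hN.ne'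
      push_cast
      field_simp
    have := h2.rpow_const (p := α) (Or.inl one_ne_zero)
    rwa [Real.one_rpow] at this
  refine h1.congr' ?_
  filter_upwards [eventually_gt_atTop k] with N hN
  rw [a_of_pos α (by omega), Real.div_rpow (by positivity) (by positivity)]

theorem rpow_div_a_le {α : ℝ} (hα : 0 ≤ α) {N m : ℕ} {c : ℝ} (hc : 0 < c) (hN : 0 < N)
    (h : (N : ℝ) ≤ c * m) : (N : ℝ) ^ α / a α m ≤ c ^ α := by
  have hNpos : (0 : ℝ) < N := by exact_mod_cast hN
  have hm : 0 < m := by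
    rcases Nat.eq_zero_or_pos m with h0 | h0
    · rw [h0] at h; simp at h; linarith
    · exact h0
  have hmpos : (0 : ℝ) < m := by exact_mod_cast hm
  rw [a_of_pos α hm, div_le_iff₀ (Real.rpow_pos_of_pos hmpos α), ← Real.mul_rpow hc.le hmpos.le]
  exact Real.rpow_le_rpow hNpos.le h hα

theorem eventually_two_mul_lt {ℓ : ℕ → ℝ}
    (hℓN : Tendsto (fun N : ℕ => ℓ N / (N : ℝ)) atTop (𝓝 0)) {c : ℝ} (hc : 0 < c) :
    ∀ᶠ N : ℕ in atTop, c * ℓ N < N := by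
  filter_upwards [hℓN.eventually_lt_const (show (0 : ℝ) < 1 / c by positivity),
    eventually_gt_atTop 0] with N h1 h2
  have : (0 : ℝ) < N := by exact_mod_cast h2
  rw [div_lt_iff₀ this] at h1
  have := mul_lt_mul_of_pos_left h1 hc
  rwa [← mul_assoc, mul_one_div_cancel hc.ne', one_mul] at this

theorem weight_eq_single (α : ℝ) (w : ZMod L) (η : Config L) :
    weight α η = 1 / a α (η w) * bgWeight α {w} (clear {w} η) := by
  rw [weight_eq_mul_bgWeight α {w}, Finset.prod_singleton]

/-- The condensate contributes N^α/a(η_w) → 1, bounded by 2^α because η_w ≥ N/2, and the other L - 1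
sites become independent. -/
theorem tendsto_weight_well {α : ℝ} (hα : 3 < α) {ℓ : ℕ → ℝ} (hℓ : Tendsto ℓ atTop atTop)
    (hℓN : Tendsto (fun N : ℕ => ℓ N / (N : ℝ)) atTop (𝓝 0)) (w : ZMod L) :
    Tendsto (fun N : ℕ => (N : ℝ) ^ α * ∑ η ∈ well N (ℓ N) w, weight α η) atTop
      (𝓝 (Gam α ^ (L - 1))) := by
  have key := tendsto_sum_condensed (L := L) hα hℓ (Finset.mem_singleton_self w)
    (fun N m => (N : ℝ) ^ α / a α m) (2 ^ α) ?_ (fun k => tendsto_rpow_div_a α k)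
  · rw [Finset.card_singleton] at key
    refine key.congr fun N => ?_
    rw [Finset.mul_sum]
    refine Finset.sum_congr ?_ fun η _ => ?_
    · unfold condensed
      refine Finset.filter_true_of_mem fun η _ v hv hne => ?_
      exact absurd (Finset.mem_singleton.1 hv) hne
    · rw [weight_eq_single α w]; ring
  · filter_upwards [eventually_two_mul_lt hℓN two_pos, eventually_gt_atTop 0] with N h1 h2 m h3 _
    rw [abs_of_nonneg (div_nonneg (by positivity) (a_pos α m).le)]
    exact rpow_div_a_le (by linarith) two_pos h2 (by linarith)

theorem exists_max_site (η : Config L) : ∃ w : ZMod L, ∀ v, η v ≤ η w := by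
  obtain ⟨w, _, hw⟩ := Finset.exists_max_image Finset.univ η ⟨0, Finset.mem_univ _⟩
  exact ⟨w, fun v => hw v (Finset.mem_univ v)⟩

theorem sum_le_sum_filter_cover {ι κ : Type*} (W : Finset κ) (S : Finset ι) (f : ι → ℝ)
    (hf : ∀ η ∈ S, 0 ≤ f η) (P : κ → ι → Prop) [∀ w, DecidablePred (P w)]
    (hP : ∀ η ∈ S, ∃ w ∈ W, P w η) :
    ∑ η ∈ S, f η ≤ ∑ w ∈ W, ∑ η ∈ S.filter (P w), f η := by
  simp only [Finset.sum_filter]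
  rw [Finset.sum_comm]
  refine Finset.sum_le_sum fun η hη => ?_
  obtain ⟨w, hw, hPw⟩ := hP η hη
  have h1 := Finset.single_le_sum (f := fun w => if P w η then f η else 0)
    (fun v _ => by split_ifs; exacts [hf η hη, le_rfl]) hw
  simpa [hPw] using h1

/-- Around a most occupied site w one has η_w ≥ N/L, so N^α/a(η_w) ≤ L^α dominates. For a fixed
background the configuration is in the well of w as soon as ℓ_N exceeds the background size, so
every term eventually vanishes. -/
theorem tendsto_weight_off_wells {α : ℝ} (hα : 3 < α) {ℓ : ℕ → ℝ} (hℓ : Tendsto ℓ atTop atTop) :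
    Tendsto (fun N : ℕ => (N : ℝ) ^ α *
      ∑ η ∈ (confs L N).filter (fun η => η ∉ wells N (ℓ N) Finset.univ), weight α η) atTop
      (𝓝 0) := by
  let S : ZMod L → ℕ → Finset (Config L) := fun w N => (confs L N).filter
    (fun η => η ∉ wells N (ℓ N) Finset.univ ∧ ∀ v, η v ≤ η w)
  have hLpos : (0 : ℝ) < L := by exact_mod_cast Nat.pos_of_ne_zero (NeZero.ne L)
  have key : ∀ w : ZMod L, Tendsto (fun N => ∑ η ∈ S w N,
      bgWeight α {w} (clear {w} η) * ((N : ℝ) ^ α / a α (η w))) atTop (𝓝 0) := by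
    intro w
    have hfib : ∀ N, ∀ ζ : Config L, ∀ η ∈ (S w N).filter (fun ξ => clear {w} ξ = ζ),
        size ζ + η w = N ∧ η = ζ + Pi.single w (N - size ζ) := by
      intro N ζ η hη
      obtain ⟨h1, h2⟩ := Finset.mem_filter.1 hη
      -- With l = N the lower bound on η_w is void, so any configuration of E_N qualifies.
      refine condensed_fiber_subsingleton (l := N) (Finset.mem_singleton_self w) ?_ h2
      rw [condensed, Finset.mem_filter, mem_well]
      refine ⟨⟨(Finset.mem_filter.1 h1).1, by simp⟩, fun v hv hne => ?_⟩
      exact absurd (Finset.mem_singleton.1 hv) hne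
    have := tendsto_sum_bgWeight hα {w} (S w) (fun N η => (N : ℝ) ^ α / a α (η w))
      (fun _ => 0) ((L : ℝ) ^ α) ?_ ?_
    · simpa using this
    · filter_upwards [eventually_gt_atTop 0] with N hN ζ
      have hcard : ((S w N).filter (fun ξ => clear {w} ξ = ζ)).card ≤ 1 :=
        Finset.card_le_one.2 fun η hη η' hη' => by
          rw [(hfib N ζ η hη).2, (hfib N ζ η' hη').2]
      rw [abs_of_nonneg (Finset.sum_nonneg fun η _ => div_nonneg (by positivity) (a_pos α _).le)]
      have h1 : ∑ ξ ∈ (S w N).filter (fun ξ => clear {w} ξ = ζ), (N : ℝ) ^ α / a α (ξ w) ≤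
          ((S w N).filter (fun ξ => clear {w} ξ = ζ)).card • (L : ℝ) ^ α := by
        refine Finset.sum_le_card_nsmul _ _ _ fun η hη => ?_
        have h2 := (Finset.mem_filter.1 (Finset.mem_filter.1 hη).1)
        refine rpow_div_a_le (by linarith) hLpos hN ?_
        have h3 : ∑ v, η v ≤ ∑ _v : ZMod L, η w := Finset.sum_le_sum fun v _ => h2.2.2 v
        rw [mem_confs.1 h2.1, Finset.sum_const, Finset.card_univ, ZMod.card, smul_eq_mul] at h3
        exact_mod_cast h3
      rw [nsmul_eq_mul] at h1
      have h4 : (((S w N).filter (fun ξ => clear {w} ξ = ζ)).card : ℝ) ≤ 1 := by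
        exact_mod_cast hcard
      have h5 : (0 : ℝ) < (L : ℝ) ^ α := Real.rpow_pos_of_pos hLpos α
      have h6 := one_le_momentBound ζ
      nlinarith
    · intro ζ _
      refine tendsto_const_nhds.congr' ?_
      filter_upwards [hℓ.eventually_ge_atTop (size ζ : ℝ)] with N hN
      rw [Finset.sum_eq_zero]
      intro η hη
      exfalso
      have h1 := (hfib N ζ η hη).1
      have h2 := (Finset.mem_filter.1 (Finset.mem_filter.1 hη).1)
      refine h2.2.1 (well_subset_wells (z := w) (mem_well.2 ⟨h2.1, ?_⟩))
      have h3 : (size ζ : ℝ) + η w = N := by exact_mod_cast h1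
      linarith
  have hsum := tendsto_finsetSum Finset.univ fun w (_ : w ∈ Finset.univ) => key w
  rw [Finset.sum_const_zero] at hsum
  refine squeeze_zero (fun N => mul_nonneg (by positivity)
    (Finset.sum_nonneg fun η _ => (weight_pos α η).le)) (fun N => ?_) hsum
  have hterm : ∀ w, ∑ η ∈ S w N, bgWeight α {w} (clear {w} η) * ((N : ℝ) ^ α / a α (η w)) =
      (N : ℝ) ^ α * ∑ η ∈ S w N, weight α η := by
    intro w
    rw [Finset.mul_sum]
    exact Finset.sum_congr rfl fun η _ => by rw [weight_eq_single α w]; ring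
  simp only [hterm]
  rw [← Finset.mul_sum]
  refine mul_le_mul_of_nonneg_left ?_ (by positivity)
  refine (sum_le_sum_filter_cover Finset.univ _ (weight α) (fun η _ => (weight_pos α η).le)
    (fun w η => ∀ v, η v ≤ η w) fun η _ => ?_).trans_eq ?_
  · obtain ⟨w, hw⟩ := exists_max_site η
    exact ⟨w, Finset.mem_univ w, hw⟩
  · refine Finset.sum_congr rfl fun w _ => ?_
    rw [Finset.filter_filter]

theorem tendsto_Z {α : ℝ} (hα : 3 < α) {ℓ : ℕ → ℝ} (hℓ : Tendsto ℓ atTop atTop)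
    (hℓN : Tendsto (fun N : ℕ => ℓ N / (N : ℝ)) atTop (𝓝 0)) :
    Tendsto (fun N : ℕ => Z L α N) atTop (𝓝 (L * Gam α ^ (L - 1))) := by
  have h1 := tendsto_finsetSum Finset.univ
    fun w (_ : w ∈ Finset.univ) => tendsto_weight_well (L := L) hα hℓ hℓN w
  rw [Finset.sum_const, Finset.card_univ, ZMod.card, nsmul_eq_mul] at h1
  have h2 := h1.add (tendsto_weight_off_wells (L := L) hα hℓ)
  rw [add_zero] at h2
  refine h2.congr' ?_
  filter_upwards [eventually_two_mul_lt hℓN two_pos] with N hN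
  unfold Z
  rw [← Finset.sum_filter_add_sum_filter_not (confs L N) (fun η => η ∈ wells N (ℓ N) Finset.univ),
    mul_add, ← Finset.mul_sum]
  congr 2
  rw [← Finset.sum_biUnion]
  · refine Finset.sum_congr ?_ fun _ _ => rfl
    ext η
    simp only [Finset.mem_biUnion, Finset.mem_filter, mem_wells]
    constructor
    · rintro ⟨z, hz, h⟩
      exact ⟨(mem_well.1 h).1, z, hz, h⟩
    · rintro ⟨_, h⟩
      exact h
  · intro z _ w _ hzw
    exact Finset.disjoint_left.2 fun η h1 => disjoint_wells hN hzw h1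

theorem tendsto_mu_well {α : ℝ} (hα : 3 < α) {ℓ : ℕ → ℝ} (hℓ : Tendsto ℓ atTop atTop)
    (hℓN : Tendsto (fun N : ℕ => ℓ N / (N : ℝ)) atTop (𝓝 0)) (w : ZMod L) :
    Tendsto (fun N : ℕ => ∑ η ∈ well N (ℓ N) w, mu α N η) atTop (𝓝 (1 / L)) := by
  have hG := Gam_pos hα
  have hLpos : (0 : ℝ) < L := by exact_mod_cast Nat.pos_of_ne_zero (NeZero.ne L)
  have h1 := (tendsto_weight_well (L := L) hα hℓ hℓN w).div (tendsto_Z (L := L) hα hℓ hℓN)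
    (by positivity)
  have h2 : Gam α ^ (L - 1) / (L * Gam α ^ (L - 1)) = 1 / L := by
    have := pow_pos hG (L - 1)
    field_simp
  rw [h2] at h1
  refine h1.congr fun N => ?_
  unfold mu
  rw [Pi.div_apply, Finset.mul_sum, Finset.sum_div]
  exact Finset.sum_congr rfl fun η _ => by ring

/-! ### The one-dimensional profile -/

/-- The density `s ^ α (1 - s) ^ α`. -/
def kern (α s : ℝ) : ℝ := s ^ α * (1 - s) ^ α

/-- The primitive of `kern`. -/
def prim (α t : ℝ) : ℝ := ∫ s in (0 : ℝ)..t, kern α s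

/-- The projection to `[d, 1 - d]`. -/
def clip (d t : ℝ) : ℝ := max d (min t (1 - d))

theorem continuous_kern {α : ℝ} (hα : 0 < α) : Continuous (kern α) :=
  (continuous_id.rpow_const fun _ => Or.inr hα.le).mul
    ((continuous_const.sub continuous_id).rpow_const fun _ => Or.inr hα.le)

theorem prim_sub {α : ℝ} (hα : 0 < α) (s t : ℝ) :
    prim α t - prim α s = ∫ r in s..t, kern α r :=
  intervalIntegral.integral_interval_sub_left ((continuous_kern hα).intervalIntegrable _ _)
    ((continuous_kern hα).intervalIntegrable _ _)

theorem continuous_prim {α : ℝ} (hα : 0 < α) : Continuous (prim α) :=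
  intervalIntegral.continuous_primitive
    (fun _ _ => (continuous_kern hα).intervalIntegrable _ _) 0

theorem prim_one (α : ℝ) : prim α 1 = I α := rfl

theorem I_pos {α : ℝ} (hα : 0 < α) : 0 < I α := by
  refine intervalIntegral.intervalIntegral_pos_of_pos_on
    ((continuous_kern hα).intervalIntegrable 0 1) (fun s hs => ?_) one_pos
  exact mul_pos (Real.rpow_pos_of_pos hs.1 α) (Real.rpow_pos_of_pos (by linarith [hs.2]) α)

/-- Clipping only shortens the interval of integration, on which the density is at most T^α Q^α. The
two factors will compensate 1/a(ξ_x) and 1/a(ξ_w) near the ends of a tube. -/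
theorem abs_prim_clip_sub_le {α : ℝ} (hα : 0 < α) {d : ℝ} (hd : d < 1 / 2)
    {s t T Q : ℝ} (hs : 0 ≤ s) (hs1 : s ≤ 1) (ht : 0 ≤ t) (ht1 : t ≤ 1) (hsT : s ≤ T)
    (htT : t ≤ T) (hsQ : 1 - s ≤ Q) (htQ : 1 - t ≤ Q) :
    |prim α (clip d t) - prim α (clip d s)| ≤ |t - s| * (T ^ α * Q ^ α) := by
  wlog hst : s ≤ t generalizing s t
  · rw [abs_sub_comm, abs_sub_comm t s]
    exact this ht ht1 hs hs1 htT hsT htQ hsQ (le_of_not_ge hst)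
  have hT : 0 ≤ T := hs.trans hsT
  have hQ : 0 ≤ Q := by linarith
  have hR : 0 ≤ |t - s| * (T ^ α * Q ^ α) :=
    mul_nonneg (abs_nonneg _) (mul_nonneg (Real.rpow_nonneg hT α) (Real.rpow_nonneg hQ α))
  rcases le_or_gt t d with h1 | h1
  · have e1 : clip d t = d := max_eq_left ((min_le_left _ _).trans h1)
    have e2 : clip d s = d := max_eq_left ((min_le_left _ _).trans (hst.trans h1))
    rw [e1, e2, sub_self, abs_zero]; exact hR
  rcases le_or_gt (1 - d) s with h2 | h2
  · have e1 : clip d t = max d (1 - d) := by rw [clip, min_eq_right (h2.trans hst)]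
    have e2 : clip d s = max d (1 - d) := by rw [clip, min_eq_right h2]
    rw [e1, e2, sub_self, abs_zero]; exact hR
  have e1 : clip d t = min t (1 - d) := max_eq_right (le_min h1.le (by linarith))
  have e2 : clip d s = max d s := by rw [clip, min_eq_left h2.le]
  have h3 : min t (1 - d) ≤ t := min_le_left _ _
  have h4 : s ≤ max d s := le_max_right _ _
  have h5 : max d s ≤ min t (1 - d) :=
    max_le (le_min h1.le (by linarith)) (le_min hst h2.le)
  rw [prim_sub hα, e1, e2, ← Real.norm_eq_abs, mul_comm]
  refine (intervalIntegral.norm_integral_le_of_norm_le_const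
    (C := T ^ α * Q ^ α) fun r hr => ?_).trans ?_
  · rw [Set.uIoc_of_le h5] at hr
    have hr0 : 0 ≤ r := hs.trans (h4.trans hr.1.le)
    have hr1 : 0 ≤ 1 - r := by linarith [hr.2, h3]
    rw [kern, Real.norm_eq_abs, abs_of_nonneg (mul_nonneg (Real.rpow_nonneg hr0 α)
      (Real.rpow_nonneg hr1 α))]
    refine mul_le_mul (Real.rpow_le_rpow hr0 (by linarith [hr.2]) hα.le)
      (Real.rpow_le_rpow hr1 (by linarith [hr.1]) hα.le) (Real.rpow_nonneg hr1 α)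
      (Real.rpow_nonneg hT α)
  · refine mul_le_mul_of_nonneg_left ?_
      (mul_nonneg (Real.rpow_nonneg hT α) (Real.rpow_nonneg hQ α))
    rw [abs_of_nonneg (by linarith), abs_of_nonneg (by linarith)]
    linarith

theorem abs_rpow_sub_le {α : ℝ} (hα : 1 ≤ α) {s p : ℝ} (hs : s ∈ Set.Icc (0 : ℝ) 1)
    (hp : p ∈ Set.Icc (0 : ℝ) 1) : |s ^ α - p ^ α| ≤ α * |s - p| := by
  have h := Convex.norm_image_sub_le_of_norm_hasDerivWithin_le (𝕜 := ℝ)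
    (f := fun r : ℝ => r ^ α) (f' := fun r => α * r ^ (α - 1)) (s := Set.Icc (0 : ℝ) 1) (C := α)
    (x := p) (y := s)
    (fun r _ => (Real.hasDerivAt_rpow_const (Or.inr hα)).hasDerivWithinAt) (fun r hr => ?_)
    (convex_Icc 0 1) hp hs
  · simpa [Real.norm_eq_abs] using h
  · rw [Real.norm_eq_abs, abs_of_nonneg (mul_nonneg (by linarith) (Real.rpow_nonneg hr.1 _))]
    exact mul_le_of_le_one_right (by linarith) (Real.rpow_le_one hr.1 hr.2 (by linarith))

theorem abs_rpow_mul_rpow_sub_le {α : ℝ} (hα : 1 ≤ α) {s t p q : ℝ}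
    (hs : s ∈ Set.Icc (0 : ℝ) 1) (ht : t ∈ Set.Icc (0 : ℝ) 1)
    (hp : p ∈ Set.Icc (0 : ℝ) 1) (hq : q ∈ Set.Icc (0 : ℝ) 1) :
    |s ^ α * t ^ α - p ^ α * q ^ α| ≤ α * (|s - p| + |t - q|) := by
  have h1 := abs_rpow_sub_le hα hs hp
  have h2 := abs_rpow_sub_le hα ht hq
  have h3 : |t ^ α| ≤ 1 := by
    rw [abs_of_nonneg (Real.rpow_nonneg ht.1 _)]
    exact Real.rpow_le_one ht.1 ht.2 (by linarith)
  have h4 : |p ^ α| ≤ 1 := by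
    rw [abs_of_nonneg (Real.rpow_nonneg hp.1 _)]
    exact Real.rpow_le_one hp.1 hp.2 (by linarith)
  have h5 : s ^ α * t ^ α - p ^ α * q ^ α =
      (s ^ α - p ^ α) * t ^ α + p ^ α * (t ^ α - q ^ α) := by ring
  rw [h5]
  refine (abs_add_le _ _).trans ?_
  rw [abs_mul, abs_mul, mul_add]
  refine add_le_add ?_ ?_
  · exact (mul_le_of_le_one_right (abs_nonneg _) h3).trans h1
  · exact (mul_le_of_le_one_left (abs_nonneg _) h4).trans h2

/-! ### The test functions -/

/-- The sites `x, x + 1, …, w - 1`. -/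
def arc (x w : ZMod L) : Finset (ZMod L) :=
  Finset.univ.filter fun z => (z - x).val < (w - x).val

theorem mem_arc {x w z : ZMod L} : z ∈ arc x w ↔ (z - x).val < (w - x).val := by simp [arc]

theorem left_mem_arc {x w : ZMod L} (h : w ≠ x) : x ∈ arc x w := by
  rw [mem_arc, sub_self, ZMod.val_zero]
  exact Nat.pos_of_ne_zero fun h0 => h (sub_eq_zero.1 ((ZMod.val_eq_zero _).1 h0))

theorem right_notMem_arc (x w : ZMod L) : w ∉ arc x w := by simp [mem_arc]

/-- Makes x - 1 a base point valid for all arcs starting at x, whatever their end. -/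
theorem sub_one_notMem_arc (hL : 2 ≤ L) (x w : ZMod L) : x - 1 ∉ arc x w := by
  have h1 : (x - 1 - x : ZMod L) = -1 := by ring
  have h2 : (-1 : ZMod L).val = L - 1 := by
    obtain ⟨n, rfl⟩ : ∃ n, L = n + 1 := ⟨L - 1, by omega⟩
    rw [ZMod.val_neg_one]; rfl
  have h3 := ZMod.val_lt (w - x)
  rw [mem_arc, h1, h2]
  omega

/-- Summation along an arc. -/
theorem sum_arc_sub (x w : ZMod L) (F : ZMod L → ℝ) :
    ∑ z ∈ arc x w, (F (z + 1) - F z) = F w - F x := by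
  have h1 : ∑ z ∈ arc x w, (F (z + 1) - F z) =
      ∑ j ∈ Finset.range (w - x).val, (F (x + (j + 1 : ℕ)) - F (x + (j : ℕ))) := by
    refine Finset.sum_bij' (fun z _ => (z - x).val) (fun j _ => x + (j : ℕ)) ?_ ?_ ?_ ?_ ?_
    · intro z hz
      exact Finset.mem_range.2 (mem_arc.1 hz)
    · intro j hj
      have hj' := Finset.mem_range.1 hj
      rw [mem_arc, add_sub_cancel_left, ZMod.val_natCast_of_lt (hj'.trans (ZMod.val_lt _))]
      exact hj'
    · intro z _
      simp
    · intro j hj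
      have hj' := Finset.mem_range.1 hj
      rw [add_sub_cancel_left, ZMod.val_natCast_of_lt (hj'.trans (ZMod.val_lt _))]
    · intro z _
      have : x + (((z - x).val : ℕ) : ZMod L) = z := by simp
      rw [Nat.cast_add, ← add_assoc, this, Nat.cast_one]
  rw [h1, Finset.sum_range_sub (fun j : ℕ => F (x + (j : ZMod L)))]
  simp

/-- `w` carries the most particles among the sites other than `x`. -/
def IsDominant (x : ZMod L) (η : Config L) (w : ZMod L) : Prop :=
  w ≠ x ∧ ∀ v, v ≠ x → η v ≤ η w

theorem exists_isDominant (hL : 2 ≤ L) (x : ZMod L) (η : Config L) : ∃ w, IsDominant x η w := by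
  have hne : ((Finset.univ : Finset (ZMod L)).erase x).Nonempty := by
    refine ⟨x + 1, Finset.mem_erase.2 ⟨fun h => ?_, Finset.mem_univ _⟩⟩
    exact one_ne_zero_of_two_le hL (by simpa using h)
  obtain ⟨w, hw, hmax⟩ := Finset.exists_max_image _ η hne
  exact ⟨w, Finset.ne_of_mem_erase hw,
    fun v hv => hmax v (Finset.mem_erase.2 ⟨hv, Finset.mem_univ v⟩)⟩

open Classical in
/-- A dominant site. -/
def domSite (x : ZMod L) (η : Config L) : ZMod L :=
  if h : ∃ w, IsDominant x η w then h.choose else x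

theorem isDominant_domSite (hL : 2 ≤ L) (x : ZMod L) (η : Config L) :
    IsDominant x η (domSite x η) := by
  rw [domSite, dif_pos (exists_isDominant hL x η)]
  exact (exists_isDominant hL x η).choose_spec

/-- The approximate position along the tube between `x` and the dominant site. -/
def coord (x : ZMod L) (η : Config L) : ℕ :=
  η x + min (η x) (∑ v ∈ (arc x (domSite x η)).erase x, η v)

/-- The (not normalized) test function centred at `x`. -/
def testFn (α : ℝ) (N : ℕ) (d : ℝ) (x : ZMod L) (η : Config L) : ℝ :=
  prim α (clip d ((coord x η : ℝ) / N)) - prim α d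

theorem le_coord (x : ZMod L) (η : Config L) : η x ≤ coord x η := Nat.le_add_right _ _

/-- The purpose of the minimum in `coord`: the test function stays flat when x is nearly empty, even
if many particles sit elsewhere on the arc. -/
theorem coord_le_two_mul (x : ZMod L) (η : Config L) : coord x η ≤ 2 * η x := by
  unfold coord
  have := min_le_left (η x) (∑ v ∈ (arc x (domSite x η)).erase x, η v)
  omega

theorem coord_add_domSite_le (hL : 2 ≤ L) (x : ZMod L) (η : Config L) :
    coord x η + η (domSite x η) ≤ ∑ v, η v := by
  have hx := (isDominant_domSite hL x η).1
  have h1 : coord x η ≤ ∑ v ∈ arc x (domSite x η), η v := by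
    rw [← Finset.add_sum_erase _ η (left_mem_arc hx)]
    unfold coord
    have := min_le_right (η x) (∑ v ∈ (arc x (domSite x η)).erase x, η v)
    omega
  refine (Nat.add_le_add_right h1 _).trans ?_
  rw [add_comm, ← Finset.sum_insert (right_notMem_arc x (domSite x η))]
  exact Finset.sum_le_sum_of_subset (Finset.subset_univ _)

theorem testFn_eq_on_well {α : ℝ} {N : ℕ} {l d : ℝ} (hN : 0 < N)
    (hd : d < 1 / 2) (hld : l ≤ d * N) {x : ZMod L} {η : Config L} (hη : η ∈ well N l x) :
    testFn α N d x η = prim α (1 - d) - prim α d := by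
  have hNpos : (0 : ℝ) < N := by exact_mod_cast hN
  have h1 : (1 - d) ≤ (coord x η : ℝ) / N := by
    rw [le_div_iff₀ hNpos]
    have h2 := (mem_well.1 hη).2
    have h3 : (η x : ℝ) ≤ coord x η := by exact_mod_cast le_coord x η
    linarith
  unfold testFn clip
  rw [min_eq_right h1, max_eq_right (by linarith)]

/-- On another well η_x ≤ l, hence the coordinate is at most 2l. This factor 2 dictates the later
choice d = 2 ℓ_N / N. -/
theorem testFn_eq_zero_on_well {α : ℝ} {N : ℕ} {l d : ℝ} (hN : 0 < N)
    (hld : 2 * l ≤ d * N) {x z : ZMod L} (hzx : z ≠ x) {η : Config L}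
    (hη : η ∈ well N l z) : testFn α N d x η = 0 := by
  have hNpos : (0 : ℝ) < N := by exact_mod_cast hN
  obtain ⟨h1, h2⟩ := mem_well.1 hη
  have h4 : η z + η x ≤ N := by
    rw [← mem_confs.1 h1, ← Finset.sum_pair hzx]
    exact Finset.sum_le_sum_of_subset (Finset.subset_univ _)
  have h5 : (η z : ℝ) + η x ≤ N := by exact_mod_cast h4
  have h6 : (coord x η : ℝ) ≤ 2 * η x := by exact_mod_cast coord_le_two_mul x η
  have h7 : (coord x η : ℝ) / N ≤ d := by
    rw [div_le_iff₀ hNpos]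
    linarith
  unfold testFn clip
  rw [max_eq_left ((min_le_left _ _).trans h7), sub_self]

/-! ### The gradients of the test functions -/

theorem rpow_succ_le_two_rpow_mul_a {α : ℝ} (hα : 0 ≤ α) (n : ℕ) :
    ((n : ℝ) + 1) ^ α ≤ 2 ^ α * a α n := by
  rcases Nat.eq_zero_or_pos n with rfl | h
  · simp only [a, if_true, Nat.cast_zero, zero_add, Real.one_rpow, mul_one]
    exact Real.one_le_rpow one_le_two hα
  · rw [a_of_pos α h, ← Real.mul_rpow two_pos.le (Nat.cast_nonneg n)]
    refine Real.rpow_le_rpow (by positivity) ?_ hα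
    have : (1 : ℝ) ≤ n := by exact_mod_cast h
    linarith

theorem a_le_rpow {α : ℝ} (hα : 0 ≤ α) {n N : ℕ} (hN : 1 ≤ N) (h : n ≤ N) :
    a α n ≤ (N : ℝ) ^ α := by
  unfold a
  split_ifs
  · exact Real.one_le_rpow (by exact_mod_cast hN) hα
  · exact Real.rpow_le_rpow (by positivity) (by exact_mod_cast h) hα

theorem a_mono {α : ℝ} (hα : 0 ≤ α) {n m : ℕ} (h : n ≤ m) : a α n ≤ a α m := by
  rcases Nat.eq_zero_or_pos m with rfl | hm
  · rw [Nat.le_zero.1 h]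
  · rw [a_of_pos α hm]
    exact a_le_rpow hα hm h

theorem size_clear_pair {n : ℕ} {x w : ZMod L} (hxw : x ≠ w) {ξ : Config L}
    (hξ : ξ ∈ confs L n) : size (clear {x, w} ξ) + (ξ x + ξ w) = n := by
  rw [← mem_confs.1 hξ, ← size_clear_add {x, w} ξ, Finset.sum_pair hxw]

/-- The dominant site may change when a particle is added, but the new one carries at least as many
particles as w, which is enough for the upper bound. -/
theorem coord_addAt_bounds (hL : 2 ≤ L) {n : ℕ} {x w : ZMod L} {ξ : Config L}
    (hξ : ξ ∈ confs L n) (hw : IsDominant x ξ w) (z : ZMod L) :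
    ξ x ≤ coord x (addAt ξ z) ∧ coord x (addAt ξ z) ≤ ξ x + size (clear {x, w} ξ) + 1 := by
  refine ⟨(le_addAt ξ z x).trans (le_coord _ _), ?_⟩
  have h1 := coord_add_domSite_le hL x (addAt ξ z)
  have h2 := (isDominant_domSite hL x (addAt ξ z)).2 w hw.1
  have h3 := le_addAt ξ z w
  have h4 := mem_confs.1 (addAt_mem_confs hξ z)
  have h5 := size_clear_pair hw.1.symm hξ
  omega

/-- The coordinate varies along a cycle by at most the background size plus a constant, and the
density there is at most of order (ξ_x ξ_w)^α / N^(2α). The bound also covers configurations outside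
the deep tubes, uniformly in d. -/
theorem abs_testFn_sub_le (hL : 2 ≤ L) {α : ℝ} (hα : 0 < α) {N : ℕ} (hN : 1 ≤ N) {d : ℝ}
    (hd : d < 1 / 2) {x w : ZMod L} {ξ : Config L} (hξ : ξ ∈ confs L (N - 1))
    (hw : IsDominant x ξ w) (z z' : ZMod L) :
    |testFn α N d x (addAt ξ z) - testFn α N d x (addAt ξ z')| ≤
      (8 * L) ^ α * (size (clear {x, w} ξ) + 3) *
        (a α (ξ x) * a α (ξ w) / (N * ((N : ℝ) ^ α) ^ 2)) := by
  have hNpos : (0 : ℝ) < N := by exact_mod_cast hN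
  have hLpos : (0 : ℝ) < L := by exact_mod_cast (by omega : 0 < L)
  have hb := coord_addAt_bounds hL hξ hw
  have hsz := size_clear_pair hw.1.symm hξ
  have hle : ∀ y, (coord x (addAt ξ y) : ℝ) ≤ N := by
    intro y
    have h1 := coord_add_domSite_le hL x (addAt ξ y)
    rw [mem_confs.1 (addAt_mem_confs hξ y)] at h1
    exact_mod_cast (by omega : coord x (addAt ξ y) ≤ N)
  have hT : ∀ y, (coord x (addAt ξ y) : ℝ) / N ≤ 2 * ((ξ x : ℝ) + 1) / N := by
    intro y
    have h1 := coord_le_two_mul x (addAt ξ y)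
    have h2 := addAt_le ξ y x
    gcongr
    exact_mod_cast (by omega : coord x (addAt ξ y) ≤ 2 * (ξ x + 1))
  -- Since w is dominant, the particles away from x number at most (L - 1) ξ_w.
  have hsum : N ≤ ξ x + L * (ξ w + 1) := by
    have h1 := mem_confs.1 hξ
    rw [← Finset.add_sum_erase _ ξ (Finset.mem_univ x)] at h1
    have h2 : ∑ v ∈ Finset.univ.erase x, ξ v ≤ ∑ _v ∈ (Finset.univ : Finset (ZMod L)).erase x, ξ w :=
      Finset.sum_le_sum fun v hv => hw.2 v (Finset.ne_of_mem_erase hv)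
    rw [Finset.sum_const, Finset.card_erase_of_mem (Finset.mem_univ x), Finset.card_univ,
      ZMod.card, smul_eq_mul] at h2
    have h3 : (L - 1) * ξ w ≤ L * ξ w := Nat.mul_le_mul_right _ (Nat.sub_le _ _)
    have h4 : L * (ξ w + 1) = L * ξ w + L := by ring
    omega
  have hQ : ∀ y, 1 - (coord x (addAt ξ y) : ℝ) / N ≤ L * ((ξ w : ℝ) + 1) / N := by
    intro y
    rw [sub_le_iff_le_add, ← add_div, le_div_iff₀ hNpos, one_mul]
    have h2 := (hb y).1
    exact_mod_cast (by omega : N ≤ L * (ξ w + 1) + coord x (addAt ξ y))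
  have h01 : ∀ y, (coord x (addAt ξ y) : ℝ) / N ≤ 1 := fun y => (div_le_one hNpos).2 (hle y)
  have h00 : ∀ y, 0 ≤ (coord x (addAt ξ y) : ℝ) / N := fun y => by positivity
  have hmain := abs_prim_clip_sub_le hα hd (h00 z') (h01 z') (h00 z) (h01 z) (hT z') (hT z)
    (hQ z') (hQ z)
  have e1 : testFn α N d x (addAt ξ z) - testFn α N d x (addAt ξ z') =
      prim α (clip d ((coord x (addAt ξ z) : ℝ) / N)) -
        prim α (clip d ((coord x (addAt ξ z') : ℝ) / N)) := by
    unfold testFn; ring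
  rw [e1]
  refine hmain.trans ?_
  have hdiff : |(coord x (addAt ξ z) : ℝ) / N - (coord x (addAt ξ z') : ℝ) / N| ≤
      ((size (clear {x, w} ξ) : ℝ) + 3) / N := by
    rw [← sub_div, abs_div, abs_of_pos hNpos]
    gcongr
    have c1 : (ξ x : ℝ) ≤ coord x (addAt ξ z) := by exact_mod_cast (hb z).1
    have c2 : (ξ x : ℝ) ≤ coord x (addAt ξ z') := by exact_mod_cast (hb z').1
    have c3 : (coord x (addAt ξ z) : ℝ) ≤ ξ x + size (clear {x, w} ξ) + 1 := by
      exact_mod_cast (hb z).2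
    have c4 : (coord x (addAt ξ z') : ℝ) ≤ ξ x + size (clear {x, w} ξ) + 1 := by
      exact_mod_cast (hb z').2
    rw [abs_le]
    constructor <;> linarith
  have hP : (0 : ℝ) < (N : ℝ) ^ α := Real.rpow_pos_of_pos hNpos α
  have hTQ : (2 * ((ξ x : ℝ) + 1) / N) ^ α * (L * ((ξ w : ℝ) + 1) / N) ^ α ≤
      (8 * L) ^ α * (a α (ξ x) * a α (ξ w)) / ((N : ℝ) ^ α) ^ 2 := by
    rw [Real.div_rpow (by positivity) hNpos.le, Real.div_rpow (by positivity) hNpos.le,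
      div_mul_div_comm, ← sq]
    refine div_le_div_of_nonneg_right ?_ (by positivity)
    rw [Real.mul_rpow two_pos.le (by positivity), Real.mul_rpow hLpos.le (by positivity)]
    -- The factors 2 and L come from T and Q, the other two from replacing (n + 1)^α by 2^α a(n).
    have e2 : ((8 : ℝ) * L) ^ α = 2 ^ α * L ^ α * (2 ^ α * 2 ^ α) := by
      rw [← Real.mul_rpow two_pos.le hLpos.le, ← Real.mul_rpow two_pos.le two_pos.le,
        ← Real.mul_rpow (by positivity) (by positivity)]
      congr 1; ring
    have h5 := rpow_succ_le_two_rpow_mul_a hα.le (ξ x)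
    have h6 := rpow_succ_le_two_rpow_mul_a hα.le (ξ w)
    have h7 := mul_le_mul h5 h6 (Real.rpow_nonneg (by positivity) α)
      (mul_nonneg (Real.rpow_nonneg two_pos.le α) (a_pos α _).le)
    have h8 : (0 : ℝ) ≤ 2 ^ α * (L : ℝ) ^ α := by positivity
    have h9 := mul_le_mul_of_nonneg_left h7 h8
    rw [e2]
    linarith
  calc |(coord x (addAt ξ z) : ℝ) / N - (coord x (addAt ξ z') : ℝ) / N| *
        ((2 * ((ξ x : ℝ) + 1) / N) ^ α * (L * ((ξ w : ℝ) + 1) / N) ^ α)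
      ≤ ((size (clear {x, w} ξ) : ℝ) + 3) / N *
          ((8 * L) ^ α * (a α (ξ x) * a α (ξ w)) / ((N : ℝ) ^ α) ^ 2) := by
        refine mul_le_mul hdiff hTQ ?_ (by positivity)
        exact mul_nonneg (Real.rpow_nonneg (by positivity) α) (Real.rpow_nonneg (by positivity) α)
    _ = _ := by field_simp

/-- The strength of the flow between `x` and `w`. -/
def flowCoef (α : ℝ) (N : ℕ) (l : ℝ) (x w : ZMod L) (ξ : Config L) : ℝ :=
  if (size (clear {x, w} ξ) : ℝ) ≤ l then a α (ξ x) * a α (ξ w) / (N * ((N : ℝ) ^ α) ^ 2) else 0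

/-- The approximation of the gradient of the test function. -/
def flow (α : ℝ) (N : ℕ) (l : ℝ) (x : ZMod L) (ξ : Config L) (z : ZMod L) : ℝ :=
  ∑ w ∈ Finset.univ.erase x, if z ∈ arc x w then flowCoef α N l x w ξ else 0

/-- The difference between the gradient of the test function and its approximation. -/
def errFn (α : ℝ) (N : ℕ) (l d : ℝ) (x : ZMod L) (ξ : Config L) (z : ZMod L) : ℝ :=
  testFn α N d x (addAt ξ z) - testFn α N d x (addAt ξ (x - 1)) - flow α N l x ξ z

theorem flowCoef_nonneg (α : ℝ) (N : ℕ) (l : ℝ) (x w : ZMod L) (ξ : Config L) :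
    0 ≤ flowCoef α N l x w ξ := by
  unfold flowCoef
  split_ifs
  · exact div_nonneg (mul_nonneg (a_pos α _).le (a_pos α _).le) (by positivity)
  · exact le_rfl

theorem abs_flow_le {α : ℝ} (hα : 0 < α) {N : ℕ} {l : ℝ} {x w : ZMod L} {ξ : Config L}
    (hw : IsDominant x ξ w) (z : ZMod L) :
    |flow α N l x ξ z| ≤ L * (a α (ξ x) * a α (ξ w) / (N * ((N : ℝ) ^ α) ^ 2)) := by
  have hK : 0 ≤ a α (ξ x) * a α (ξ w) / (N * ((N : ℝ) ^ α) ^ 2) :=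
    div_nonneg (mul_nonneg (a_pos α _).le (a_pos α _).le) (by positivity)
  have h1 : ∀ v ∈ Finset.univ.erase x, (if z ∈ arc x v then flowCoef α N l x v ξ else 0) ≤
      a α (ξ x) * a α (ξ w) / (N * ((N : ℝ) ^ α) ^ 2) := by
    intro v hv
    split_ifs
    · unfold flowCoef
      split_ifs
      · have := a_mono hα.le (hw.2 v (Finset.ne_of_mem_erase hv))
        have := (a_pos α (ξ x)).le
        gcongr
      · exact hK
    · exact hK
  have h2 : 0 ≤ flow α N l x ξ z := Finset.sum_nonneg fun v _ => by
    split_ifs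
    · exact flowCoef_nonneg _ _ _ _ _ _
    · exact le_rfl
  rw [abs_of_nonneg h2]
  refine (Finset.sum_le_card_nsmul _ _ _ h1).trans ?_
  rw [nsmul_eq_mul]
  refine mul_le_mul_of_nonneg_right ?_ hK
  have := Finset.card_erase_le (s := (Finset.univ : Finset (ZMod L))) (a := x)
  rw [Finset.card_univ, ZMod.card] at this
  exact_mod_cast this

/-- The scale factor which makes squared gradients bounded. -/
def gradScale (α : ℝ) (N : ℕ) (x w : ZMod L) (ξ : Config L) : ℝ :=
  ((N : ℝ) * (N : ℝ) ^ α) ^ 2 / (a α (ξ x) * a α (ξ w))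

theorem gradScale_nonneg (α : ℝ) (N : ℕ) (x w : ZMod L) (ξ : Config L) :
    0 ≤ gradScale α N x w ξ :=
  div_nonneg (sq_nonneg _) (mul_nonneg (a_pos α _).le (a_pos α _).le)

theorem gradScale_mul_sq_le {α : ℝ} (hα : 0 < α) {N : ℕ} (hN : 1 ≤ N) {x w : ZMod L}
    {ξ : Config L} (hξ : ξ ∈ confs L (N - 1)) {b c : ℝ}
    (h : |b| ≤ c * (a α (ξ x) * a α (ξ w) / (N * ((N : ℝ) ^ α) ^ 2))) :
    gradScale α N x w ξ * b ^ 2 ≤ c ^ 2 := by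
  have hNpos : (0 : ℝ) < N := by exact_mod_cast hN
  have hP : (0 : ℝ) < (N : ℝ) ^ α := Real.rpow_pos_of_pos hNpos α
  have hle : ∀ v, ξ v ≤ N := by
    intro v
    have h1 := Finset.single_le_sum (f := ξ) (fun _ _ => Nat.zero_le _) (Finset.mem_univ v)
    rw [mem_confs.1 hξ] at h1
    omega
  have hA : 0 < a α (ξ x) * a α (ξ w) := mul_pos (a_pos α _) (a_pos α _)
  have hA' : a α (ξ x) * a α (ξ w) ≤ ((N : ℝ) ^ α) ^ 2 := by
    rw [sq]
    exact mul_le_mul (a_le_rpow hα.le hN (hle x)) (a_le_rpow hα.le hN (hle w)) (a_pos α _).le hP.le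
  have h2 : b ^ 2 ≤ (c * (a α (ξ x) * a α (ξ w) / (N * ((N : ℝ) ^ α) ^ 2))) ^ 2 :=
    sq_le_sq' (by linarith [(abs_le.1 h).1]) (abs_le.1 h).2
  refine (mul_le_mul_of_nonneg_left h2 (gradScale_nonneg α N x w ξ)).trans ?_
  have h3 : gradScale α N x w ξ * (c * (a α (ξ x) * a α (ξ w) / (N * ((N : ℝ) ^ α) ^ 2))) ^ 2 =
      c ^ 2 * ((a α (ξ x) * a α (ξ w)) / ((N : ℝ) ^ α) ^ 2) := by
    unfold gradScale
    generalize a α (ξ x) * a α (ξ w) = A at *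
    field_simp
  rw [h3]
  exact mul_le_of_le_one_right (sq_nonneg c) ((div_le_one (by positivity)).2 hA')

theorem gradScale_mul_testFn_sq_le (hL : 2 ≤ L) {α : ℝ} (hα : 0 < α) {N : ℕ} (hN : 1 ≤ N) {d : ℝ}
    (hd : d < 1 / 2) {x w : ZMod L} {ξ : Config L} (hξ : ξ ∈ confs L (N - 1))
    (hw : IsDominant x ξ w) (z z' : ZMod L) :
    gradScale α N x w ξ * (testFn α N d x (addAt ξ z) - testFn α N d x (addAt ξ z')) ^ 2 ≤
      ((8 * L : ℝ) ^ α) ^ 2 * 9 * momentBound (clear {x, w} ξ) := by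
  refine (gradScale_mul_sq_le hα hN hξ (abs_testFn_sub_le hL hα hN hd hξ hw z z')).trans ?_
  rw [mul_pow, mul_assoc]
  exact mul_le_mul_of_nonneg_left (size_sq_le_momentBound _) (sq_nonneg _)

theorem gradScale_mul_errFn_sq_le (hL : 2 ≤ L) {α : ℝ} (hα : 0 < α) {N : ℕ} (hN : 1 ≤ N)
    {l d : ℝ} (hd : d < 1 / 2) {x w : ZMod L} {ξ : Config L} (hξ : ξ ∈ confs L (N - 1))
    (hw : IsDominant x ξ w) (z : ZMod L) :
    gradScale α N x w ξ * errFn α N l d x ξ z ^ 2 ≤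
      (18 * ((8 * L : ℝ) ^ α) ^ 2 + 2 * L ^ 2) * momentBound (clear {x, w} ξ) := by
  have h1 := gradScale_mul_testFn_sq_le hL hα hN hd hξ hw z (x - 1)
  have h2 := gradScale_mul_sq_le hα hN hξ (abs_flow_le (N := N) (l := l) hα hw z)
  have h3 : errFn α N l d x ξ z ^ 2 ≤
      2 * (testFn α N d x (addAt ξ z) - testFn α N d x (addAt ξ (x - 1))) ^ 2 +
        2 * flow α N l x ξ z ^ 2 := by
    unfold errFn
    nlinarith [sq_nonneg (testFn α N d x (addAt ξ z) - testFn α N d x (addAt ξ (x - 1)) +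
      flow α N l x ξ z)]
  have h4 := mul_le_mul_of_nonneg_left h3 (gradScale_nonneg α N x w ξ)
  have h5 := one_le_momentBound (clear {x, w} ξ)
  have h6 : (L : ℝ) ^ 2 * 1 ≤ (L : ℝ) ^ 2 * momentBound (clear {x, w} ξ) :=
    mul_le_mul_of_nonneg_left h5 (sq_nonneg _)
  linarith

/-! ### The error is small in the tubes -/

theorem apply_le_size_clear {A : Finset (ZMod L)} {v : ZMod L} (hv : v ∉ A) (ξ : Config L) :
    ξ v ≤ size (clear A ξ) := by
  have h := Finset.single_le_sum (f := clear A ξ) (fun _ _ => Nat.zero_le _) (Finset.mem_univ v)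
  rwa [clear, if_neg hv] at h

/-- Deep in a tube the background is too small to supply the dominant site or to activate the
minimum, so the coordinate counts the particles on the arc. -/
theorem coord_addAt_of_tube (hL : 2 ≤ L) {x w : ZMod L} (hxw : x ≠ w) {ξ : Config L}
    (hx : size (clear {x, w} ξ) + 2 ≤ ξ x) (hw : size (clear {x, w} ξ) + 2 ≤ ξ w)
    (z : ZMod L) :
    coord x (addAt ξ z) = ∑ v ∈ arc x w, ξ v + if z ∈ arc x w then 1 else 0 := by
  have hdom : domSite x (addAt ξ z) = w := by
    by_contra hne
    obtain ⟨h1, h2⟩ := isDominant_domSite hL x (addAt ξ z)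
    have h3 := h2 w hxw.symm
    have h4 := addAt_le ξ z (domSite x (addAt ξ z))
    have h5 := le_addAt ξ z w
    have h6 := apply_le_size_clear (A := {x, w}) (v := domSite x (addAt ξ z))
      (by simp [h1, hne]) ξ
    omega
  have h1 : ∑ v ∈ (arc x w).erase x, ξ v ≤ size (clear {x, w} ξ) := by
    have h2 : ∑ v ∈ (arc x w).erase x, ξ v = ∑ v ∈ (arc x w).erase x, clear {x, w} ξ v := by
      refine Finset.sum_congr rfl fun v hv => ?_
      have hv1 := Finset.ne_of_mem_erase hv
      have hv2 : v ≠ w := by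
        rintro rfl
        exact right_notMem_arc x v (Finset.mem_of_mem_erase hv)
      simp [clear, hv1, hv2]
    rw [h2]
    exact Finset.sum_le_sum_of_subset (Finset.subset_univ _)
  have h3 := sum_addAt ξ z ((arc x w).erase x)
  have h4 : ∑ v ∈ (arc x w).erase x, addAt ξ z v ≤ addAt ξ z x := by
    have := le_addAt ξ z x
    split_ifs at h3 <;> omega
  unfold coord
  rw [hdom, min_eq_right h4, Finset.add_sum_erase _ (addAt ξ z) (left_mem_arc hxw.symm),
    sum_addAt]

/-- For v ≠ w the site w belongs to the background of the pair {x, v}, which then exceeds the cutoff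
l. -/
theorem flow_of_tube {α : ℝ} {N : ℕ} {l : ℝ} {x w : ZMod L} (hxw : x ≠ w) {ξ : Config L}
    (hl : (size (clear {x, w} ξ) : ℝ) ≤ l) (hlw : l < ξ w) (z : ZMod L) :
    flow α N l x ξ z =
      if z ∈ arc x w then a α (ξ x) * a α (ξ w) / (N * ((N : ℝ) ^ α) ^ 2) else 0 := by
  unfold flow
  rw [Finset.sum_eq_single_of_mem w (Finset.mem_erase.2 ⟨hxw.symm, Finset.mem_univ w⟩)]
  · rw [flowCoef, if_pos hl]
  · intro v _ hvw
    have h1 := apply_le_size_clear (A := {x, v}) (v := w) (by simp [hxw.symm, hvw.symm]) ξ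
    have h2 : (ξ w : ℝ) ≤ size (clear {x, v} ξ) := by exact_mod_cast h1
    have h3 : flowCoef α N l x v ξ = 0 := if_neg (not_le.2 (hlw.trans_le h2))
    rw [h3, ite_self]

/-- The increment is an integral of the density over an interval of length 1/N on which r and 1 - r
are within (k+1)/N of ξ_x/N and ξ_w/N. The Lipschitz bound on s^α t^α gives the rest. -/
theorem abs_errFn_le_of_tube (hL : 2 ≤ L) {α : ℝ} (hα : 1 ≤ α) {N : ℕ} (hN : 1 ≤ N) {l d : ℝ}
    {x w : ZMod L} (hxw : x ≠ w) {ξ : Config L} (hξ : ξ ∈ confs L (N - 1))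
    (hx : size (clear {x, w} ξ) + 2 ≤ ξ x) (hw : size (clear {x, w} ξ) + 2 ≤ ξ w)
    (hl : (size (clear {x, w} ξ) : ℝ) ≤ l) (hlw : l < ξ w)
    (hdx : d * N ≤ ξ x) (hdw : d * N ≤ ξ w) (z : ZMod L) :
    |errFn α N l d x ξ z| ≤ 2 * α * (size (clear {x, w} ξ) + 1) / (N : ℝ) ^ 2 := by
  have hNpos : (0 : ℝ) < N := by exact_mod_cast hN
  set k := size (clear {x, w} ξ) with hk
  have hsz := size_clear_pair hxw hξ
  rw [← hk] at hsz
  have hszR : (k : ℝ) + (ξ x + ξ w) + 1 = N := by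
    exact_mod_cast (by omega : k + (ξ x + ξ w) + 1 = N)
  set m := ∑ v ∈ arc x w, ξ v with hm
  have hm1 : ξ x ≤ m := Finset.single_le_sum (f := ξ) (fun _ _ => Nat.zero_le _)
    (left_mem_arc hxw.symm)
  have hm2 : m ≤ ξ x + k := by
    have h1 : ∑ v ∈ insert w (arc x w), ξ v ≤ ∑ v, ξ v :=
      Finset.sum_le_sum_of_subset (Finset.subset_univ _)
    rw [Finset.sum_insert (right_notMem_arc x w), mem_confs.1 hξ] at h1
    omega
  have hm1R : (ξ x : ℝ) ≤ m := by exact_mod_cast hm1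
  have hm2R : (m : ℝ) ≤ ξ x + k := by exact_mod_cast hm2
  have hclip : ∀ t : ℝ, (m : ℝ) ≤ t → t ≤ m + 1 → clip d (t / N) = t / N := by
    intro t h1 h2
    have h3 : t / N ≤ 1 - d := by
      rw [div_le_iff₀ hNpos]; linarith
    have h4 : d ≤ t / N := by
      rw [le_div_iff₀ hNpos]; linarith
    rw [clip, min_eq_left h3, max_eq_right h4]
  have hbase : testFn α N d x (addAt ξ (x - 1)) = prim α ((m : ℝ) / N) - prim α d := by
    rw [testFn, coord_addAt_of_tube hL hxw hx hw, if_neg (sub_one_notMem_arc hL x w), add_zero,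
      hclip _ le_rfl (by linarith)]
  unfold errFn
  rw [hbase, flow_of_tube hxw hl hlw, testFn, coord_addAt_of_tube hL hxw hx hw, ← hm]
  have hk0 : (0 : ℝ) ≤ k := Nat.cast_nonneg k
  by_cases hz : z ∈ arc x w
  · rw [if_pos hz, if_pos hz]
    push_cast
    rw [hclip _ (by linarith) le_rfl]
    have hp : ((ξ x : ℝ) / N) ^ α * ((ξ w : ℝ) / N) ^ α =
        a α (ξ x) * a α (ξ w) / ((N : ℝ) ^ α) ^ 2 := by
      rw [a_of_pos α (by omega), a_of_pos α (by omega), Real.div_rpow (by positivity) hNpos.le,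
        Real.div_rpow (by positivity) hNpos.le, div_mul_div_comm, ← sq]
    have e1 : prim α (((m : ℝ) + 1) / N) - prim α d - (prim α ((m : ℝ) / N) - prim α d) -
        a α (ξ x) * a α (ξ w) / (N * ((N : ℝ) ^ α) ^ 2) =
        ∫ r in ((m : ℝ) / N)..(((m : ℝ) + 1) / N),
          (kern α r - ((ξ x : ℝ) / N) ^ α * ((ξ w : ℝ) / N) ^ α) := by
      rw [intervalIntegral.integral_sub ((continuous_kern (by linarith)).intervalIntegrable _ _)
        (continuous_const.intervalIntegrable _ _), ← prim_sub (by linarith : 0 < α),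
        intervalIntegral.integral_const, hp, smul_eq_mul]
      have : ((m : ℝ) + 1) / N - m / N = 1 / N := by ring
      rw [this]
      have hP : (0 : ℝ) < (N : ℝ) ^ α := Real.rpow_pos_of_pos hNpos α
      field_simp
      ring
    rw [e1, ← Real.norm_eq_abs]
    have hle : (m : ℝ) / N ≤ ((m : ℝ) + 1) / N := by gcongr; linarith
    refine (intervalIntegral.norm_integral_le_of_norm_le_const
      (C := 2 * α * (k + 1) / N) fun r hr => ?_).trans ?_
    · rw [Set.uIoc_of_le hle] at hr
      have hr1 : (ξ x : ℝ) / N ≤ r := le_trans (by gcongr) hr.1.le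
      have hr2 : r ≤ ((ξ x : ℝ) + k + 1) / N := hr.2.trans (by gcongr)
      have hq : (ξ w : ℝ) / N = 1 - ((ξ x : ℝ) + k + 1) / N := by
        field_simp; linarith
      have hspl : ((ξ x : ℝ) + k + 1) / N = (ξ x : ℝ) / N + (k + 1) / N := by ring
      have hx0 : 0 ≤ (ξ x : ℝ) / N := by positivity
      have hw0 : 0 ≤ (ξ w : ℝ) / N := by positivity
      have hk1 : 0 ≤ ((k : ℝ) + 1) / N := by positivity
      rw [Real.norm_eq_abs, kern]
      refine (abs_rpow_mul_rpow_sub_le hα (s := r) (t := 1 - r) (p := (ξ x : ℝ) / N)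
        (q := (ξ w : ℝ) / N) ⟨by linarith, by linarith⟩ ⟨by linarith, by linarith⟩
        ⟨by linarith, by linarith⟩ ⟨by linarith, by linarith⟩).trans ?_
      have h1 : |r - (ξ x : ℝ) / N| ≤ (k + 1) / N := by
        rw [abs_le]; constructor <;> linarith
      have h2 : |1 - r - (ξ w : ℝ) / N| ≤ (k + 1) / N := by
        rw [abs_le]; constructor <;> linarith
      have h3 : 2 * α * ((k : ℝ) + 1) / N = α * ((k + 1) / N + (k + 1) / N) := by ring
      rw [h3]
      exact mul_le_mul_of_nonneg_left (add_le_add h1 h2) (by linarith)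
    · have : ((m : ℝ) + 1) / N - m / N = 1 / N := by ring
      rw [this, abs_of_nonneg (by positivity)]
      refine le_of_eq ?_
      field_simp
  · rw [if_neg hz, if_neg hz, add_zero, hclip _ le_rfl (by linarith), sub_self, sub_zero, abs_zero]
    positivity

/-! ### Summation of squared gradients over all tubes. -/

open Classical in
/-- Reduction of a sum over configurations to sums over tubes. -/
theorem scaled_sum_le (hL : 2 ≤ L) {α : ℝ} {N : ℕ} (hN : 1 ≤ N) (x : ZMod L)
    (E : Config L → ℝ) (hE : ∀ ξ, 0 ≤ E ξ) :
    N * ((N : ℝ) ^ α) ^ 2 * ∑ ξ ∈ confs L (N - 1), weight α ξ * E ξ ≤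
      ∑ w ∈ Finset.univ.erase x, (1 / (N : ℝ)) * ∑ ξ ∈ confs L (N - 1),
        bgWeight α {x, w} (clear {x, w} ξ) *
          (if IsDominant x ξ w then gradScale α N x w ξ * E ξ else 0) := by
  have hNpos : (0 : ℝ) < N := by exact_mod_cast hN
  have h1 := sum_le_sum_filter_cover (Finset.univ.erase x) (confs L (N - 1))
    (fun ξ => weight α ξ * E ξ) (fun ξ _ => mul_nonneg (weight_pos α ξ).le (hE ξ))
    (fun w ξ => IsDominant x ξ w) (fun ξ _ => by
      obtain ⟨w, hw⟩ := exists_isDominant hL x ξ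
      exact ⟨w, Finset.mem_erase.2 ⟨hw.1, Finset.mem_univ w⟩, hw⟩)
  refine (mul_le_mul_of_nonneg_left h1 (by positivity)).trans_eq ?_
  rw [Finset.mul_sum]
  refine Finset.sum_congr rfl fun w hw => ?_
  have hxw : x ≠ w := (Finset.ne_of_mem_erase hw).symm
  rw [Finset.sum_filter, Finset.mul_sum, Finset.mul_sum]
  refine Finset.sum_congr rfl fun ξ _ => ?_
  split_ifs
  · rw [weight_eq_mul_bgWeight α {x, w}, Finset.prod_pair hxw, gradScale]
    have h2 := a_pos α (ξ x)
    have h3 := a_pos α (ξ w)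
    field_simp
  · simp

/-- For a fixed background and both ends occupied by at least εN, the scale factor is of order N²
and the squared error of order N⁻⁴. The moment bound dominates everywhere else. -/
theorem tendsto_scaled_err_sum (hL : 2 ≤ L) {α : ℝ} (hα : 3 < α) {ℓ : ℕ → ℝ}
    (hℓ : Tendsto ℓ atTop atTop)
    (hℓN : Tendsto (fun N : ℕ => ℓ N / (N : ℝ)) atTop (𝓝 0)) (x : ZMod L) :
    Tendsto (fun N : ℕ => N * ((N : ℝ) ^ α) ^ 2 * ∑ ξ ∈ confs L (N - 1), weight α ξ *
      ∑ z, errFn α N (ℓ N) (2 * (ℓ N / N)) x ξ z ^ 2) atTop (𝓝 0) := by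
  classical
  have hE : ∀ N : ℕ, ∀ ξ : Config L, 0 ≤ ∑ z, errFn α N (ℓ N) (2 * (ℓ N / N)) x ξ z ^ 2 :=
    fun N ξ => Finset.sum_nonneg fun _ _ => sq_nonneg _
  have hd : ∀ᶠ N : ℕ in atTop, 2 * (ℓ N / N) < 1 / 2 := by
    filter_upwards [hℓN.eventually_lt_const (show (0 : ℝ) < 1 / 4 by norm_num)] with N h
    linarith
  have key : ∀ w ∈ (Finset.univ : Finset (ZMod L)).erase x,
      Tendsto (fun N : ℕ => (1 / (N : ℝ)) * ∑ ξ ∈ confs L (N - 1),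
        bgWeight α {x, w} (clear {x, w} ξ) * (if IsDominant x ξ w then gradScale α N x w ξ *
          ∑ z, errFn α N (ℓ N) (2 * (ℓ N / N)) x ξ z ^ 2 else 0)) atTop (𝓝 0) := by
    intro w hw
    have hxw : x ≠ w := (Finset.ne_of_mem_erase hw).symm
    refine tendsto_pair_sum_zero hα hxw (C := L * (18 * ((8 * L : ℝ) ^ α) ^ 2 + 2 * L ^ 2))
      (fun N ξ => if IsDominant x ξ w then gradScale α N x w ξ *
          ∑ z, errFn α N (ℓ N) (2 * (ℓ N / N)) x ξ z ^ 2 else 0) (fun N ξ => ?_) ?_ ?_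
    · split_ifs
      · exact mul_nonneg (gradScale_nonneg _ _ _ _ _) (hE N ξ)
      · exact le_rfl
    · filter_upwards [hd, eventually_ge_atTop 1] with N hdN hN ξ hξ
      split_ifs with hdom
      · rw [Finset.mul_sum]
        refine (Finset.sum_le_card_nsmul _ _ _ fun z _ =>
          gradScale_mul_errFn_sq_le hL (by linarith) hN hdN hξ hdom z).trans_eq ?_
        rw [Finset.card_univ, ZMod.card, nsmul_eq_mul, mul_assoc]
      · exact mul_nonneg (by positivity) (zero_le_one.trans (one_le_momentBound _))
    · intro ζ ε hε
      set k := size ζ with hk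
      have hεα : 0 < ε ^ α := Real.rpow_pos_of_pos hε α
      have hlimit : Tendsto (fun N : ℕ => L * (2 * α * (k + 1)) ^ 2 / (ε ^ α) ^ 2 / (N : ℝ) ^ 2)
          atTop (𝓝 0) :=
        tendsto_const_nhds.div_atTop
          ((tendsto_pow_atTop two_ne_zero).comp tendsto_natCast_atTop_atTop)
      have hlarge : ∀ᶠ N : ℕ in atTop, ((k : ℝ) + 2) ≤ ε * N :=
        (tendsto_natCast_atTop_atTop.const_mul_atTop hε).eventually_ge_atTop _
      filter_upwards [hlimit.eventually_lt_const hε, hlarge, eventually_ge_atTop 1,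
        hℓ.eventually_ge_atTop (k : ℝ), hℓN.eventually_lt_const (half_pos hε)]
        with N h1 h2 hN h3 h4 ξ hξ hclear hxε hwε
      split_ifs with hdom
      · have hNpos : (0 : ℝ) < N := by exact_mod_cast hN
        have hP : (0 : ℝ) < (N : ℝ) ^ α := Real.rpow_pos_of_pos hNpos α
        have hksz : size (clear {x, w} ξ) = k := by rw [hclear]
        have hx2 : k + 2 ≤ ξ x := by exact_mod_cast h2.trans hxε
        have hw2 : k + 2 ≤ ξ w := by exact_mod_cast h2.trans hwε
        have hℓpos : 0 ≤ ℓ N := (Nat.cast_nonneg k).trans h3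
        have h5 : ℓ N < ε / 2 * N := by rwa [div_lt_iff₀ hNpos] at h4
        have h6 : 2 * (ℓ N / N) * N = 2 * ℓ N := by field_simp
        have herr := abs_errFn_le_of_tube hL (by linarith : 1 ≤ α) hN (l := ℓ N)
          (d := 2 * (ℓ N / N)) hxw hξ (by rw [hksz]; exact hx2) (by rw [hksz]; exact hw2)
          (by rw [hksz]; exact h3) (by nlinarith) (by rw [h6]; linarith) (by rw [h6]; linarith)
        rw [hksz] at herr
        have hsq : ∑ z, errFn α N (ℓ N) (2 * (ℓ N / N)) x ξ z ^ 2 ≤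
            L * (2 * α * (k + 1) / (N : ℝ) ^ 2) ^ 2 := by
          refine (Finset.sum_le_card_nsmul _ _ ((2 * α * (k + 1) / (N : ℝ) ^ 2) ^ 2)
            fun z _ => ?_).trans_eq ?_
          · exact sq_le_sq' (by linarith [(abs_le.1 (herr z)).1]) (abs_le.1 (herr z)).2
          · rw [Finset.card_univ, ZMod.card, nsmul_eq_mul]
        have hax : ∀ v, ε * N ≤ ξ v → k + 2 ≤ ξ v → ε ^ α * (N : ℝ) ^ α ≤ a α (ξ v) := by
          intro v hv hv2
          rw [a_of_pos α (by omega), ← Real.mul_rpow hε.le hNpos.le]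
          exact Real.rpow_le_rpow (by positivity) hv (by linarith)
        have hgs : gradScale α N x w ξ ≤ (N : ℝ) ^ 2 / (ε ^ α) ^ 2 := by
          unfold gradScale
          rw [div_le_div_iff₀ (mul_pos (a_pos α _) (a_pos α _)) (by positivity)]
          have h7 := mul_le_mul (hax x hxε hx2) (hax w hwε hw2) (by positivity) (a_pos α _).le
          nlinarith [mul_le_mul_of_nonneg_left h7 (sq_nonneg (N : ℝ))]
        refine (mul_le_mul hgs hsq (hE N ξ) (by positivity)).trans (le_trans (le_of_eq ?_) h1.le)
        field_simp
      · exact hε.le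
  have hsum := tendsto_finsetSum _ key
  rw [Finset.sum_const_zero] at hsum
  refine squeeze_zero' (Eventually.of_forall fun N => mul_nonneg (by positivity)
    (Finset.sum_nonneg fun ξ _ => mul_nonneg (weight_pos α ξ).le (hE N ξ))) ?_ hsum
  filter_upwards [eventually_ge_atTop 1] with N hN
  exact scaled_sum_le hL hN x _ (hE N)

theorem scaled_testFn_sum_bounded (hL : 2 ≤ L) {α : ℝ} (hα : 3 < α) (x : ZMod L) :
    ∃ C : ℝ, ∀ (N : ℕ) (d : ℝ), 1 ≤ N → d < 1 / 2 →
      N * ((N : ℝ) ^ α) ^ 2 * ∑ ξ ∈ confs L (N - 1), weight α ξ *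
        ∑ z, (testFn α N d x (addAt ξ z) - testFn α N d x (addAt ξ (x - 1))) ^ 2 ≤ C := by
  classical
  refine ⟨∑ w ∈ Finset.univ.erase x, |L * (((8 * L : ℝ) ^ α) ^ 2 * 9)| *
    ∑' ζ : Config L, bgWeight α {x, w} ζ * momentBound ζ, fun N d hN hd => ?_⟩
  have hNpos : (0 : ℝ) < N := by exact_mod_cast hN
  refine (scaled_sum_le hL hN x _ fun ξ => Finset.sum_nonneg fun _ _ => sq_nonneg _).trans ?_
  refine Finset.sum_le_sum fun w hw => ?_
  have hxw : x ≠ w := (Finset.ne_of_mem_erase hw).symm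
  rw [one_div, inv_mul_le_iff₀ hNpos]
  refine pair_sum_le hα hN hxw _ fun ξ hξ => ?_
  split_ifs with hdom
  · rw [Finset.mul_sum]
    refine (Finset.sum_le_card_nsmul _ _ _ fun z _ =>
      gradScale_mul_testFn_sq_le hL (by linarith) hN hd hξ hdom z (x - 1)).trans_eq ?_
    rw [Finset.card_univ, ZMod.card, nsmul_eq_mul]
    ring
  · exact mul_nonneg (by positivity) (zero_le_one.trans (one_le_momentBound _))

/-! ### Asymptotics of the capacity matrix -/

theorem confs_nonempty (N : ℕ) : (confs L N).Nonempty :=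
  ⟨Pi.single 0 N, by rw [mem_confs]; simp⟩

theorem Z_pos (α : ℝ) {N : ℕ} (hN : 1 ≤ N) : 0 < Z L α N :=
  mul_pos (Real.rpow_pos_of_pos (by exact_mod_cast hN) α)
    (Finset.sum_pos (fun η _ => weight_pos α η) (confs_nonempty N))

theorem coefMu_pos (α : ℝ) {N : ℕ} (hN : 1 ≤ N) : 0 < coefMu L α N :=
  div_pos (Real.rpow_pos_of_pos (by exact_mod_cast hN) α) (Z_pos α hN)

theorem inner_gen' (hL : 2 ≤ L) (α : ℝ) {N : ℕ} (hN : 1 ≤ N) (u h : Config L → ℝ) :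
    inner α N u (gen α h) = coefMu L α N * bform α (N - 1) u h := by
  obtain ⟨n, rfl⟩ : ∃ n, N = n + 1 := ⟨N - 1, by omega⟩
  exact inner_gen hL α n u h

/-- Off the wells 𝓛 h vanishes, so u is seen only on the wells; this allows indicators to be
exchanged for test functions. -/
theorem IsPotential.inner_congr {α : ℝ} {N : ℕ} {l : ℝ} {w : ZMod L} {h : Config L → ℝ}
    (hh : IsPotential α N l w h) {u u' : Config L → ℝ}
    (huu : ∀ η ∈ wells N l Finset.univ, u η = u' η) :
    inner α N u (gen α h) = inner α N u' (gen α h) := by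
  unfold inner
  refine Finset.sum_congr rfl fun η hη => ?_
  by_cases hw : η ∈ wells N l Finset.univ
  · rw [huu η hw]
  · rw [hh.harmonic η hη hw, mul_zero, mul_zero, mul_zero, mul_zero]

theorem IsPotential.bform_congr (hL : 2 ≤ L) {α : ℝ} {N : ℕ} (hN : 1 ≤ N) {l : ℝ} {w : ZMod L}
    {h : Config L → ℝ} (hh : IsPotential α N l w h) {u u' : Config L → ℝ}
    (huu : ∀ η ∈ wells N l Finset.univ, u η = u' η) :
    bform α (N - 1) u h = bform α (N - 1) u' h := by
  have h1 := hh.inner_congr huu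
  rw [inner_gen' hL α hN, inner_gen' hL α hN] at h1
  exact mul_left_cancel₀ (coefMu_pos α hN).ne' h1

/-- Cauchy–Schwarz over pairs (ξ, z), with the weight split into two square roots. -/
theorem sum_mul_grad_sq_le (α : ℝ) (n : ℕ) (f : Config L → ZMod L → ℝ) (h : Config L → ℝ) :
    (∑ ξ ∈ confs L n, weight α ξ *
      ∑ z, f ξ z * (h (addAt ξ (z + 1)) - h (addAt ξ z))) ^ 2 ≤
      (∑ ξ ∈ confs L n, weight α ξ * ∑ z, f ξ z ^ 2) * energy α n h := by
  have hs : ∀ ξ : Config L, √(weight α ξ) * √(weight α ξ) = weight α ξ := fun ξ =>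
    Real.mul_self_sqrt (weight_pos α ξ).le
  have h1 := Finset.sum_mul_sq_le_sq_mul_sq (confs L n ×ˢ (Finset.univ : Finset (ZMod L)))
    (fun q => √(weight α q.1) * f q.1 q.2)
    (fun q => √(weight α q.1) * (h (addAt q.1 (q.2 + 1)) - h (addAt q.1 q.2)))
  simp only [Finset.sum_product] at h1
  have e1 : ∀ ξ : Config L, ∑ z, √(weight α ξ) * f ξ z *
      (√(weight α ξ) * (h (addAt ξ (z + 1)) - h (addAt ξ z))) =
      weight α ξ * ∑ z, f ξ z * (h (addAt ξ (z + 1)) - h (addAt ξ z)) := by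
    intro ξ
    rw [Finset.mul_sum]
    refine Finset.sum_congr rfl fun z _ => ?_
    rw [← hs ξ, Real.sqrt_mul_self (Real.sqrt_nonneg _)]
    ring
  have e2 : ∀ (ξ : Config L) (k : ZMod L → ℝ), ∑ z, (√(weight α ξ) * k z) ^ 2 =
      weight α ξ * ∑ z, k z ^ 2 := by
    intro ξ k
    rw [Finset.mul_sum]
    refine Finset.sum_congr rfl fun z _ => ?_
    rw [mul_pow, Real.sq_sqrt (weight_pos α ξ).le]
  simp only [e1, e2] at h1
  exact h1

/-- One value of `u` in each cycle may be subtracted. -/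
theorem bform_eq_sub_base (α : ℝ) (n : ℕ) (u h : Config L → ℝ) (b : ZMod L) :
    bform α n u h = ∑ ξ ∈ confs L n, weight α ξ *
      ∑ z, (u (addAt ξ z) - u (addAt ξ b)) * (h (addAt ξ (z + 1)) - h (addAt ξ z)) := by
  unfold bform
  refine Finset.sum_congr rfl fun ξ _ => ?_
  congr 1
  have h1 := sum_shift fun z => h (addAt ξ z)
  have h2 : ∑ z, u (addAt ξ b) * (h (addAt ξ (z + 1)) - h (addAt ξ z)) = 0 := by
    rw [← Finset.mul_sum, Finset.sum_sub_distrib, h1, sub_self, mul_zero]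
  simp only [sub_mul]
  rw [Finset.sum_sub_distrib, h2, sub_zero]

/-- The normalization of the test function. -/
def primGap (α d : ℝ) : ℝ := prim α (1 - d) - prim α d

theorem primGap_pos {α : ℝ} (hα : 0 < α) {d : ℝ} (hd : 0 < d) (hd' : d < 1 / 2) :
    0 < primGap α d := by
  unfold primGap
  rw [prim_sub hα]
  refine intervalIntegral.intervalIntegral_pos_of_pos_on
    ((continuous_kern hα).intervalIntegrable _ _) (fun s hs => ?_) (by linarith)
  exact mul_pos (Real.rpow_pos_of_pos (by linarith [hs.1]) α)
    (Real.rpow_pos_of_pos (by linarith [hs.2]) α)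

theorem tendsto_primGap {α : ℝ} (hα : 0 < α) {d : ℕ → ℝ} (hd : Tendsto d atTop (𝓝 0)) :
    Tendsto (fun N => primGap α (d N)) atTop (𝓝 (I α)) := by
  have hc := continuous_prim hα
  have h1 : Tendsto (fun N => prim α (1 - d N)) atTop (𝓝 (prim α (1 - 0))) :=
    (hc.tendsto _).comp (tendsto_const_nhds.sub hd)
  have h2 : Tendsto (fun N => prim α (d N)) atTop (𝓝 (prim α 0)) := (hc.tendsto _).comp hd
  have h3 := h1.sub h2
  have h4 : prim α 0 = 0 := intervalIntegral.integral_same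
  rw [sub_zero, h4, sub_zero, prim_one] at h3
  exact h3

/-- The test function is a multiple of the indicator function on the wells. -/
theorem testFn_on_wells {α : ℝ} {N : ℕ} {l d : ℝ} (hN : 0 < N) (hl : 0 ≤ l)
    (hd : d < 1 / 2) (hld : 2 * l ≤ d * N) (x : ZMod L) {h : Config L → ℝ}
    (h1 : ∀ η ∈ well N l x, h η = 1) (h0 : ∀ z, z ≠ x → ∀ η ∈ well N l z, h η = 0) :
    ∀ η ∈ wells N l Finset.univ, testFn α N d x η = primGap α d * h η := by
  intro η hη
  obtain ⟨z, _, hz⟩ := mem_wells.1 hη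
  by_cases hzx : z = x
  · subst hzx
    rw [testFn_eq_on_well hN hd (by linarith) hz, h1 η hz, mul_one, primGap]
  · rw [testFn_eq_zero_on_well hN hld hzx hz, h0 z hzx η hz, mul_zero]

/-- The test function equals gap · h on the wells, so its form against h is -(gap/2) times the
energy. Cauchy–Schwarz gives (gap²/4) E² ≤ Q E, and E cancels. No sector condition is needed. -/
theorem IsPotential.energy_le (hL : 2 ≤ L) {α : ℝ} (hα : 0 < α) {N : ℕ} (hN : 1 ≤ N) {l d : ℝ}
    (hl : 0 ≤ l) (hd0 : 0 < d) (hd : d < 1 / 2) (hld : 2 * l ≤ d * N) {x : ZMod L}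
    {h : Config L → ℝ} (hh : IsPotential α N l x h) :
    energy α (N - 1) h ≤ 4 / primGap α d ^ 2 * ∑ ξ ∈ confs L (N - 1), weight α ξ *
      ∑ z, (testFn α N d x (addAt ξ z) - testFn α N d x (addAt ξ (x - 1))) ^ 2 := by
  have hg := primGap_pos hα hd0 hd
  have h1 := hh.bform_congr hL hN
    (testFn_on_wells (α := α) hN hl hd hld x hh.one hh.zero)
  rw [bform_smul_left, bform_self, bform_eq_sub_base _ _ _ _ (x - 1)] at h1
  have h2 := sum_mul_grad_sq_le α (N - 1)
    (fun ξ z => testFn α N d x (addAt ξ z) - testFn α N d x (addAt ξ (x - 1))) h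
  rw [h1] at h2
  have hE := energy_nonneg α (N - 1) h
  set Q := ∑ ξ ∈ confs L (N - 1), weight α ξ *
      ∑ z, (testFn α N d x (addAt ξ z) - testFn α N d x (addAt ξ (x - 1))) ^ 2 with hQ
  have hQ0 : 0 ≤ Q := Finset.sum_nonneg fun ξ _ => mul_nonneg (weight_pos α ξ).le
    (Finset.sum_nonneg fun _ _ => sq_nonneg _)
  rw [div_mul_eq_mul_div, le_div_iff₀ (by positivity)]
  rcases hE.eq_or_lt with h0 | h0
  · rw [← h0, zero_mul]; positivity
  · have h3 : (energy α (N - 1) h * primGap α d ^ 2) * energy α (N - 1) h ≤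
        (4 * Q) * energy α (N - 1) h := by nlinarith
    exact le_of_mul_le_mul_right h3 h0

theorem clear_addAt {x w z : ZMod L} (hz : z = x ∨ z = w) (ξ : Config L) :
    clear {x, w} (addAt ξ z) = clear {x, w} ξ := by
  funext v
  unfold clear
  split_ifs with hv
  · rfl
  · rw [addAt_of_ne]
    rintro rfl
    simp at hv
    rcases hz with h | h
    · exact hv.1 h
    · exact hv.2 h

/-! ### The flow between two wells. -/

/-- The mass of the flow between `x` and `w`. -/
def flowMass (α : ℝ) (N : ℕ) (l : ℝ) (A : Finset (ZMod L)) (w : ZMod L) : ℝ :=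
  ∑ η ∈ condensed N l A w, bgWeight α A (clear A η)

theorem tendsto_flowMass {α : ℝ} (hα : 3 < α) {ℓ : ℕ → ℝ} (hℓ : Tendsto ℓ atTop atTop)
    {x w : ZMod L} (hxw : x ≠ w) :
    Tendsto (fun N => flowMass α N (ℓ N) {x, w} w) atTop (𝓝 (Gam α ^ (L - 2))) := by
  have key := tendsto_sum_condensed (L := L) hα hℓ (A := {x, w}) (w := w) (by simp)
    (fun _ _ => 1) 1 (Eventually.of_forall fun N m _ _ => by simp) (fun k => tendsto_const_nhds)
  rw [Finset.card_pair hxw] at key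
  simpa [flowMass] using key

/-- When x is empty, the cutoff on the background says exactly that η is in the well of w, so the
flow ends where h is constant. The pair enters through an equation so that the lemma also applies
with x and w exchanged. -/
theorem sum_condensed_eq {α : ℝ} {N : ℕ} {l : ℝ} {x w : ZMod L} (hxw : x ≠ w)
    (A : Finset (ZMod L)) (hA : A = {x, w}) {h : Config L → ℝ} {b : ℝ}
    (hb : ∀ η ∈ well N l w, h η = b) :
    ∑ η ∈ (confs L N).filter (fun η => η x = 0),
      (if (size (clear A η) : ℝ) ≤ l then bgWeight α A (clear A η) else 0) * h η =
      b * flowMass α N l A w := by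
  subst hA
  unfold flowMass
  simp only [ite_mul, zero_mul]
  rw [← Finset.sum_filter, Finset.filter_filter, Finset.mul_sum]
  have hset : (confs L N).filter (fun η => η x = 0 ∧ (size (clear {x, w} η) : ℝ) ≤ l) =
      condensed N l {x, w} w := by
    ext η
    rw [condensed, Finset.mem_filter, Finset.mem_filter, mem_well]
    constructor
    · rintro ⟨h1, h2, h3⟩
      have h4 := size_clear_pair hxw h1
      have h5 : (size (clear {x, w} η) : ℝ) + η w = N := by
        exact_mod_cast (by omega : size (clear {x, w} η) + η w = N)
      refine ⟨⟨h1, by linarith⟩, fun v hv hne => ?_⟩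
      rcases Finset.mem_insert.1 hv with rfl | hv
      · exact h2
      · exact absurd (Finset.mem_singleton.1 hv) hne
    · rintro ⟨⟨h1, h2⟩, h3⟩
      have hx := h3 x (by simp) hxw
      have h4 := size_clear_pair hxw h1
      have h5 : (size (clear {x, w} η) : ℝ) + η w = N := by
        exact_mod_cast (by omega : size (clear {x, w} η) + η w = N)
      exact ⟨h1, hx, by linarith⟩
  rw [hset]
  refine Finset.sum_congr rfl fun η hη => ?_
  rw [hb η (Finset.mem_filter.1 hη).1, mul_comm]

/-- The flow between `x` and `w`, tested against a function which is constant on the wells. -/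
theorem sum_flowCoef {α : ℝ} {N : ℕ} (hN : 1 ≤ N) {l : ℝ} {x w : ZMod L} (hxw : x ≠ w)
    {h : Config L → ℝ} {bx bw : ℝ} (hbx : ∀ η ∈ well N l x, h η = bx)
    (hbw : ∀ η ∈ well N l w, h η = bw) :
    N * ((N : ℝ) ^ α) ^ 2 * ∑ ξ ∈ confs L (N - 1), weight α ξ *
      (flowCoef α N l x w ξ * (h (addAt ξ w) - h (addAt ξ x))) =
      bw * flowMass α N l {x, w} w - bx * flowMass α N l {x, w} x := by
  have hNpos : (0 : ℝ) < N := by exact_mod_cast hN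
  have hP : (0 : ℝ) < (N : ℝ) ^ α := Real.rpow_pos_of_pos hNpos α
  set Wt : Config L → ℝ := fun η =>
    if (size (clear {x, w} η) : ℝ) ≤ l then bgWeight α {x, w} (clear {x, w} η) else 0 with hWt
  -- The factors a(ξ_x) a(ξ_w) cancel, leaving a weight that depends only on the background, hence
  -- is the same at ξ + δ_w and ξ + δ_x.
  have h1 : ∀ ξ : Config L, N * ((N : ℝ) ^ α) ^ 2 * (weight α ξ *
      (flowCoef α N l x w ξ * (h (addAt ξ w) - h (addAt ξ x)))) =
      Wt (addAt ξ w) * h (addAt ξ w) - Wt (addAt ξ x) * h (addAt ξ x) := by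
    intro ξ
    simp only [hWt, clear_addAt (Or.inl rfl), clear_addAt (Or.inr rfl), flowCoef]
    split_ifs
    · rw [weight_eq_mul_bgWeight α {x, w}, Finset.prod_pair hxw]
      have h2 := a_pos α (ξ x)
      have h3 := a_pos α (ξ w)
      field_simp
    · simp
  rw [Finset.mul_sum, Finset.sum_congr rfl fun ξ _ => h1 ξ, Finset.sum_sub_distrib]
  have hc := fun z => sum_confs_filter_pos (N - 1) z fun η => Wt η * h η
  rw [Nat.sub_add_cancel hN] at hc
  rw [← hc w, ← hc x]
  -- The sums over η_w ≠ 0 and η_x ≠ 0 differ only by the configurations with η_x = 0 and those with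
  -- η_w = 0, the two ends of the tube.
  have hsplit := fun z : ZMod L => Finset.sum_filter_add_sum_filter_not (confs L N)
    (fun η => η z = 0) (fun η => Wt η * h η)
  have ex := sum_condensed_eq (α := α) hxw {x, w} rfl hbw
  have ew := sum_condensed_eq (α := α) hxw.symm {x, w} (Finset.pair_comm x w) hbx
  rw [← ex, ← ew]
  have h4 := hsplit x
  have h5 := hsplit w
  simp only [hWt] at h4 h5 ⊢
  linarith

theorem bform_testFn_eq (α : ℝ) {N : ℕ} (l d : ℝ) (x : ZMod L) (h : Config L → ℝ) :
    bform α (N - 1) (testFn α N d x) h =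
      ∑ w ∈ Finset.univ.erase x, ∑ ξ ∈ confs L (N - 1), weight α ξ *
          (flowCoef α N l x w ξ * (h (addAt ξ w) - h (addAt ξ x))) +
        ∑ ξ ∈ confs L (N - 1), weight α ξ *
          ∑ z, errFn α N l d x ξ z * (h (addAt ξ (z + 1)) - h (addAt ξ z)) := by
  rw [bform_eq_sub_base _ _ _ _ (x - 1), Finset.sum_comm, ← Finset.sum_add_distrib]
  refine Finset.sum_congr rfl fun ξ _ => ?_
  rw [← Finset.mul_sum, ← mul_add]
  congr 1
  have h1 : ∑ w ∈ Finset.univ.erase x, flowCoef α N l x w ξ * (h (addAt ξ w) - h (addAt ξ x)) =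
      ∑ z, flow α N l x ξ z * (h (addAt ξ (z + 1)) - h (addAt ξ z)) := by
    simp only [flow, Finset.sum_mul]
    rw [Finset.sum_comm]
    refine Finset.sum_congr rfl fun w _ => ?_
    rw [← sum_arc_sub x w fun z => h (addAt ξ z), Finset.mul_sum]
    simp only [ite_mul, zero_mul]
    rw [← Finset.sum_filter]
    refine Finset.sum_congr ?_ fun _ _ => rfl
    ext z; simp
  rw [h1, ← Finset.sum_add_distrib]
  refine Finset.sum_congr rfl fun z _ => ?_
  unfold errFn
  ring

/-- Of the flows leaving x only the one towards y reaches a well where h is not zero; its mass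
converges and the error term vanishes. -/
theorem tendsto_scaled_bform (hL : 2 ≤ L) {α : ℝ} (hα : 3 < α) {ℓ : ℕ → ℝ}
    (hℓ : Tendsto ℓ atTop atTop)
    (hℓN : Tendsto (fun N : ℕ => ℓ N / (N : ℝ)) atTop (𝓝 0)) {x y : ZMod L} (hxy : x ≠ y)
    {h : ℕ → Config L → ℝ} (hh : ∀ᶠ N in atTop, IsPotential α N (ℓ N) y (h N)) :
    Tendsto (fun N : ℕ => N * ((N : ℝ) ^ α) ^ 2 *
      bform α (N - 1) (testFn α N (2 * (ℓ N / N)) x) (h N)) atTop (𝓝 (Gam α ^ (L - 2))) := by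
  have hd0 : Tendsto (fun N : ℕ => 2 * (ℓ N / (N : ℝ))) atTop (𝓝 0) := by
    simpa using hℓN.const_mul 2
  have hα0 : 0 < α := by linarith
  set err : ℕ → ℝ := fun N => ∑ ξ ∈ confs L (N - 1), weight α ξ *
    ∑ z, errFn α N (ℓ N) (2 * (ℓ N / N)) x ξ z * (h N (addAt ξ (z + 1)) - h N (addAt ξ z))
    with herr
  obtain ⟨C, hC⟩ := scaled_testFn_sum_bounded hL hα y
  have hsq : Tendsto (fun N : ℕ => (N * ((N : ℝ) ^ α) ^ 2 * err N) ^ 2) atTop (𝓝 0) := by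
    have hlim := (tendsto_scaled_err_sum hL hα hℓ hℓN x).mul
      (((tendsto_const_nhds (x := (4 : ℝ))).div ((tendsto_primGap hα0 hd0).pow 2)
        (pow_pos (I_pos hα0) 2).ne').mul_const C)
    rw [zero_mul] at hlim
    refine squeeze_zero' (Eventually.of_forall fun N => sq_nonneg _) ?_ hlim
    filter_upwards [hh, eventually_ge_atTop 1, hℓ.eventually_gt_atTop 0,
      hd0.eventually_lt_const (show (0 : ℝ) < 1 / 2 by norm_num)] with N hhN hN hℓpos hd
    have hNpos : (0 : ℝ) < N := by exact_mod_cast hN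
    have hdpos : 0 < 2 * (ℓ N / (N : ℝ)) := by positivity
    have hld : 2 * ℓ N ≤ 2 * (ℓ N / N) * N := le_of_eq (by field_simp)
    have h1 := sum_mul_grad_sq_le α (N - 1) (errFn α N (ℓ N) (2 * (ℓ N / N)) x) (h N)
    have h2 := hhN.energy_le hL hα0 hN hℓpos.le hdpos hd hld
    have h3 := hC N (2 * (ℓ N / N)) hN hd
    set K := (N : ℝ) * ((N : ℝ) ^ α) ^ 2 with hK
    have hKpos : 0 < K := mul_pos hNpos (pow_pos (Real.rpow_pos_of_pos hNpos α) 2)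
    set R := ∑ ξ ∈ confs L (N - 1), weight α ξ *
      ∑ z, errFn α N (ℓ N) (2 * (ℓ N / N)) x ξ z ^ 2 with hR
    have hRnn : 0 ≤ R := Finset.sum_nonneg fun ξ _ => mul_nonneg (weight_pos α ξ).le
      (Finset.sum_nonneg fun _ _ => sq_nonneg _)
    have hgap : 0 ≤ 4 / primGap α (2 * (ℓ N / N)) ^ 2 := by positivity
    have h4 : K * energy α (N - 1) (h N) ≤ 4 / primGap α (2 * (ℓ N / N)) ^ 2 * C := by
      have h5 := mul_le_mul_of_nonneg_left h2 hKpos.le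
      have h6 := mul_le_mul_of_nonneg_left h3 hgap
      linarith
    calc (K * err N) ^ 2 = K ^ 2 * err N ^ 2 := mul_pow _ _ _
      _ ≤ K ^ 2 * (R * energy α (N - 1) (h N)) := mul_le_mul_of_nonneg_left h1 (sq_nonneg K)
      _ = (K * R) * (K * energy α (N - 1) (h N)) := by ring
      _ ≤ (K * R) * (4 / primGap α (2 * (ℓ N / N)) ^ 2 * C) :=
          mul_le_mul_of_nonneg_left h4 (mul_nonneg hKpos.le hRnn)
  have hzero : Tendsto (fun N : ℕ => N * ((N : ℝ) ^ α) ^ 2 * err N) atTop (𝓝 0) := by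
    have h1 := hsq.sqrt
    simp only [Real.sqrt_zero, Real.sqrt_sq_eq_abs] at h1
    exact (tendsto_zero_iff_abs_tendsto_zero _).2 h1
  have hsum := (tendsto_flowMass (L := L) hα hℓ hxy).add hzero
  rw [add_zero] at hsum
  refine hsum.congr' ?_
  filter_upwards [hh, eventually_ge_atTop 1] with N hhN hN
  rw [bform_testFn_eq α (ℓ N), mul_add]
  congr 1
  rw [Finset.mul_sum, Finset.sum_eq_single_of_mem y
    (Finset.mem_erase.2 ⟨hxy.symm, Finset.mem_univ y⟩)]
  · rw [sum_flowCoef hN hxy (hhN.zero x hxy) hhN.one]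
    ring
  · intro w hw hwy
    rw [sum_flowCoef hN (Finset.ne_of_mem_erase hw).symm (hhN.zero x hxy) (hhN.zero w hwy)]
    ring

/-- The indicator function of a well. -/
def wellInd (N : ℕ) (l : ℝ) (z : ZMod L) (η : Config L) : ℝ := if η ∈ well N l z then 1 else 0

theorem wellInd_one {N : ℕ} {l : ℝ} {z : ZMod L} {η : Config L} (h : η ∈ well N l z) :
    wellInd N l z η = 1 := if_pos h

theorem wellInd_zero {N : ℕ} {l : ℝ} (hl : 2 * l < N) {z w : ZMod L} (hwz : w ≠ z) {η : Config L}
    (h : η ∈ well N l w) : wellInd N l z η = 0 := if_neg (disjoint_wells hl hwz h)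

/-- The capacity matrix `⟨1_{𝓔^z}, 𝓛 h_w⟩`, up to the factor `N ^ α / Z_N`. -/
def capEntry (α : ℝ) (N : ℕ) (l : ℝ) (z w : ZMod L) : ℝ :=
  bform α (N - 1) (wellInd N l z) (potential α N l w)

/-- The indicator of the well is exchanged for the test function divided by its gap, and N^(1+α) ·
N^α = N · (N^α)² matches the scaling of the form. -/
theorem tendsto_capEntry (hL : 2 ≤ L) {α : ℝ} (hα : 3 < α) {ℓ : ℕ → ℝ}
    (hℓ : Tendsto ℓ atTop atTop)
    (hℓN : Tendsto (fun N : ℕ => ℓ N / (N : ℝ)) atTop (𝓝 0)) {x y : ZMod L} (hxy : x ≠ y) :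
    Tendsto (fun N : ℕ => (N : ℝ) ^ (1 + α) *
      (coefMu L α N * capEntry α N (ℓ N) x y)) atTop (𝓝 (1 / (L * (Gam α * I α)))) := by
  have hd0 : Tendsto (fun N : ℕ => 2 * (ℓ N / (N : ℝ))) atTop (𝓝 0) := by
    simpa using hℓN.const_mul 2
  have hα0 : 0 < α := by linarith
  have hG := Gam_pos hα
  have hI := I_pos hα0
  have hLpos : (0 : ℝ) < L := by exact_mod_cast (by omega : 0 < L)
  have hpot : ∀ᶠ N : ℕ in atTop, IsPotential α N (ℓ N) y (potential α N (ℓ N) y) := by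
    filter_upwards [eventually_two_mul_lt hℓN two_pos] with N hN
    exact isPotential_potential α hN y
  have h1 := (tendsto_scaled_bform hL hα hℓ hℓN hxy hpot).div
    ((tendsto_Z (L := L) hα hℓ hℓN).mul (tendsto_primGap hα0 hd0))
    (by positivity)
  have e1 : Gam α ^ (L - 2) / (L * Gam α ^ (L - 1) * I α) = 1 / (L * (Gam α * I α)) := by
    have : L - 1 = L - 2 + 1 := by omega
    rw [this, pow_succ]
    have := pow_pos hG (L - 2)
    field_simp
  rw [e1] at h1
  refine h1.congr' ?_
  filter_upwards [hpot, eventually_ge_atTop 1, hℓ.eventually_gt_atTop 0,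
    eventually_two_mul_lt hℓN two_pos,
    hd0.eventually_lt_const (show (0 : ℝ) < 1 / 2 by norm_num)] with N hp hN hℓpos h2l hd
  have hNpos : (0 : ℝ) < N := by exact_mod_cast hN
  have hdpos : 0 < 2 * (ℓ N / (N : ℝ)) := by positivity
  have hld : 2 * ℓ N ≤ 2 * (ℓ N / N) * N := le_of_eq (by field_simp)
  have hgap := primGap_pos hα0 hdpos hd
  have hbf := hp.bform_congr hL hN (testFn_on_wells (α := α) hN hℓpos.le hd hld x
    (fun η hη => wellInd_one hη) (fun z hz η hη => wellInd_zero h2l hz hη))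
  rw [bform_smul_left] at hbf
  have hZ := Z_pos (L := L) α hN
  rw [Pi.div_apply, hbf, capEntry, coefMu, Real.rpow_add hNpos, Real.rpow_one]
  generalize primGap α (2 * (ℓ N / N)) = γ at hgap ⊢
  field_simp

/-! ### The time-reversed process by reflection -/

/-- The reflected configuration. -/
def reflect (η : Config L) : Config L := fun z => η (-z)

@[simp] theorem reflect_reflect (η : Config L) : reflect (reflect η) = η := by
  funext z; simp [reflect]

theorem reflect_mem_confs {N : ℕ} {η : Config L} (h : η ∈ confs L N) : reflect η ∈ confs L N := by
  rw [mem_confs] at h ⊢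
  rw [← h]
  exact Fintype.sum_equiv (Equiv.neg _) _ _ fun _ => rfl

theorem weight_reflect (α : ℝ) (η : Config L) : weight α (reflect η) = weight α η :=
  Fintype.prod_equiv (Equiv.neg _) _ _ fun _ => rfl

theorem reflect_addAt (ξ : Config L) (z : ZMod L) :
    reflect (addAt ξ z) = addAt (reflect ξ) (-z) := by
  funext v
  simp [reflect, addAt_apply, neg_eq_iff_eq_neg]

theorem reflect_mem_well {N : ℕ} {l : ℝ} {z : ZMod L} {η : Config L} (h : η ∈ well N l z) :
    reflect η ∈ well N l (-z) := by
  rw [mem_well] at h ⊢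
  exact ⟨reflect_mem_confs h.1, by simpa [reflect] using h.2⟩

/-- Reflection reverses time. -/
theorem bform_reflect (α : ℝ) (n : ℕ) (u h : Config L → ℝ) :
    bform α n (fun η => u (reflect η)) (fun η => h (reflect η)) = bform α n h u := by
  unfold bform
  refine Finset.sum_bij' (fun ξ _ => reflect ξ) (fun ξ _ => reflect ξ)
    (fun ξ hξ => reflect_mem_confs hξ) (fun ξ hξ => reflect_mem_confs hξ)
    (fun ξ _ => reflect_reflect ξ) (fun ξ _ => reflect_reflect ξ) fun ξ _ => ?_
  rw [weight_reflect]
  congr 1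
  simp only [reflect_addAt]
  set ξ' := reflect ξ
  have h1 : ∑ z : ZMod L, u (addAt ξ' (-z)) * (h (addAt ξ' (-(z + 1))) - h (addAt ξ' (-z))) =
      ∑ z : ZMod L, u (addAt ξ' z) * (h (addAt ξ' (z - 1)) - h (addAt ξ' z)) := by
    refine Fintype.sum_equiv (Equiv.neg _) _ _ fun z => ?_
    simp only [Equiv.neg_apply]
    rw [neg_add, ← sub_eq_add_neg]
  have h2 := sum_shift fun z => u (addAt ξ' z) * h (addAt ξ' (z - 1))
  simp only [add_sub_cancel_right] at h2
  rw [h1]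
  simp only [mul_sub, Finset.sum_sub_distrib]
  rw [← h2]
  congr 1 <;> exact Finset.sum_congr rfl fun z _ => by ring

/-! ### The variational formula -/

/-- `u` is equal to `bx` on the well of `x`, to `b` on the well of `y` and to `0` on the others. -/
def HasBoundary (N : ℕ) (l : ℝ) (x y : ZMod L) (bx b : ℝ) (u : Config L → ℝ) : Prop :=
  (∀ η ∈ well N l x, u η = bx) ∧ (∀ η ∈ well N l y, u η = b) ∧
    ∀ z, z ≠ x → z ≠ y → ∀ η ∈ well N l z, u η = 0

theorem HasBoundary.reflect {N : ℕ} {l : ℝ} {x y : ZMod L} {bx b : ℝ} {u : Config L → ℝ}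
    (h : HasBoundary N l x y bx b u) :
    HasBoundary N l (-x) (-y) bx b (fun η => u (reflect η)) := by
  refine ⟨fun η hη => h.1 _ ?_, fun η hη => h.2.1 _ ?_, fun z hzx hzy η hη =>
    h.2.2 (-z) (fun e => hzx (by rw [← e, neg_neg])) (fun e => hzy (by rw [← e, neg_neg])) _
      (reflect_mem_well hη)⟩
  · simpa using reflect_mem_well hη
  · simpa using reflect_mem_well hη

/-- The function equal to `1` on the well of `x`, to `0` on the wells other than those of `x` and
`y`, and harmonic for the process in which the well of `y` is collapsed to a point. -/
def pairPotential (α : ℝ) (N : ℕ) (l : ℝ) (x y : ZMod L) (η : Config L) : ℝ :=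
  potential α N l x η +
    -(capEntry α N l y x / capEntry α N l y y) * potential α N l y η

/-- The capacity between the well of `x` and the wells other than that of `y`. -/
def pairCap (α : ℝ) (N : ℕ) (l : ℝ) (x y : ZMod L) : ℝ :=
  -(capEntry α N l x x - capEntry α N l y x * capEntry α N l x y / capEntry α N l y y)

theorem hasBoundary_pairPotential (α : ℝ) {N : ℕ} {l : ℝ} (hl : 2 * l < N) {x y : ZMod L}
    (hxy : x ≠ y) : HasBoundary N l x y 1 (-(capEntry α N l y x / capEntry α N l y y))
      (pairPotential α N l x y) := by
  have hx := isPotential_potential α hl x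
  have hy := isPotential_potential α hl y
  refine ⟨fun η hη => ?_, fun η hη => ?_, fun z hzx hzy η hη => ?_⟩
  · rw [pairPotential, hx.one η hη, hy.zero x hxy η hη, mul_zero, add_zero]
  · rw [pairPotential, hx.zero y hxy.symm η hη, hy.one η hη, mul_one, zero_add]
  · rw [pairPotential, hx.zero z hzx η hη, hy.zero z hzy η hη, mul_zero, add_zero]

theorem bform_potential_of_hasBoundary (hL : 2 ≤ L) (α : ℝ) {N : ℕ} (hN : 1 ≤ N) {l : ℝ}
    (hl : 2 * l < N) {x y : ZMod L} (hxy : x ≠ y) {bx b : ℝ} {u : Config L → ℝ}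
    (hu : HasBoundary N l x y bx b u) (w : ZMod L) :
    bform α (N - 1) u (potential α N l w) =
      bx * capEntry α N l x w + b * capEntry α N l y w := by
  rw [(isPotential_potential α hl w).bform_congr hL hN
    (u' := fun η => bx * wellInd N l x η + b * wellInd N l y η), bform_add_left,
    bform_smul_left, bform_smul_left]
  · rfl
  · intro η hη
    obtain ⟨z, _, hz⟩ := mem_wells.1 hη
    by_cases hzx : z = x
    · subst hzx
      rw [hu.1 η hz, wellInd_one hz, wellInd_zero hl hxy hz]; ring
    · by_cases hzy : z = y
      · subst hzy
        rw [hu.2.1 η hz, wellInd_one hz, wellInd_zero hl hxy.symm hz]; ring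
      · rw [hu.2.2 z hzx hzy η hz, wellInd_zero hl hzx hz, wellInd_zero hl hzy hz]; ring

/-- The coefficient of the potential of y in `pairPotential` makes the flux through the well of y
vanish, so the value b drops out. -/
theorem bform_pairPotential (hL : 2 ≤ L) (α : ℝ) {N : ℕ} (hN : 1 ≤ N) {l : ℝ}
    (hl : 2 * l < N) {x y : ZMod L} (hxy : x ≠ y) (hne : capEntry α N l y y ≠ 0) {bx b : ℝ}
    {u : Config L → ℝ} (hu : HasBoundary N l x y bx b u) :
    bform α (N - 1) u (pairPotential α N l x y) = -(bx * pairCap α N l x y) := by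
  unfold pairPotential pairCap
  rw [bform_add_right, bform_smul_right, bform_potential_of_hasBoundary hL α hN hl hxy hu,
    bform_potential_of_hasBoundary hL α hN hl hxy hu]
  field_simp
  ring

theorem functional_eq (hL : 2 ≤ L) (α : ℝ) {N : ℕ} (hN : 1 ≤ N) (f h : Config L → ℝ) :
    2 * inner α N f (gen α h) - inner α N h (fun η => -genSym α h η) =
      coefMu L α N * (2 * bform α (N - 1) f h + bform α (N - 1) h h) := by
  obtain ⟨n, rfl⟩ : ∃ n, N = n + 1 := ⟨N - 1, by omega⟩
  rw [inner_gen hL, inner_genSym hL, Nat.add_sub_cancel]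
  ring

theorem hasBoundary_iff_zero_wells {N : ℕ} {l : ℝ} {x y : ZMod L} {u : Config L → ℝ} :
    (∀ η ∈ wells N l (Finset.univ.filter fun z => z ≠ x ∧ z ≠ y), u η = 0) ↔
      ∀ z, z ≠ x → z ≠ y → ∀ η ∈ well N l z, u η = 0 := by
  constructor
  · intro h z hzx hzy η hη
    exact h η (mem_wells.2 ⟨z, by simp [hzx, hzy], hη⟩)
  · intro h η hη
    obtain ⟨z, hz, hzη⟩ := mem_wells.1 hη
    have := (Finset.mem_filter.1 hz).2
    exact h z this.1 this.2 η hzη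

/-- The variational problem is solved by the capacity of the collapsed process. -/
theorem infG_eq (hL : 2 ≤ L) (α : ℝ) {N : ℕ} (hN : 1 ≤ N) {l : ℝ} (hl : 2 * l < N)
    {x y : ZMod L} (hxy : x ≠ y) (hne : capEntry α N l y y ≠ 0)
    (hne' : capEntry α N l (-y) (-y) ≠ 0) :
    infG α N l x y = ((coefMu L α N * pairCap α N l x y : ℝ) : EReal) := by
  have hxy' : -x ≠ -y := fun h => hxy (neg_injective h)
  have hc := coefMu_pos (L := L) α hN
  set p := pairPotential α N l x y with hp
  set q : Config L → ℝ := fun η => pairPotential α N l (-x) (-y) (reflect η) with hq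
  obtain ⟨bp, hpb⟩ : ∃ bp, HasBoundary N l x y 1 bp p :=
    ⟨_, hasBoundary_pairPotential α hl hxy⟩
  obtain ⟨bq, hqb⟩ : ∃ bq, HasBoundary N l x y 1 bq q := by
    have := (hasBoundary_pairPotential α hl hxy').reflect
    rw [neg_neg, neg_neg] at this
    exact ⟨_, this⟩
  have hBp : ∀ {u : Config L → ℝ} {bx b : ℝ}, HasBoundary N l x y bx b u →
      bform α (N - 1) u p = -(bx * pairCap α N l x y) := fun hu =>
    bform_pairPotential hL α hN hl hxy hne hu
  have hBq' : ∀ {u : Config L → ℝ} {bx b : ℝ}, HasBoundary N l x y bx b u →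
      bform α (N - 1) q u = -(bx * pairCap α N l (-x) (-y)) := by
    intro u bx b hu
    rw [← bform_pairPotential hL α hN hl hxy' hne' hu.reflect, ← bform_reflect]
    simp only [hq, reflect_reflect]
  -- The process and its reversal have the same capacity: the form of q against p is computed in two
  -- ways.
  have hcap : pairCap α N l (-x) (-y) = pairCap α N l x y := by
    have h1 := hBp hqb
    have h2 := hBq' hpb
    rw [h1] at h2
    linarith
  have hBq : ∀ {u : Config L → ℝ} {bx b : ℝ}, HasBoundary N l x y bx b u →
      bform α (N - 1) q u = -(bx * pairCap α N l x y) := fun hu => by rw [hBq' hu, hcap]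
  unfold infG G supFunctional
  refine le_antisymm ?_ ?_
  -- For f = (p + q)/2, writing B for the form, B(q,h) = B(h,p) gives 2B(f,h) + B(h,h) = B(p+h, p+h)
  -- - B(p,p). The first term is non-positive, and -B(p,p) is the capacity.
  · refine (iInf₂_le (fun η => 1 / 2 * p η + 1 / 2 * q η) ?_).trans ?_
    · refine ⟨fun η hη => ?_, ?_, ⟨1 / 2 * bp + 1 / 2 * bq, fun η hη => ?_⟩⟩
      · dsimp only
        rw [hpb.1 η hη, hqb.1 η hη]; norm_num
      · refine hasBoundary_iff_zero_wells.2 fun z hzx hzy η hη => ?_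
        rw [hpb.2.2 z hzx hzy η hη, hqb.2.2 z hzx hzy η hη]; norm_num
      · dsimp only
        rw [hpb.2.1 η hη, hqb.2.1 η hη]
    · refine iSup₂_le fun h hh => ?_
      obtain ⟨⟨bx, h1⟩, ⟨b, h2⟩, h3⟩ := hh
      have hhb : HasBoundary N l x y bx b h := ⟨h1, h2, hasBoundary_iff_zero_wells.1 h3⟩
      rw [EReal.coe_le_coe_iff, functional_eq hL α hN]
      refine mul_le_mul_of_nonneg_left ?_ hc.le
      rw [bform_add_left, bform_smul_left, bform_smul_left, hBq hhb, ← hBp hhb]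
      have e1 : bform α (N - 1) (fun η => p η + h η) (fun η => p η + h η) =
          bform α (N - 1) p p + bform α (N - 1) p h + bform α (N - 1) h p +
            bform α (N - 1) h h := by
        rw [bform_add_left, bform_add_right, bform_add_right]; ring
      have e2 := bform_self α (N - 1) fun η => p η + h η
      have e3 := energy_nonneg α (N - 1) fun η => p η + h η
      have e4 := hBp hpb
      linarith
  · refine le_iInf₂ fun f hf => ?_
    obtain ⟨h1, h2, ⟨b, h3⟩⟩ := hf
    have hfb : HasBoundary N l x y 1 b f := ⟨h1, h3, hasBoundary_iff_zero_wells.1 h2⟩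
    -- For every admissible f, the choice h = -p gives 2 cap - cap.
    refine le_iSup₂_of_le (fun η => -1 * p η) ?_ ?_
    · refine ⟨⟨-1, fun η hη => ?_⟩, ⟨-1 * bp, fun η hη => ?_⟩, ?_⟩
      · dsimp only
        rw [hpb.1 η hη, mul_one]
      · dsimp only
        rw [hpb.2.1 η hη]
      · refine hasBoundary_iff_zero_wells.2 fun z hzx hzy η hη => ?_
        rw [hpb.2.2 z hzx hzy η hη, mul_zero]
    · rw [EReal.coe_le_coe_iff, functional_eq hL α hN]
      refine mul_le_mul_of_nonneg_left ?_ hc.le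
      rw [bform_smul_right, bform_smul_right, bform_smul_left, hBp hfb, hBp hpb]
      linarith

/-! ### Conclusion -/

/-- The indicators of the wells add up to 1 on the wells, and constants do not contribute to the
form. -/
theorem sum_capEntry (hL : 2 ≤ L) (α : ℝ) {N : ℕ} (hN : 1 ≤ N) {l : ℝ} (hl : 2 * l < N)
    (y : ZMod L) :
    capEntry α N l y y = -∑ z ∈ Finset.univ.erase y, capEntry α N l z y := by
  have h1 : ∑ z, capEntry α N l z y = 0 := by
    have h2 : ∀ s : Finset (ZMod L), ∑ z ∈ s, capEntry α N l z y =
        bform α (N - 1) (fun η => ∑ z ∈ s, wellInd N l z η) (potential α N l y) := by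
      intro s
      induction s using Finset.induction_on with
      | empty => simp [bform_const_left]
      | insert z s hz ih =>
        simp only [Finset.sum_insert hz]
        rw [bform_add_left, ih]
        rfl
    rw [h2, (isPotential_potential α hl y).bform_congr hL hN (u' := fun _ => 1),
      bform_const_left]
    intro η hη
    obtain ⟨w, _, hw⟩ := mem_wells.1 hη
    rw [Finset.sum_eq_single_of_mem w (Finset.mem_univ w)
      fun z _ hzw => wellInd_zero hl hzw.symm hw, wellInd_one hw]
  rw [← Finset.add_sum_erase _ _ (Finset.mem_univ y)] at h1
  linarith

theorem tendsto_capEntry_self (hL : 2 ≤ L) {α : ℝ} (hα : 3 < α) {ℓ : ℕ → ℝ}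
    (hℓ : Tendsto ℓ atTop atTop)
    (hℓN : Tendsto (fun N : ℕ => ℓ N / (N : ℝ)) atTop (𝓝 0)) (y : ZMod L) :
    Tendsto (fun N : ℕ => (N : ℝ) ^ (1 + α) *
      (coefMu L α N * capEntry α N (ℓ N) y y)) atTop
      (𝓝 (-((L - 1) * (1 / (L * (Gam α * I α)))))) := by
  have h1 := (tendsto_finsetSum (Finset.univ.erase y) fun z hz =>
    tendsto_capEntry hL hα hℓ hℓN (Finset.ne_of_mem_erase hz)).neg
  rw [Finset.sum_const, Finset.card_erase_of_mem (Finset.mem_univ y), Finset.card_univ,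
    ZMod.card, nsmul_eq_mul, Nat.cast_sub (by omega), Nat.cast_one] at h1
  refine h1.congr' ?_
  filter_upwards [eventually_ge_atTop 1, eventually_two_mul_lt hℓN two_pos] with N hN hl
  rw [sum_capEntry hL α hN hl y, mul_neg, mul_neg, Finset.mul_sum, Finset.mul_sum]

theorem tendsto_pairCap (hL : 2 ≤ L) {α : ℝ} (hα : 3 < α) {ℓ : ℕ → ℝ}
    (hℓ : Tendsto ℓ atTop atTop)
    (hℓN : Tendsto (fun N : ℕ => ℓ N / (N : ℝ)) atTop (𝓝 0)) {x y : ZMod L} (hxy : x ≠ y) :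
    Tendsto (fun N : ℕ => (N : ℝ) ^ (1 + α) * (coefMu L α N * pairCap α N (ℓ N) x y)) atTop
      (𝓝 (1 / (Gam α * I α) * (((L : ℝ) - 2) / ((L : ℝ) - 1)))) := by
  have hG := Gam_pos hα
  have hI := I_pos (by linarith : 0 < α)
  have hL2 : (2 : ℝ) ≤ L := by exact_mod_cast hL
  have hL1 : (0 : ℝ) < (L : ℝ) - 1 := by linarith
  have hLpos : (0 : ℝ) < L := by linarith
  have hθ : 0 < 1 / (L * (Gam α * I α)) := by positivity
  have hxx := tendsto_capEntry_self hL hα hℓ hℓN x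
  have hyy := tendsto_capEntry_self hL hα hℓ hℓN y
  have h1 := tendsto_capEntry hL hα hℓ hℓN hxy
  have h2 := tendsto_capEntry hL hα hℓ hℓN hxy.symm
  have h3 := (hxx.sub ((h2.mul h1).div hyy (neg_ne_zero.2 (mul_pos hL1 hθ).ne'))).neg
  -- With θ = 1/(L Γ I) this is (L-1)θ - θ/(L-1) = Lθ(L-2)/(L-1).
  have e1 : -(-(((L : ℝ) - 1) * (1 / (L * (Gam α * I α)))) -
      1 / (L * (Gam α * I α)) * (1 / (L * (Gam α * I α))) /
        -(((L : ℝ) - 1) * (1 / (L * (Gam α * I α))))) =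
      1 / (Gam α * I α) * (((L : ℝ) - 2) / ((L : ℝ) - 1)) := by
    field_simp
    ring
  rw [e1] at h3
  refine h3.congr' ?_
  filter_upwards [eventually_ge_atTop 1,
    hyy.eventually_ne (neg_ne_zero.2 (mul_pos hL1 hθ).ne')] with N hN hne
  have hK : (0 : ℝ) < (N : ℝ) ^ (1 + α) := Real.rpow_pos_of_pos (by exact_mod_cast hN) _
  have hc := coefMu_pos (L := L) α hN
  have hne' : capEntry α N (ℓ N) y y ≠ 0 := fun h => hne (by rw [h, mul_zero, mul_zero])
  unfold pairCap
  simp only [Pi.div_apply]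
  generalize (N : ℝ) ^ (1 + α) = K at *
  field_simp

theorem meanRate_eq_capEntry (hL : 2 ≤ L) (α : ℝ) {N : ℕ} (hN : 1 ≤ N) {l : ℝ} (hl : 2 * l < N)
    {x y : ZMod L} (hxy : x ≠ y) :
    meanRate α N l y x =
      coefMu L α N * capEntry α N l y x / ∑ η ∈ well N l y, mu α N η := by
  rw [meanRate_eq α hl hxy.symm, capEntry, ← inner_gen' hL α hN, one_div, inv_mul_eq_div]
  congr 1
  unfold inner wellInd
  simp only [ite_mul, one_mul, zero_mul, mul_ite, mul_zero]
  rw [← Finset.sum_filter]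
  refine Finset.sum_congr ?_ fun _ _ => rfl
  ext η
  rw [Finset.mem_filter]
  exact ⟨fun h => ⟨(mem_well.1 h).1, h⟩, fun h => h.2⟩

end ZeroRange

end

theorem proposition5p2 (L : ℕ) [NeZero L] (α : ℝ) (hα : 3 < α) (ℓ : ℕ → ℝ)
    (hℓ : Filter.Tendsto ℓ Filter.atTop Filter.atTop)
    (hℓN : Filter.Tendsto (fun N : ℕ => ℓ N / (N : ℝ)) Filter.atTop (nhds 0))
    (x y : ZMod L) (hxy : x ≠ y) :
    Filter.Tendsto
        (fun N : ℕ => (((N : ℝ) ^ (1 + α) : ℝ) : EReal) * ZeroRange.infG α N (ℓ N) x y)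
        Filter.atTop
        (nhds ((1 / (ZeroRange.Gam α * ZeroRange.I α) * (((L : ℝ) - 2) / ((L : ℝ) - 1)) : ℝ) :
          EReal)) ∧
      Filter.Tendsto
        (fun N : ℕ => (N : ℝ) ^ (1 + α) * ZeroRange.meanRate α N (ℓ N) y x)
        Filter.atTop
        (nhds (1 / (ZeroRange.Gam α * ZeroRange.I α))) := by
  open ZeroRange Filter Topology in
  -- Two distinct sites exclude L = 1.
  have hL : 2 ≤ L := by
    by_contra h
    have h1 : L = 1 := by have := NeZero.ne L; omega
    subst h1
    exact hxy (Subsingleton.elim x y)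
  have hL2 : (2 : ℝ) ≤ L := by exact_mod_cast hL
  have hG := Gam_pos hα
  have hI := I_pos (by linarith : 0 < α)
  have hθ : 0 < ((L : ℝ) - 1) * (1 / (L * (Gam α * I α))) :=
    mul_pos (by linarith) (one_div_pos.2 (mul_pos (by linarith) (mul_pos hG hI)))
  have hne : ∀ z : ZMod L, ∀ᶠ N : ℕ in atTop, capEntry α N (ℓ N) z z ≠ 0 := by
    intro z
    filter_upwards [(tendsto_capEntry_self hL hα hℓ hℓN z).eventually_ne
      (neg_ne_zero.2 hθ.ne')] with N hN h
    exact hN (by rw [h, mul_zero, mul_zero])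
  constructor
  · refine (EReal.tendsto_coe.2 (tendsto_pairCap hL hα hℓ hℓN hxy)).congr' ?_
    filter_upwards [eventually_ge_atTop 1, eventually_two_mul_lt hℓN two_pos, hne y, hne (-y)]
      with N hN hl h1 h2
    rw [infG_eq hL α hN hl hxy h1 h2, ← EReal.coe_mul]
  · have h1 := (tendsto_capEntry hL hα hℓ hℓN hxy.symm).div (tendsto_mu_well hα hℓ hℓN y)
      (one_div_pos.2 (by linarith)).ne'
    have e1 : 1 / (L * (Gam α * I α)) / (1 / (L : ℝ)) = 1 / (Gam α * I α) := by
      have : (L : ℝ) ≠ 0 := by linarith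
      field_simp
    rw [e1] at h1
    refine h1.congr' ?_
    filter_upwards [eventually_ge_atTop 1, eventually_two_mul_lt hℓN two_pos] with N hN hl
    rw [meanRate_eq_capEntry hL α hN hl hxy, Pi.div_apply, mul_div_assoc]
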